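/- **Hurwitz numbers.** For $g\ge 0$, $n\ge 1$ and positive integers $b_1,\dots,b_n$ put $d=b_1+\cdots+b_n$ and $m=2g-1+n$. Let $h_{g,b_1,\dots,b_n}$ be the number of isomorphism classes of connected degree $d$ ramified coverings of the sphere which are totally ramified over $0$, have $n$ labelled preimages of $\infty$ with multiplicities $b_1,\dots,b_n$, and have one simple ramification over each of $m$ fixed further points, each class being counted with weight $1/|\mathrm{Aut}|$. Coverings are described by their monodromy: tuples $(\sigma_0,t_1,\dots,t_m,\sigma_\infty)$ of permutations of $\{1,\dots,d\}$ with $\sigma_0t_1\cdots t_m\sigma_\infty=1$, $\sigma_0$ a $d$-cycle, the $t_i$ transpositions and the cycles of $\sigma_\infty$ labelled by $1,\dots,n$ with the $i$-th one of length $b_i$; isomorphism is simultaneous conjugation preserving the labels, and automorphisms are the permutations fixing all these data. **Intersection numbers.** The numbers $\langle\lambda_{2j}\tau_{d_1}\cdots\tau_{d_n}\rangle\in\mathbb{Q}$ are defined by the Goulden–Jackson–Vakil formula: for all $g\ge 0$, $n\ge 1$ with $(g,n)\ne(0,1),(0,2)$ and all positive integers $b_1,\dots,b_n$, $$\frac{h_{g,b_1,\dots,b_n}}{d\cdot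 m!}=\sum_{j=0}^{g}(-1)^j\sum_{\substack{d_1,\dots,d_n\ge 0\\ d_1+\cdots+d_n=4g-3+n-2j}}\langle\lambda_{2j}\tau_{d_1}\cdots\tau_{d_n}\rangle\, b_1^{d_1}\cdots b_n^{d_n},$$ and $\langle\lambda_{2j}\tau_{d_1}\cdots\tau_{d_n}\rangle=0$ unless $4g-3+n=2j+d_1+\cdots+d_n$ for some integer $g\ge j$. **Operators and series.** We work with formal power series in $q_1,q_2,\dots$ whose coefficients are formal Laurent series in $u$ over $\mathbb{C}$; infinite sums are taken coefficientwise (each coefficient of a monomial in $u$ and the $q_i$ receives finitely many contributions). Let $$\Lambda_0=\sum_{i\ge1}q_i\,i\frac{\partial}{\partial q_i},\qquad \Lambda_1=\sum_{i\ge2}q_i\,(i-1)\frac{\partial}{\partial q_{i-1}},$$ $$M_a=\frac12\sum_{\substack{i,j\ge1\\ i+j>a}}q_iq_j\,(i+j-a)\frac{\partial}{\partial q_{i+j-a}}+\frac12\sum_{i,j\ge1}q_{i+j+a}\,ij\frac{\partial^2}{\partial q_i\partial q_j}\qquad(a=0,1,2),$$ $T_0=q_1$, $T_{k+1}=(u\Lambda_0+\Lambda_1)T_k$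 for $k\ge 0$, and $$G(u,q_1,q_2,\dots)=\sum_{j,k_0,k_1,\dots}(-1)^j\langle\lambda_{2j}\tau_0^{k_0}\tau_1^{k_1}\cdots\rangle\,u^{2j+1}\,\frac{T_0^{k_0}}{k_0!}\frac{T_1^{k_1}}{k_1!}\cdots,$$ where the sum is over $j\ge0$ and finitely supported sequences $(k_0,k_1,\dots)$ of non-negative integers. For a Laurent series $c=c(u)$ let $$\tau=c(u)+\frac{q_1+q_1q_2}{u}+q_1^2+\left(\Lambda_0+\frac1u\Lambda_1\right)^2G(u,q_1,q_2,\dots).$$ **Theorem.** There is exactly one family of numbers $\langle\lambda_{2j}\tau_{d_1}\cdots\tau_{d_n}\rangle$ as above, the sum defining $G$ converges coefficientwise, and for every Laurent series $c(u)$ the exponential series below converges coefficientwise and $$\tau=\exp\left(M_2+2uM_1+u^2M_0\right)\left(c(u)+\frac{q_1}{u}\right),$$ where $\exp(A)f=\sum_{k\ge0}\frac1{k!}A^kf$. -/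

import Mathlib

namespace GJV

/-! ### Hurwitz numbers -/

/-- The monodromy data of a connected ramified covering of the sphere of degree `d = ∑ i, b i`
whose sheets over a base point are numbered by `Fin d`, and whose `n` preimages of `∞` are
labelled so that the `i`-th one has multiplicity `b i`:
* `zero` is the monodromy at `0`; it is a single cycle of length `d` (total ramification);
* `swap i` is the monodromy at the `i`-th of `m` further points (simple ramification);
* `infty` is the monodromy at `∞`; its cycles are the preimages of `∞`, the length of a cycle is
  the multiplicity of the preimage, and `label` gives the label of the cycle of a sheet.
The covering surface is connected because `zero` acts transitively on the sheets. -/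
@[ext]
structure Covering {n : ℕ} (m : ℕ) (b : Fin n → ℕ) where
  zero : Equiv.Perm (Fin (∑ i, b i))
  swap : Fin m → Equiv.Perm (Fin (∑ i, b i))
  infty : Equiv.Perm (Fin (∑ i, b i))
  label : Fin (∑ i, b i) → Fin n
  zero_full : ∀ x y, zero.SameCycle x y
  swap_isSwap : ∀ i, (swap i).IsSwap
  prod_eq_one : zero * (List.ofFn swap).prod * infty = 1
  label_eq_iff : ∀ x y, label x = label y ↔ infty.SameCycle x y
  card_label : ∀ i, Nat.card {x // label x = i} = b i

/-- Renumbering the sheets. Two coverings are isomorphic (respecting the labels over `∞`) iff they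
lie in the same orbit, and the stabilizer is the automorphism group of the covering. -/
instance {n : ℕ} (m : ℕ) (b : Fin n → ℕ) :
    MulAction (Equiv.Perm (Fin (∑ i, b i))) (Covering m b) where
  smul r X :=
    { zero := r * X.zero * r⁻¹
      swap := fun i => r * X.swap i * r⁻¹
      infty := r * X.infty * r⁻¹
      label := fun x => X.label (r⁻¹ x)
      zero_full := fun x y => by
        rw [Equiv.Perm.sameCycle_conj]; exact X.zero_full _ _
      swap_isSwap := fun i => by
        obtain ⟨x, y, hxy, h⟩ := X.swap_isSwap i
        refine ⟨r x, r y, fun h' => hxy (r.injective h'), ?_⟩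
        rw [h, Equiv.swap_apply_apply]
      prod_eq_one := by
        have h1 : (List.ofFn fun i => r * X.swap i * r⁻¹).prod
            = r * (List.ofFn X.swap).prod * r⁻¹ := by
          have := map_list_prod (MulAut.conj r) (List.ofFn X.swap)
          rw [List.map_ofFn] at this
          simpa [MulAut.conj_apply, Function.comp_def] using this.symm
        have h2 := X.prod_eq_one
        rw [h1]
        calc r * X.zero * r⁻¹ * (r * (List.ofFn X.swap).prod * r⁻¹) * (r * X.infty * r⁻¹)
            = r * (X.zero * (List.ofFn X.swap).prod * X.infty) * r⁻¹ := by group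
          _ = 1 := by rw [h2]; group
      label_eq_iff := fun x y => by
        rw [Equiv.Perm.sameCycle_conj]; exact X.label_eq_iff _ _
      card_label := fun i => by
        rw [← X.card_label i]
        exact Nat.card_congr ((r⁻¹).subtypeEquiv fun x => Iff.rfl) }
  one_smul X := by
    ext <;> simp [HSMul.hSMul]
  mul_smul r s X := by
    ext <;> simp [HSMul.hSMul, mul_assoc]

/-- The Hurwitz number `h_{g, b₁, …, bₙ}`: the number of isomorphism classes of coverings with
`m = 2 g - 1 + n` simple ramifications, each counted with the inverse of the order of its
automorphism group. -/
noncomputable def hurwitz (g : ℕ) {n : ℕ} (b : Fin n → ℕ) : ℚ :=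
  ∑ᶠ ω : MulAction.orbitRel.Quotient (Equiv.Perm (Fin (∑ i, b i))) (Covering (2 * g + n - 1) b),
    (1 : ℚ) / Nat.card (MulAction.stabilizer (Equiv.Perm (Fin (∑ i, b i))) ω.out)

/-! ### The intersection numbers -/

/-- `I j [d₁, …, dₙ]` are the intersection numbers `⟨λ_{2j} τ_{d₁} ⋯ τ_{dₙ}⟩`: they satisfy
`h_{g,b} / (d ⋅ m!) = ∫_{X_{g,n}} (1 - λ₂ + ⋯ ± λ_{2g}) / ∏ i, (1 - bᵢ ψᵢ)` for all `(g, n)` other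
than `(0, 1)` and `(0, 2)` and all `b`, where the integral is expanded with `dim X_{g,n} = 4g-3+n`,
and the numbers that do not occur in any of these expansions are zero. -/
structure IsIntersectionNumbers (I : ℕ → List ℕ → ℚ) : Prop where
  hurwitz_eq : ∀ (g n : ℕ), 1 ≤ n → 3 ≤ 2 * g + n → ∀ b : Fin n → ℕ, (∀ i, 0 < b i) →
    hurwitz g b / ((∑ i, b i : ℕ) * (2 * g + n - 1).factorial : ℚ) =
      ∑ j ∈ Finset.range (g + 1),
        (-1) ^ j * ∑ d ∈ Finset.piAntidiag Finset.univ (4 * g + n - 3 - 2 * j),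
          I j (List.ofFn d) * ∏ i, (b i : ℚ) ^ d i
  eq_zero : ∀ (j : ℕ) (d : List ℕ),
    (¬ ∃ g, j ≤ g ∧ 4 * g + d.length = 2 * j + d.sum + 3) → I j d = 0

/-! ### Formal series in `q₁, q₂, …` over Laurent series in `u` -/

/-- Formal power series in `q₁, q₂, …` whose coefficients are formal Laurent series in `u`. -/
abbrev Series : Type := MvPowerSeries ℕ+ (LaurentSeries ℂ)

/-- The parameter `u`. -/
noncomputable abbrev u : LaurentSeries ℂ := HahnSeries.single 1 1

/-- The variable `q_i`. -/
noncomputable abbrev q (i : ℕ+) : Series := MvPowerSeries.X i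

/-- `S` is the sum of the family `a` of series: for each monomial in `u` and the `q_i`, only
finitely many members of the family contribute to its coefficient, and the contributions add up
to the coefficient in `S`. -/
def HasFormalSum {ι : Type*} (a : ι → Series) (S : Series) : Prop :=
  ∀ (s : ℕ+ →₀ ℕ) (e : ℤ),
    {i | (MvPowerSeries.coeff s (a i)).coeff e ≠ 0}.Finite ∧
    (MvPowerSeries.coeff s S).coeff e = ∑ᶠ i, (MvPowerSeries.coeff s (a i)).coeff e

/-- The family `a` can be summed. -/
def FormallySummable {ι : Type*} (a : ι → Series) : Prop := ∃ S, HasFormalSum a S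

open Classical in
/-- The sum of the family `a` (zero if it cannot be summed). -/
noncomputable def formalSum {ι : Type*} (a : ι → Series) : Series :=
  if h : FormallySummable a then h.choose else 0

/-- The terms `A^k f / k!` of the exponential series. -/
noncomputable def expTerm (A : Series → Series) (f : Series) (k : ℕ) : Series :=
  ((k.factorial : LaurentSeries ℂ)⁻¹) • (A^[k] f)

/-- `exp(A) f = ∑_k A^k f / k!`. -/
noncomputable def formalExp (A : Series → Series) (f : Series) : Series :=
  formalSum (expTerm A f)

/-- The operator `n ∂/∂q_n`, which is zero for `n = 0`. -/
noncomputable def D (n : ℕ) (f : Series) : Series :=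
  if h : 0 < n then (n : Series) * MvPowerSeries.pderiv (LaurentSeries ℂ) ⟨n, h⟩ f else 0

/-- `Λ_a = ∑_i q_i (i-a) ∂/∂q_{i-a}`, over `i ≥ 1` with `i - a ≥ 1`. -/
noncomputable def Λ (a : ℕ) (f : Series) : Series :=
  formalSum fun i : ℕ+ => q i * D (i - a) f

/-- `M_a = 1/2 ∑ q_i q_j (i+j-a) ∂/∂q_{i+j-a} + 1/2 ∑ q_{i+j+a} i j ∂²/∂q_i∂q_j`, over `i, j ≥ 1`
(and `i + j - a ≥ 1` in the first sum). -/
noncomputable def M (a : ℕ) (f : Series) : Series :=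
  (1 / 2 : LaurentSeries ℂ) • (formalSum fun p : ℕ+ × ℕ+ => q p.1 * q p.2 * D (p.1 + p.2 - a) f) +
  (1 / 2 : LaurentSeries ℂ) • (formalSum fun p : ℕ+ × ℕ+ =>
    q ⟨p.1 + p.2 + a, by positivity⟩ * D p.1 (D p.2 f))

/-! ### The series `G` and `τ` -/

/-- `T₀ = q₁`, `T_{k+1} = (u Λ₀ + Λ₁) T_k`. -/
noncomputable def T : ℕ → Series
  | 0 => q 1
  | k + 1 => (u • Λ 0 + Λ 1) (T k)

/-- The term of `G` with index `(j, k₀, k₁, …)`: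
`(-1)^j ⟨λ_{2j} τ₀^{k₀} τ₁^{k₁} ⋯⟩ u^{2j+1} (T₀^{k₀}/k₀!) (T₁^{k₁}/k₁!) ⋯`. -/
noncomputable def gTerm (I : ℕ → List ℕ → ℚ) (x : ℕ × (ℕ →₀ ℕ)) : Series :=
  ((-1) ^ x.1 * (I x.1 (Finsupp.toMultiset x.2).toList : LaurentSeries ℂ) * u ^ (2 * x.1 + 1)) •
    x.2.prod fun i k => ((k.factorial : LaurentSeries ℂ)⁻¹) • T i ^ k

/-- The generating series `G(u, q₁, q₂, …)` of the intersection numbers `I`. -/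
noncomputable def G (I : ℕ → List ℕ → ℚ) : Series := formalSum (gTerm I)

/-- `τ = c(u) + (q₁ + q₁ q₂)/u + q₁² + (Λ₀ + Λ₁/u)² G`. -/
noncomputable def tau (I : ℕ → List ℕ → ℚ) (c : LaurentSeries ℂ) : Series :=
  MvPowerSeries.C c + u⁻¹ • (q 1 + q 1 * q 2) + q 1 ^ 2 + (Λ 0 + u⁻¹ • Λ 1)^[2] (G I)

end GJV

/-! Hurwitz numbers and the exponential series are both iterates of one operator, the cut-and-join
operator `cutJoin` on functions of lists `[b₁, …, bₙ]`, which joins two entries or cuts one in two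
and keeps the total `d`. A series enters through its n-point functions (`nPoint`): apply the
derivations attached to `b₁, …, bₙ` and take the constant coefficient.

Hurwitz side. For the derivations `k ∂/∂q_k` the operator `M_0` becomes `cutJoin`
(`nPoint_Ml_zero`). On the cycle type monomial of a permutation `M_0` is the sum over all products
with a transposition (`Ml_zero_cycleMon`), so counting monodromy tuples gives `∏ bᵢ · d · h =
cutJoin^m onePoint` (`hurwitz_eq`). This evolution has a closed solution: `cutJoin^m onePoint / m!`
is `d^m` times the coefficient of `t^m` in `∏ 2 sinh(bᵢt/2) / 2 sinh(t/2)`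
(`cutJoin_iterate_onePoint`). Hence `h / (d · m!)` is a symmetric polynomial in the `bᵢ` whose
homogeneous parts are indexed by `j`. A polynomial is determined by its values at positive integers,
so its coefficients are the intersection numbers, and there is no other choice
(`existsUnique_intersectionNumbers`).

Exponential side. Identify `k ∂/∂q_k` with `z^k`. The double commutator of `P` and `Q` with `A = M_2
+ 2uM_1 + u²M_0` is `(1 + uz)² P' Q'` (`comm_comm_Al`). So for the derivations given by `(1 + uz)^b`
(`pointOp`) the operator `A` becomes `u² · cutJoin` (`nPoint_Al`). In this model `Λ_0 + u⁻¹Λ_1`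
multiplies n-point functions by `d` (`nPoint_eulerOp`), and `T_k` has the one-point function
`(bu)^(k+1)` and no other (`pointOp_Tl`).

Give `q_i` weight `i` and `u` weight one. The part of `G` of weight `2m` has n-point functions
`u^(2m) ∏ bᵢ · h / (d · m!)` if `m = 2g - 1 + n` for some `g`, and zero otherwise. Two applications
of `Λ_0 + u⁻¹Λ_1` turn it into `A^m (q_1/u) / m!` for `m ≥ 2` (`eulerOp_eulerOp_gPart`), because a
series is determined by its n-point functions when `u ≠ 0` (`eq_zero_of_nPoint_eq_zero`). The cases
`m = 0, 1` belong to `(g, n) = (0, 1), (0, 2)` and are the explicit terms of `τ`. Different `m` have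
different weights, so the parts assemble coefficientwise (`hasFormalSum_eulerOp_gPart`). -/

namespace GJV

open MvPowerSeries
open Finset.HasAntidiagonal (antidiagonal)

variable {K : Type*} [Field K]

/-! ### Sums that are finite in each coefficient -/

section FormalSums

variable {ι : Type*} {a a' : ι → MvPowerSeries ℕ+ K}

/-- Each monomial in the `q_i` occurs in finitely many members of the family. -/
def CoeffFinite (a : ι → MvPowerSeries ℕ+ K) : Prop := ∀ s, {i | coeff s (a i) ≠ 0}.Finite

/-- The sum of a family that is finite in each monomial. -/
noncomputable def coeffSum (a : ι → MvPowerSeries ℕ+ K) : MvPowerSeries ℕ+ K :=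
  fun s => ∑ᶠ i, coeff s (a i)

theorem coeff_coeffSum (a : ι → MvPowerSeries ℕ+ K) (s : ℕ+ →₀ ℕ) :
    coeff s (coeffSum a) = ∑ᶠ i, coeff s (a i) := rfl

theorem coeffSum_add (h : CoeffFinite a) (h' : CoeffFinite a') :
    coeffSum (fun i => a i + a' i) = coeffSum a + coeffSum a' := by
  ext1 s
  simp only [map_add, coeff_coeffSum]
  exact finsum_add_distrib (h s) (h' s)

theorem coeffSum_smul (c : K) (h : CoeffFinite a) :
    coeffSum (fun i => c • a i) = c • coeffSum a := by
  ext1 s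
  simp only [coeff_smul, coeff_coeffSum]
  exact (mul_finsum' _ _ (h s)).symm

theorem CoeffFinite.add (h : CoeffFinite a) (h' : CoeffFinite a') :
    CoeffFinite fun i => a i + a' i := by
  intro s
  refine ((h s).union (h' s)).subset fun i hi => ?_
  by_contra h0
  simp only [Set.mem_union, Set.mem_ofPred_eq, not_or, not_not] at h0
  exact hi (by rw [map_add, h0.1, h0.2, add_zero])

theorem coeffSum_sum {κ : Type*} (T : Finset κ) (b : κ → ι → MvPowerSeries ℕ+ K)
    (h : ∀ k ∈ T, CoeffFinite (b k)) :
    coeffSum (fun i => ∑ k ∈ T, b k i) = ∑ k ∈ T, coeffSum (b k) := by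
  ext1 s
  simp only [map_sum, coeff_coeffSum]
  exact (finsum_sum_comm T _ fun k hk => h k hk s)

end FormalSums

theorem coeff_X_mul_eq_zero {i : ℕ+} {s : ℕ+ →₀ ℕ} (h : s i = 0) (f : MvPowerSeries ℕ+ K) :
    coeff s (X i * f) = 0 :=
  X_dvd_iff.1 (dvd_mul_right _ _) s h

/-- Only indices whose variable lies in the finite support of the monomial can contribute, so finite
fibres of `v` suffice, whatever `g` is. -/
theorem coeffFinite_q_mul {ι : Type*} (v : ι → ℕ+) (hv : ∀ n, {i | v i = n}.Finite)
    (g : ι → MvPowerSeries ℕ+ K) : CoeffFinite fun i => X (v i) * g i := by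
  intro s
  refine (s.support.finite_toSet.biUnion fun n _ => hv n).subset fun i hi => ?_
  simp only [Set.mem_iUnion, Finset.mem_coe, Finsupp.mem_support_iff, Set.mem_ofPred_eq]
  exact ⟨v i, fun h => hi (coeff_X_mul_eq_zero h _), rfl⟩

theorem coeffFinite_q_mul_self (g : ℕ+ → MvPowerSeries ℕ+ K) : CoeffFinite fun i => X i * g i :=
  coeffFinite_q_mul id (fun n => by simp) g

theorem coeffFinite_q_mul_q_mul (g : ℕ+ × ℕ+ → MvPowerSeries ℕ+ K) :
    CoeffFinite fun p : ℕ+ × ℕ+ => X p.1 * X p.2 * g p := by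
  intro s
  refine (s.support.finite_toSet.prod s.support.finite_toSet).subset fun p hp => ?_
  simp only [Set.mem_prod, Finset.mem_coe, Finsupp.mem_support_iff]
  refine ⟨fun h => hp ?_, fun h => hp ?_⟩ <;> beta_reduce
  · rw [mul_assoc, coeff_X_mul_eq_zero h]
  · rw [mul_comm (X p.1), mul_assoc, coeff_X_mul_eq_zero h]

/-- The index `i + j + a` as a positive integer. -/
def addIdx (a : ℕ) (p : ℕ+ × ℕ+) : ℕ+ := ⟨p.1 + p.2 + a, by positivity⟩

theorem coe_addIdx (a : ℕ) (p : ℕ+ × ℕ+) : (addIdx a p : ℕ) = p.1 + p.2 + a := rfl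

theorem finite_addIdx_eq (a : ℕ) (n : ℕ+) : {p | addIdx a p = n}.Finite := by
  refine ((Set.finite_Iic n).prod (Set.finite_Iic n)).subset fun p hp => ?_
  have h := congrArg PNat.val hp
  rw [coe_addIdx] at h
  simp only [Set.mem_prod, Set.mem_Iic, ← PNat.coe_le_coe]
  omega

theorem coeffFinite_q_addIdx_mul (a : ℕ) (g : ℕ+ × ℕ+ → MvPowerSeries ℕ+ K) :
    CoeffFinite fun p : ℕ+ × ℕ+ => X (addIdx a p) * g p :=
  coeffFinite_q_mul _ (finite_addIdx_eq a) g

/-! ### The operators as linear maps -/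

/-- `n ∂/∂q_n` as a linear map. -/
noncomputable def Dl (n : ℕ) : Module.End K (MvPowerSeries ℕ+ K) :=
  if h : 0 < n then (n : K) • (pderiv K ⟨n, h⟩).toLinearMap else 0

theorem Dl_apply {n : ℕ} (h : 0 < n) (f : MvPowerSeries ℕ+ K) :
    Dl n f = (n : MvPowerSeries ℕ+ K) * pderiv K ⟨n, h⟩ f := by
  rw [Dl, dif_pos h, LinearMap.smul_apply, Nat.cast_smul_eq_nsmul, nsmul_eq_mul]
  rfl

theorem Dl_zero : (Dl 0 : Module.End K (MvPowerSeries ℕ+ K)) = 0 := by simp [Dl]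

theorem Dl_mul (n : ℕ) (f g : MvPowerSeries ℕ+ K) : Dl n (f * g) = Dl n f * g + f * Dl n g := by
  rcases Nat.eq_zero_or_pos n with rfl | h
  · simp [Dl_zero]
  · simp only [Dl_apply h, Derivation.leibniz, smul_eq_mul]
    ring

theorem Dl_coe (n : ℕ+) (f : MvPowerSeries ℕ+ K) :
    Dl n f = ((n : ℕ) : MvPowerSeries ℕ+ K) * pderiv K n f := Dl_apply n.pos f

theorem Dl_q (n : ℕ) (i : ℕ+) : Dl n (X i) = if (i : ℕ) = n then (n : MvPowerSeries ℕ+ K) else 0 := by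
  rcases Nat.eq_zero_or_pos n with rfl | h
  · simp [Dl_zero]
  lift n to ℕ+ using h
  rw [Dl_coe]
  split_ifs with h'
  · rw [PNat.eq h', pderiv_X_self, mul_one]
  · rw [pderiv_X_of_ne fun e => h' (by rw [e]), mul_zero]

theorem coeff_Dl (n : ℕ+) (f : MvPowerSeries ℕ+ K) (s : ℕ+ →₀ ℕ) :
    coeff s (Dl n f) = (n : K) * ((s n + 1) * coeff (s + Finsupp.single n 1) f) := by
  unfold Dl
  rw [dif_pos n.pos]
  simp only [LinearMap.smul_apply, coeff_smul]
  congr 1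
  rw [mul_comm _ (coeff _ _)]
  exact coeff_pderiv f s

theorem Dl_natCast (n k : ℕ) : Dl n (k : MvPowerSeries ℕ+ K) = 0 := by
  unfold Dl
  split_ifs with h
  · simp
  · simp

theorem Dl_comm (m n : ℕ) (f : MvPowerSeries ℕ+ K) : Dl m (Dl n f) = Dl n (Dl m f) := by
  rcases Nat.eq_zero_or_pos m with rfl | hm
  · simp [Dl_zero]
  rcases Nat.eq_zero_or_pos n with rfl | hn
  · simp [Dl_zero]
  lift m to ℕ+ using hm
  lift n to ℕ+ using hn
  ext1 s
  simp only [coeff_Dl, Finsupp.add_apply]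
  rw [add_right_comm]
  by_cases h : m = n
  · subst h; ring
  · rw [Finsupp.single_eq_of_ne h, Finsupp.single_eq_of_ne (Ne.symm h)]
    push_cast; ring

theorem Dl_coeffSum {ι : Type*} {a : ι → MvPowerSeries ℕ+ K} (n : ℕ) (h : CoeffFinite a) :
    Dl n (coeffSum a) = coeffSum fun i => Dl n (a i) := by
  rcases Nat.eq_zero_or_pos n with rfl | hn
  · ext1 s
    simp [Dl_zero, coeff_coeffSum]
  lift n to ℕ+ using hn
  ext1 s
  simp only [coeff_Dl, coeff_coeffSum]
  rw [← mul_finsum' _ _ ?_, ← mul_finsum' _ _ (h _)]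
  refine (h (s + Finsupp.single n 1)).subset fun i hi h0 => hi ?_
  beta_reduce
  rw [h0, mul_zero]

/-- `Λ_a` as a linear map. -/
noncomputable def Λl (a : ℕ) : Module.End K (MvPowerSeries ℕ+ K) where
  toFun f := coeffSum fun i : ℕ+ => X i * Dl (i - a) f
  map_add' f g := by
    simp only [map_add, mul_add]
    exact coeffSum_add (coeffFinite_q_mul_self _) (coeffFinite_q_mul_self _)
  map_smul' c f := by
    simp only [map_smul, mul_smul_comm]
    exact coeffSum_smul _ (coeffFinite_q_mul_self _)

theorem Λl_apply (a : ℕ) (f : MvPowerSeries ℕ+ K) :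
    Λl a f = coeffSum fun i : ℕ+ => X i * Dl (i - a) f := rfl

/-- The part of `M_a` with one derivative. -/
noncomputable def cutl (a : ℕ) : Module.End K (MvPowerSeries ℕ+ K) where
  toFun f := coeffSum fun p : ℕ+ × ℕ+ => X p.1 * X p.2 * Dl (p.1 + p.2 - a) f
  map_add' f g := by
    simp only [map_add, mul_add]
    exact coeffSum_add (coeffFinite_q_mul_q_mul _) (coeffFinite_q_mul_q_mul _)
  map_smul' c f := by
    simp only [map_smul, mul_smul_comm]
    exact coeffSum_smul _ (coeffFinite_q_mul_q_mul _)

/-- The part of `M_a` with two derivatives. -/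
noncomputable def joinl (a : ℕ) : Module.End K (MvPowerSeries ℕ+ K) where
  toFun f := coeffSum fun p : ℕ+ × ℕ+ => X (addIdx a p) * Dl p.1 (Dl p.2 f)
  map_add' f g := by
    simp only [map_add, mul_add]
    exact coeffSum_add (coeffFinite_q_addIdx_mul a _) (coeffFinite_q_addIdx_mul a _)
  map_smul' c f := by
    simp only [map_smul, mul_smul_comm]
    exact coeffSum_smul _ (coeffFinite_q_addIdx_mul a _)

theorem cutl_apply (a : ℕ) (f : MvPowerSeries ℕ+ K) :
    cutl a f = coeffSum fun p : ℕ+ × ℕ+ => X p.1 * X p.2 * Dl (p.1 + p.2 - a) f := rfl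

theorem joinl_apply (a : ℕ) (f : MvPowerSeries ℕ+ K) :
    joinl a f = coeffSum fun p : ℕ+ × ℕ+ => X (addIdx a p) * Dl p.1 (Dl p.2 f) := rfl

/-- `M_a` as a linear map. -/
noncomputable def Ml (a : ℕ) : Module.End K (MvPowerSeries ℕ+ K) :=
  (1 / 2 : K) • cutl a + (1 / 2 : K) • joinl a

theorem constantCoeff_coeffSum {ι : Type*} (a : ι → MvPowerSeries ℕ+ K) :
    constantCoeff (coeffSum a) = ∑ᶠ i, constantCoeff (a i) := by
  simp only [← coeff_zero_eq_constantCoeff_apply, coeff_coeffSum]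

theorem constantCoeff_Λl (a : ℕ) (f : MvPowerSeries ℕ+ K) : constantCoeff (Λl a f) = 0 := by
  rw [Λl_apply, constantCoeff_coeffSum]
  simp [constantCoeff_X]

theorem constantCoeff_Ml (a : ℕ) (f : MvPowerSeries ℕ+ K) : constantCoeff (Ml a f) = 0 := by
  rw [Ml]
  simp only [LinearMap.add_apply, LinearMap.smul_apply, cutl_apply, joinl_apply, map_add,
    constantCoeff_smul, constantCoeff_coeffSum,
    map_mul, constantCoeff_X, zero_mul, finsum_zero, smul_zero, add_zero]

end GJV

namespace GJV

open MvPowerSeries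
open Finset.HasAntidiagonal (antidiagonal)

variable {K : Type*} [Field K]

/-! ### Commutators -/

section Reindex

variable {ι κ : Type*} {a : ι → MvPowerSeries ℕ+ K}

/-- Serves to pass from `ℕ+ × ℕ+` to `ℕ × ℕ`, where antidiagonals live, and to single out the rows
and columns of a double sum. -/
theorem coeffSum_comp {g : κ → ι} (hg : g.Injective) (h : ∀ i, i ∉ Set.range g → a i = 0) :
    coeffSum (fun k => a (g k)) = coeffSum a := by
  ext1 s
  rw [coeff_coeffSum, coeff_coeffSum, ← finsum_mem_range (f := fun i => coeff s (a i)) hg]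
  refine (finsum_mem_inter_support_eq _ _ Set.univ ?_).trans (finsum_mem_univ _)
  ext i
  simp only [Set.mem_inter_iff, Set.mem_univ, true_and, and_iff_right_iff_imp]
  intro hi
  by_contra h0
  exact hi (by beta_reduce; rw [h i h0, map_zero])

theorem CoeffFinite.of_comp {g : κ → ι} (h : ∀ i, i ∉ Set.range g → a i = 0)
    (hf : CoeffFinite fun k => a (g k)) : CoeffFinite a := by
  intro s
  refine ((hf s).image g).subset fun i hi => ?_
  by_cases h0 : i ∈ Set.range g
  · obtain ⟨k, rfl⟩ := h0
    exact ⟨k, hi, rfl⟩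
  · exact absurd (by rw [h i h0, map_zero]) hi

theorem coeffFinite_of_finset {T : Finset ι} (h : ∀ i, i ∉ T → a i = 0) : CoeffFinite a := by
  intro s
  refine T.finite_toSet.subset fun i hi => ?_
  by_contra h0
  exact hi (by rw [h i h0, map_zero])

theorem coeffSum_eq_sum {T : Finset ι} (h : ∀ i, i ∉ T → a i = 0) :
    coeffSum a = ∑ i ∈ T, a i := by
  ext1 s
  rw [coeff_coeffSum, map_sum]
  refine finsum_eq_sum_of_support_subset _ fun i hi => ?_
  by_contra h0
  exact hi (by beta_reduce; rw [h i h0, map_zero])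

end Reindex

/-- Leibniz: the derivative either hits the factor `X k` or passes through. The truncated `k - a` is
harmless because `Dl 0 = 0`. -/
theorem Dl_Λl (k a : ℕ) (f : MvPowerSeries ℕ+ K) :
    Dl k (Λl a f) = (k : K) • Dl (k - a) f + Λl a (Dl k f) := by
  rcases Nat.eq_zero_or_pos k with rfl | hk
  · simp [Dl_zero]
  lift k to ℕ+ using hk
  rw [Λl_apply, Dl_coeffSum _ (coeffFinite_q_mul_self _)]
  simp only [Dl_mul, Dl_q, PNat.coe_inj]
  have h1 : ∀ i, i ∉ ({k} : Finset ℕ+) →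
      (if i = k then ((k : ℕ) : MvPowerSeries ℕ+ K) else 0) * Dl (i - a) f = 0 := by
    intro i hi
    rw [if_neg (by simpa using hi), zero_mul]
  rw [coeffSum_add (coeffFinite_of_finset h1) (coeffFinite_q_mul_self _), coeffSum_eq_sum h1,
    Finset.sum_singleton, if_pos rfl, Λl_apply, Nat.cast_smul_eq_nsmul, nsmul_eq_mul]
  simp only [Dl_comm k]

/-- The part with one derivative of the commutator of `∂/∂q_k` with `M_a`. -/
noncomputable def attach (a k : ℕ) (f : MvPowerSeries ℕ+ K) : MvPowerSeries ℕ+ K :=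
  coeffSum fun j : ℕ+ => X j * Dl (k + j - a) f

theorem constantCoeff_attach (a k : ℕ) (f : MvPowerSeries ℕ+ K) : constantCoeff (attach a k f) = 0 := by
  rw [attach, constantCoeff_coeffSum]
  simp [constantCoeff_X]

theorem Dl_attach (a k l : ℕ) (f : MvPowerSeries ℕ+ K) :
    Dl l (attach a k f) = (l : K) • Dl (k + l - a) f + attach a k (Dl l f) := by
  rcases Nat.eq_zero_or_pos l with rfl | hk
  · simp [Dl_zero, attach, coeffSum_eq_sum (T := ∅)]
  lift l to ℕ+ using hk
  rw [attach, Dl_coeffSum _ (coeffFinite_q_mul_self _)]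
  simp only [Dl_mul, Dl_q, PNat.coe_inj]
  have h1 : ∀ i, i ∉ ({l} : Finset ℕ+) →
      (if i = l then ((l : ℕ) : MvPowerSeries ℕ+ K) else 0) * Dl (k + i - a) f = 0 := by
    intro i hi
    rw [if_neg (by simpa using hi), zero_mul]
  rw [coeffSum_add (coeffFinite_of_finset h1) (coeffFinite_q_mul_self _), coeffSum_eq_sum h1,
    Finset.sum_singleton, if_pos rfl, attach, Nat.cast_smul_eq_nsmul, nsmul_eq_mul]
  simp only [Dl_comm l]

/-- The derivative may hit either of the two factors `X p.1` and `X p.2`; by symmetry the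
contributions agree, whence the factor 2, which cancels the 1/2 in `Ml`. -/
theorem Dl_cutl (k a : ℕ) (f : MvPowerSeries ℕ+ K) :
    Dl k (cutl a f) = (2 * k : K) • attach a k f + cutl a (Dl k f) := by
  rcases Nat.eq_zero_or_pos k with rfl | hk
  · simp [Dl_zero]
  lift k to ℕ+ using hk
  rw [cutl_apply, Dl_coeffSum _ (coeffFinite_q_mul_q_mul _)]
  simp only [Dl_mul, Dl_q, PNat.coe_inj, add_mul]
  have i1 : (fun j : ℕ+ => (k, j)).Injective := fun _ _ h => (Prod.mk.inj h).2
  have i2 : (fun j : ℕ+ => (j, k)).Injective := fun _ _ h => (Prod.mk.inj h).1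
  have h1 : ∀ p, p ∉ Set.range (fun j : ℕ+ => (k, j)) →
      (if p.1 = k then ((k : ℕ) : MvPowerSeries ℕ+ K) else 0) * X p.2 * Dl (p.1 + p.2 - a) f = 0 := by
    rintro ⟨i, j⟩ hi
    rw [if_neg, zero_mul, zero_mul]
    rintro rfl
    exact hi ⟨j, rfl⟩
  have h2 : ∀ p, p ∉ Set.range (fun j : ℕ+ => (j, k)) →
      X p.1 * (if p.2 = k then ((k : ℕ) : MvPowerSeries ℕ+ K) else 0) * Dl (p.1 + p.2 - a) f = 0 := by
    rintro ⟨i, j⟩ hi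
    rw [if_neg, mul_zero, zero_mul]
    rintro rfl
    exact hi ⟨i, rfl⟩
  have e1 : (fun j : ℕ+ => (if (k, j).1 = k then ((k : ℕ) : MvPowerSeries ℕ+ K) else 0) *
      X (k, j).2 *
      Dl ((k, j).1 + (k, j).2 - a) f) =
      fun j : ℕ+ => (k : K) • (X j * Dl (k + j - a) f) := by
    ext1 j
    rw [if_pos rfl, Nat.cast_smul_eq_nsmul, nsmul_eq_mul, mul_assoc]
  have e2 : (fun j : ℕ+ => (X (j, k).1 : MvPowerSeries ℕ+ K) *
      (if (j, k).2 = k then ((k : ℕ) : MvPowerSeries ℕ+ K) else 0) *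
      Dl ((j, k).1 + (j, k).2 - a) f) =
      fun j : ℕ+ => (k : K) • (X j * Dl (k + j - a) f) := by
    ext1 j
    rw [if_pos rfl, Nat.cast_smul_eq_nsmul, nsmul_eq_mul, mul_comm (X _), mul_assoc,
      add_comm (k : ℕ)]
  have hf : CoeffFinite fun j : ℕ+ => (k : K) • (X j * Dl (k + j - a) f) := by
    simp only [← mul_smul_comm]
    exact coeffFinite_q_mul_self _
  have f1 := CoeffFinite.of_comp h1 (by rw [e1]; exact hf)
  have f2 := CoeffFinite.of_comp h2 (by rw [e2]; exact hf)
  rw [coeffSum_add (f1.add f2) (coeffFinite_q_mul_q_mul _), coeffSum_add f1 f2,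
    ← coeffSum_comp i1 h1, ← coeffSum_comp i2 h2, e1, e2,
    coeffSum_smul _ (coeffFinite_q_mul_self _), cutl_apply, attach, two_mul, add_smul]
  simp only [Dl_comm k]

/-- The part with two derivatives of the commutator of `∂/∂q_k` with `M_a`. -/
noncomputable def splitSum (a k : ℕ) (f : MvPowerSeries ℕ+ K) : MvPowerSeries ℕ+ K :=
  if a ≤ k then ∑ p ∈ antidiagonal (k - a), Dl p.1 (Dl p.2 f) else 0

theorem Dl_splitSum (a k l : ℕ) (f : MvPowerSeries ℕ+ K) :
    Dl l (splitSum a k f) = splitSum a k (Dl l f) := by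
  unfold splitSum
  split_ifs
  · simp only [map_sum, Dl_comm l]
  · simp

theorem Dl_joinl (k a : ℕ) (f : MvPowerSeries ℕ+ K) :
    Dl k (joinl a f) = (k : K) • splitSum a k f + joinl a (Dl k f) := by
  rcases Nat.eq_zero_or_pos k with rfl | hk
  · simp [Dl_zero]
  lift k to ℕ+ using hk
  rw [joinl_apply, Dl_coeffSum _ (coeffFinite_q_addIdx_mul a _)]
  simp only [Dl_mul, Dl_q]
  -- The summand is extended to pairs of natural numbers; pairs with a zero entry contribute nothing
  -- because `Dl 0 = 0`.
  let b : ℕ × ℕ → MvPowerSeries ℕ+ K := fun p =>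
    (if p.1 + p.2 + a = k then ((k : ℕ) : MvPowerSeries ℕ+ K) else 0) * Dl p.1 (Dl p.2 f)
  have ig : (fun p : ℕ+ × ℕ+ => ((p.1 : ℕ), (p.2 : ℕ))).Injective := by
    rintro ⟨i, j⟩ ⟨i', j'⟩ h
    simpa using h
  have h1 : ∀ p, p ∉ Set.range (fun p : ℕ+ × ℕ+ => ((p.1 : ℕ), (p.2 : ℕ))) → b p = 0 := by
    rintro ⟨i, j⟩ hp
    rcases Nat.eq_zero_or_pos i with rfl | hi
    · simp [b, Dl_zero]
    rcases Nat.eq_zero_or_pos j with rfl | hj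
    · simp [b, Dl_zero]
    exact absurd ⟨(⟨i, hi⟩, ⟨j, hj⟩), rfl⟩ hp
  have h2 : ∀ p, p ∉ (if a ≤ k then antidiagonal (k - a) else ∅) → b p = 0 := by
    rintro ⟨i, j⟩ hp
    simp only [b]
    rw [if_neg, zero_mul]
    rintro h
    rw [if_pos (by omega), Finset.HasAntidiagonal.mem_antidiagonal] at hp
    simp only at hp
    omega
  have hc := coeffSum_comp ig h1
  have hf : CoeffFinite fun p : ℕ+ × ℕ+ => b (p.1, p.2) := fun s =>
    ((coeffFinite_of_finset h2 s).preimage ig.injOn)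
  change coeffSum (fun p : ℕ+ × ℕ+ => b (p.1, p.2) +
    X (addIdx a p) * Dl k (Dl p.1 (Dl p.2 f))) = _
  rw [coeffSum_add hf (coeffFinite_q_addIdx_mul a _), hc, coeffSum_eq_sum h2, joinl_apply]
  simp only [Dl_comm k]
  congr 1
  unfold splitSum
  split_ifs with hak
  · rw [Finset.smul_sum]
    refine Finset.sum_congr rfl fun p hp => ?_
    rw [Finset.HasAntidiagonal.mem_antidiagonal] at hp
    simp only [b]
    rw [if_pos (by omega), Nat.cast_smul_eq_nsmul, nsmul_eq_mul]
  · simp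

theorem Dl_Ml [CharZero K] (k a : ℕ) (f : MvPowerSeries ℕ+ K) :
    Dl k (Ml a f) = (k : K) • (attach a k f + (1 / 2 : K) •
      splitSum a k f) + Ml a (Dl k f) := by
  simp only [Ml, LinearMap.add_apply, LinearMap.smul_apply, map_add, map_smul, Dl_cutl, Dl_joinl,
    smul_add, smul_smul]
  rw [show (1 / 2 : K) * (2 * k) = k by field_simp, mul_comm (1 / 2 : K)]
  abel

end GJV

namespace GJV

open MvPowerSeries
open Finset.HasAntidiagonal (antidiagonal)

/-! ### The cut-and-join operator on functions of lists -/

section CutJoin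

variable {V : Type*} [AddCommGroup V] [Module ℚ V]

/-- The contribution of one point `b` to the cut-and-join operator. -/
noncomputable def insertPoint (b : ℕ) : (List ℕ → V) → List ℕ → V
  | F, [] => (b / 2 : ℚ) • ∑ p ∈ antidiagonal b, F [p.1, p.2]
  | F, c :: l => (b * c : ℚ) • F ((b + c) :: l) + insertPoint b (fun l' => F (c :: l')) l

/-- The cut-and-join operator on `n`-point functions. -/
noncomputable def cutJoin : (List ℕ → V) → List ℕ → V
  | _, [] => 0
  | F, b :: l => insertPoint b F l + cutJoin (fun l' => F (b :: l')) l

theorem map_insertPoint {W : Type*} [AddCommGroup W] [Module ℚ W] (g : V →+ W) (b : ℕ)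
    (l : List ℕ) (F : List ℕ → V) :
    g (insertPoint b F l) = insertPoint b (fun l => g (F l)) l := by
  induction l generalizing F with
  | nil => simp only [insertPoint, map_rat_smul, map_sum]
  | cons c l ih => simp only [insertPoint, map_add, map_rat_smul, ih]

theorem map_cutJoin {W : Type*} [AddCommGroup W] [Module ℚ W] (g : V →+ W)
    (l : List ℕ) (F : List ℕ → V) :
    g (cutJoin F l) = cutJoin (fun l => g (F l)) l := by
  induction l generalizing F with
  | nil => simp only [cutJoin, map_zero]
  | cons c l ih => simp only [cutJoin, map_add, map_insertPoint, ih]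

theorem insertPoint_congr (b : ℕ) (l : List ℕ) (F F' : List ℕ → V)
    (h : ∀ l' : List ℕ, l' ≠ [] → l'.sum = b + l.sum → F l' = F' l') :
    insertPoint b F l = insertPoint b F' l := by
  induction l generalizing F F' with
  | nil =>
    simp only [insertPoint]
    congr 1
    refine Finset.sum_congr rfl fun p hp => h _ (by simp) ?_
    rw [Finset.HasAntidiagonal.mem_antidiagonal] at hp
    simpa using hp
  | cons c l ih =>
    simp only [insertPoint]
    rw [h _ (by simp) (by simp; ring), ih _ _ fun l' _ hl' => h _ (by simp) (by simp [hl']; ring)]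

/-- The operator keeps the total of a list and never evaluates at the empty list. Quantities
depending only on `l.sum` may therefore be treated as constants. -/
theorem cutJoin_congr (l : List ℕ) (F F' : List ℕ → V)
    (h : ∀ l' : List ℕ, l' ≠ [] → l'.sum = l.sum → F l' = F' l') :
    cutJoin F l = cutJoin F' l := by
  induction l generalizing F F' with
  | nil => rfl
  | cons b l ih =>
    simp only [cutJoin]
    rw [insertPoint_congr b l F F' fun l' h0 hl' => h _ h0 (by simpa using hl'),
      ih _ _ fun l' _ hl' => h _ (by simp) (by simp [hl'])]

end CutJoin

/-! ### n-point functions and an abstract criterion for the cut-and-join equation -/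

section NPoint

variable {K E : Type*} [Field K] [AddCommGroup E] [Module K E]

/-- The `n`-point functions of `f` with respect to the operators `δ` and the evaluation `ε`. -/
def nPoint (δ : ℕ → Module.End K E) (ε : E →ₗ[K] K) : E → List ℕ → K
  | f, [] => ε f
  | f, b :: l => nPoint δ ε (δ b f) l

variable (δ : ℕ → Module.End K E) (ε : E →ₗ[K] K)

theorem nPoint_cons (f : E) (b : ℕ) (l : List ℕ) :
    nPoint δ ε f (b :: l) = nPoint δ ε (δ b f) l := rfl

theorem nPoint_add (f g : E) (l : List ℕ) :
    nPoint δ ε (f + g) l = nPoint δ ε f l + nPoint δ ε g l := by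
  induction l generalizing f g with
  | nil => exact map_add ε f g
  | cons b l ih => simp only [nPoint, map_add, ih]

theorem nPoint_smul (c : K) (f : E) (l : List ℕ) :
    nPoint δ ε (c • f) l = c * nPoint δ ε f l := by
  induction l generalizing f with
  | nil => exact map_smul ε c f
  | cons b l ih => simp only [nPoint, map_smul, ih]

theorem nPoint_sum {ι : Type*} (T : Finset ι) (f : ι → E) (l : List ℕ) :
    nPoint δ ε (∑ i ∈ T, f i) l = ∑ i ∈ T, nPoint δ ε (f i) l := by
  induction l generalizing f with
  | nil => exact map_sum ε f T
  | cons b l ih => simp only [nPoint, map_sum, ih]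

/-- The operators `δ b` are moved past `A` one at a time, each leaving its commutator `R b`. When `R
b` is moved past a later `δ b'`, the double commutator merges the two points (join); when `R b`
reaches the evaluation, it splits `b` (cut). Stated abstractly so that it applies both to `Dl` with
`Ml 0` and to `pointOp u` with `Al u`. -/
theorem nPoint_eq_cutJoin [CharZero K] (A : Module.End K E) (R : ℕ → E → E) (c : K)
    (hA : ∀ b f, δ b (A f) = R b f + A (δ b f))
    (hR : ∀ b b' f, δ b' (R b f) = (c * (b * b')) • δ (b + b') f + R b (δ b' f))
    (hεA : ∀ f, ε (A f) = 0)
    (hεR : ∀ b f, ε (R b f) = c * (b / 2 * ∑ p ∈ antidiagonal b, ε (δ p.2 (δ p.1 f))))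
    (f : E) (l : List ℕ) :
    nPoint δ ε (A f) l = c * cutJoin (nPoint δ ε f) l := by
  have hins : ∀ (b : ℕ) (l : List ℕ) (f : E),
      nPoint δ ε (R b f) l = c * insertPoint b (nPoint δ ε f) l := by
    intro b l
    induction l with
    | nil =>
      intro f
      simp only [nPoint, insertPoint, hεR, Rat.smul_def, Rat.cast_div, Rat.cast_natCast, Rat.cast_ofNat]
    | cons b' l ih =>
      intro f
      simp only [nPoint, insertPoint, hR, nPoint_add, nPoint_smul, ih, Rat.smul_def]
      push_cast
      rw [mul_add, mul_assoc]
  induction l generalizing f with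
  | nil => simp only [nPoint, cutJoin, hεA, mul_zero]
  | cons b l ih =>
    simp only [nPoint, cutJoin, hA, nPoint_add, hins, ih, mul_add]

end NPoint

/-! ### The two instances of the cut-and-join equation -/

variable {K : Type*} [Field K]

/-- The constant coefficient as a linear map. -/
noncomputable def constCoeff : MvPowerSeries ℕ+ K →ₗ[K] K := coeff 0

theorem constCoeff_apply (f : MvPowerSeries ℕ+ K) : constCoeff f = constantCoeff f :=
  coeff_zero_eq_constantCoeff_apply f

theorem nPoint_Ml_zero [CharZero K] (f : MvPowerSeries ℕ+ K) (l : List ℕ) :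
    nPoint Dl constCoeff (Ml 0 f) l = cutJoin (nPoint Dl constCoeff f) l := by
  refine (nPoint_eq_cutJoin Dl constCoeff (Ml 0)
    (fun k f => (k : K) • (attach 0 k f + (1 / 2 : K) • splitSum 0 k f)) 1
    ?_ ?_ ?_ ?_ f l).trans (one_mul _)
  · exact fun b f => Dl_Ml b 0 f
  · intro b b' f
    simp only [map_smul, map_add, Dl_attach, Dl_splitSum, tsub_zero]
    rw [add_assoc, smul_add, smul_smul, one_mul]
  · exact fun f => by rw [constCoeff_apply, constantCoeff_Ml]
  · intro b f
    rw [constCoeff_apply]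
    simp only [constantCoeff_smul, map_add, constantCoeff_attach, splitSum, zero_le, if_true,
      map_sum, constCoeff_apply, tsub_zero, smul_eq_mul, zero_add]
    rw [one_mul, ← mul_assoc, mul_one_div]
    simp only [Dl_comm]

/-- The operator `M_2 + 2uM_1 + u²M_0`. -/
noncomputable def Al (u : K) : Module.End K (MvPowerSeries ℕ+ K) :=
  Ml 2 + (2 * u) • Ml 1 + u ^ 2 • Ml 0

/-- The linear extension of `z^k ↦ k ∂/∂q_k`. -/
noncomputable def opOf : Polynomial K →ₗ[K] Module.End K (MvPowerSeries ℕ+ K) :=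
  Polynomial.lsum fun k => LinearMap.toSpanSingleton K _ (Dl k)

theorem opOf_monomial (k : ℕ) (c : K) : opOf (Polynomial.monomial k c) = c • Dl k := by
  simp [opOf]

/-- The commutator of two operators. -/
def comm {R : Type*} [Ring R] (a b : R) : R := a * b - b * a

section Comm

variable {R : Type*} [Ring R] [Algebra K R]

theorem comm_add (a b c : R) : comm a (b + c) = comm a b + comm a c := by
  unfold comm; noncomm_ring

theorem comm_add_left (a b c : R) : comm (a + b) c = comm a c + comm b c := by
  unfold comm; noncomm_ring

theorem comm_smul (t : K) (a b : R) : comm a (t • b) = t • comm a b := by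
  unfold comm; rw [mul_smul_comm, smul_mul_assoc, smul_sub]

theorem comm_smul_left (t : K) (a b : R) : comm (t • a) b = t • comm a b := by
  unfold comm; rw [mul_smul_comm, smul_mul_assoc, smul_sub]

end Comm

theorem comm_apply (a b : Module.End K (MvPowerSeries ℕ+ K)) (f : MvPowerSeries ℕ+ K) :
    comm a b f = a (b f) - b (a f) := rfl

theorem comm_Ml_apply [CharZero K] (a k : ℕ) (f : MvPowerSeries ℕ+ K) :
    comm (Dl k) (Ml a) f = (k : K) • (attach a k f + (1 / 2 : K) • splitSum a k f) := by
  rw [comm_apply, Dl_Ml, add_sub_cancel_right]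

/-- `splitSum` has constant coefficients and commutes with every `Dl l`; only the factor `X j` in
`attach` is seen by the second commutator. -/
theorem comm_comm_Ml [CharZero K] (a k l : ℕ) :
    comm (Dl l : Module.End K (MvPowerSeries ℕ+ K)) (comm (Dl k) (Ml a)) =
      (k * l : K) • Dl (k + l - a) := by
  ext1 f
  rw [comm_apply, comm_Ml_apply, comm_Ml_apply, LinearMap.smul_apply]
  simp only [map_smul, map_add, Dl_attach, Dl_splitSum]
  module

/-- With `Dl k` as `z^k`, the operators `M_2`, `M_1`, `M_0` contribute `P' Q'` times `1`, `z`, `z²`;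
the weights `1`, `2u`, `u²` complete the square `(1 + uz)²`. This is why the combination `Al`
appears. -/
theorem comm_comm_Al [CharZero K] (u : K) (P Q : Polynomial K) :
    comm (opOf P) (comm (opOf Q) (Al u)) =
      opOf ((1 + Polynomial.C u * Polynomial.X) ^ 2 * (Polynomial.derivative P *
        Polynomial.derivative Q)) := by
  induction P using Polynomial.induction_on' with
  | add P P' h h' =>
    rw [map_add, comm_add_left, h, h', ← map_add, Polynomial.derivative_add]; congr 1; ring
  | monomial l c =>
    induction Q using Polynomial.induction_on' with
    | add P P' h h' =>
      rw [map_add, comm_add_left, comm_add, h, h', ← map_add, Polynomial.derivative_add]; congr 1; ring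
    | monomial k d =>
      have h1 : (1 + Polynomial.C u * Polynomial.X) ^ 2 = Polynomial.monomial 0 1 +
          Polynomial.monomial 1 (2 * u) + Polynomial.monomial 2 (u ^ 2) := by
        simp only [← Polynomial.C_mul_X_pow_eq_monomial, map_mul, map_pow, map_one,
          Polynomial.C_ofNat]
        ring
      rw [opOf_monomial, opOf_monomial, comm_smul_left, comm_smul_left, comm_smul, smul_smul, Al, h1]
      simp only [comm_add, comm_smul, comm_comm_Ml, Polynomial.derivative_monomial, add_mul,
        Polynomial.monomial_mul_monomial, map_add, opOf_monomial]
      -- For a zero exponent both sides vanish; otherwise the truncated subtractions below are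
      -- genuine.
      rcases Nat.eq_zero_or_pos k with rfl | hk
      · simp
      rcases Nat.eq_zero_or_pos l with rfl | hl
      · simp
      rw [show 0 + (l - 1 + (k - 1)) = k + l - 2 by omega,
        show 1 + (l - 1 + (k - 1)) = k + l - 1 by omega,
        show 2 + (l - 1 + (k - 1)) = k + l - 0 by omega]
      module

end GJV

/-! ### Point operators and the degree operator -/

namespace GJV

open MvPowerSeries
open Finset.HasAntidiagonal (antidiagonal)

variable {K : Type*} [Field K]

/-- The operator `b ∂/∂p_b`, where `q_k = u^k ∑_b (b-1 choose k-1) p_b`. -/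
noncomputable def pointOp (u : K) (b : ℕ) : Module.End K (MvPowerSeries ℕ+ K) :=
  opOf ((1 + Polynomial.C u * Polynomial.X) ^ b)

theorem pointOp_zero (u : K) : pointOp u 0 = 0 := by
  rw [pointOp, pow_zero, ← Polynomial.monomial_zero_one, opOf_monomial, Dl_zero, smul_zero]

theorem pointOp_eq_sum (u : K) {b N : ℕ} (h : b < N) :
    pointOp u b = ∑ k ∈ Finset.range N, (b.choose k * u ^ k : K) • Dl k := by
  have h1 : (1 + Polynomial.C u * Polynomial.X) ^ b =
      ∑ k ∈ Finset.range (b + 1), Polynomial.monomial k (b.choose k * u ^ k : K) := by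
    rw [add_comm, add_pow]
    refine Finset.sum_congr rfl fun k _ => ?_
    rw [one_pow, mul_one, mul_pow, ← Polynomial.C_mul_X_pow_eq_monomial]
    simp only [map_mul, map_pow, map_natCast]
    ring
  rw [pointOp, h1, map_sum]
  simp only [opOf_monomial]
  refine Finset.sum_subset (Finset.range_mono h) fun k _ hk => ?_
  rw [Nat.choose_eq_zero_of_lt (by simpa using hk), Nat.cast_zero, zero_mul, zero_smul]

/-- The powers of `1 + uz` are eigenvectors of `(1 + uz) d/dz`. Both commutator relations of
`pointOp` below rest on this. -/
theorem derivative_one_add_pow (u : K) (b : ℕ) :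
    (1 + Polynomial.C u * Polynomial.X) * Polynomial.derivative
      ((1 + Polynomial.C u * Polynomial.X) ^ b) =
      (b * u : K) • (1 + Polynomial.C u * Polynomial.X) ^ b := by
  rw [Polynomial.derivative_pow, Polynomial.smul_eq_C_mul]
  cases b with
  | zero => simp
  | succ b =>
    simp only [Polynomial.derivative_add, Polynomial.derivative_one, Polynomial.derivative_mul,
      Polynomial.derivative_C, Polynomial.derivative_X, Nat.add_sub_cancel, map_mul,
      map_natCast]
    ring

theorem comm_comm_pointOp [CharZero K] (u : K) (b b' : ℕ) :
    comm (pointOp u b') (comm (pointOp u b) (Al u)) =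
      (u ^ 2 * (b * b') : K) • pointOp u (b + b') := by
  rw [pointOp, pointOp, comm_comm_Al, pointOp, ← map_smul]
  congr 1
  have h := derivative_one_add_pow u b
  have h' := derivative_one_add_pow u b'
  rw [Polynomial.smul_eq_C_mul] at h h'
  rw [sq, mul_mul_mul_comm, h, h', Polynomial.smul_eq_C_mul, pow_add]
  simp only [map_mul, map_natCast, map_pow]
  ring

/-- The operator `Λ_0 + u⁻¹ Λ_1`. -/
noncomputable def eulerOp (u : K) : Module.End K (MvPowerSeries ℕ+ K) := Λl 0 + u⁻¹ • Λl 1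

theorem comm_eulerOp (u : K) (P : Polynomial K) :
    comm (opOf P) (eulerOp u) =
      opOf ((Polynomial.X + Polynomial.C u⁻¹) * Polynomial.derivative P) := by
  induction P using Polynomial.induction_on' with
  | add P P' h h' =>
    rw [map_add, comm_add_left, h, h', ← map_add, Polynomial.derivative_add]; congr 1; ring
  | monomial k c =>
    have h : ∀ a : ℕ, comm (Dl k : Module.End K (MvPowerSeries ℕ+ K)) (Λl a) =
        (k : K) • Dl (k - a) := fun a => by
      ext1 f
      rw [comm_apply, Dl_Λl, add_sub_cancel_right, LinearMap.smul_apply]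
    rw [opOf_monomial, comm_smul_left, eulerOp, comm_add, comm_smul, h, h,
      Polynomial.derivative_monomial, add_mul, map_add, Polynomial.X_mul_monomial,
      Polynomial.C_mul_monomial, opOf_monomial, opOf_monomial]
    cases k with
    | zero => simp
    | succ k => rw [Nat.add_sub_cancel, tsub_zero]; module

/-- The commutator with `eulerOp u` acts on polynomials as `(z + u⁻¹) d/dz = u⁻¹ (1 + uz) d/dz`,
which has eigenvalue `b` on `(1 + uz)^b`. -/
theorem pointOp_eulerOp {u : K} (hu : u ≠ 0) (b : ℕ) (f : MvPowerSeries ℕ+ K) :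
    pointOp u b (eulerOp u f) = (b : K) • pointOp u b f + eulerOp u (pointOp u b f) := by
  rw [← sub_eq_iff_eq_add, ← comm_apply, ← LinearMap.smul_apply]
  congr 1
  rw [pointOp, comm_eulerOp, ← map_smul]
  congr 1
  have h := derivative_one_add_pow u b
  have h1 : (Polynomial.X + Polynomial.C u⁻¹ : Polynomial K) =
      Polynomial.C u⁻¹ * (1 + Polynomial.C u * Polynomial.X) := by
    rw [mul_add, ← mul_assoc, ← map_mul, inv_mul_cancel₀ hu, map_one]; ring
  rw [h1, mul_assoc, h, Polynomial.smul_eq_C_mul, Polynomial.smul_eq_C_mul, ← mul_assoc,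
    ← map_mul]
  congr 2
  field_simp

theorem constCoeff_eulerOp (u : K) (f : MvPowerSeries ℕ+ K) : constCoeff (eulerOp u f) = 0 := by
  rw [eulerOp, LinearMap.add_apply, LinearMap.smul_apply, map_add, map_smul, constCoeff_apply,
    constCoeff_apply, constantCoeff_Λl, constantCoeff_Λl, smul_zero, add_zero]

/-- Each point passed contributes its multiplicity, and the operator itself dies under the constant
coefficient. -/
theorem nPoint_eulerOp {u : K} (hu : u ≠ 0) (f : MvPowerSeries ℕ+ K) (l : List ℕ) :
    nPoint (pointOp u) constCoeff (eulerOp u f) l =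
      (l.sum : K) * nPoint (pointOp u) constCoeff f l := by
  induction l generalizing f with
  | nil => simp only [nPoint, constCoeff_eulerOp, List.sum_nil, Nat.cast_zero, zero_mul]
  | cons b l ih =>
    simp only [nPoint, pointOp_eulerOp hu, nPoint_add, nPoint_smul, ih, List.sum_cons]
    push_cast
    ring

/-! ### The cut-and-join equation for `A` -/

/-- Counts the subsets of `b + 1` ordered points with `i + j + 1` elements according to the element
that has exactly `i` others before it. -/
theorem sum_antidiagonal_choose_mul_choose (b i j : ℕ) :
    ∑ p ∈ antidiagonal b, p.1.choose i * p.2.choose j = (b + 1).choose (i + j + 1) := by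
  induction b generalizing i with
  | zero => cases i <;> cases j <;> simp [Nat.choose_eq_zero_of_lt]
  | succ b ih =>
    rw [Finset.Nat.sum_antidiagonal_succ]
    cases i with
    | zero =>
      have := ih 0
      simp only [Nat.choose_zero_right, one_mul, zero_add] at this ⊢
      rw [this, Nat.choose_succ_succ (b + 1) j]
    | succ i =>
      simp only [Nat.choose_succ_succ _ i, add_mul, Finset.sum_add_distrib, ih,
        Nat.choose_zero_succ, zero_mul, zero_add]
      rw [show i + 1 + j + 1 = (i + j + 1) + 1 by ring, Nat.choose_succ_succ (b + 1)]

/-- The sum over `i, j` with `i + j + a = k`, as a sum over a square. -/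
theorem sum_antidiagonal_eq_sum_range {M : Type*} [AddCommMonoid M] {a k N : ℕ} (h : k < N)
    (g : ℕ → ℕ → M) :
    (if a ≤ k then ∑ p ∈ antidiagonal (k - a), g p.1 p.2 else 0) =
      ∑ i ∈ Finset.range N, ∑ j ∈ Finset.range N, if i + j + a = k then g i j else 0 := by
  rw [← Finset.sum_product', ← Finset.sum_filter]
  split_ifs with hak
  · refine Finset.sum_congr ?_ fun _ _ => rfl
    ext ⟨i, j⟩
    simp only [Finset.HasAntidiagonal.mem_antidiagonal, Finset.mem_filter, Finset.mem_product,
      Finset.mem_range]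
    omega
  · rw [Finset.filter_false_of_mem, Finset.sum_empty]
    rintro ⟨i, j⟩ -
    simp only
    omega

/-- The vanishing of `w` from `N` on takes care of the pairs in the square with `i + j + a ≥ N`. -/
theorem sum_range_mul_sum_antidiagonal {a N : ℕ} (w : ℕ → K) (hw : ∀ k, N ≤ k → w k = 0)
    (g : ℕ → ℕ → K) :
    ∑ k ∈ Finset.range N, w k *
      (if a ≤ k then ∑ p ∈ antidiagonal (k - a), g p.1 p.2 else 0) =
      ∑ i ∈ Finset.range N, ∑ j ∈ Finset.range N, w (i + j + a) * g i j := by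
  have h : ∀ k ∈ Finset.range N, w k *
      (if a ≤ k then ∑ p ∈ antidiagonal (k - a), g p.1 p.2 else 0) =
      ∑ i ∈ Finset.range N, ∑ j ∈ Finset.range N, if i + j + a = k then w k * g i j else 0 := by
    intro k hk
    rw [sum_antidiagonal_eq_sum_range (Finset.mem_range.1 hk), Finset.mul_sum]
    simp only [Finset.mul_sum, mul_ite, mul_zero]
  rw [Finset.sum_congr rfl h, Finset.sum_comm]
  refine Finset.sum_congr rfl fun i _ => ?_
  rw [Finset.sum_comm]
  refine Finset.sum_congr rfl fun j _ => ?_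
  rw [Finset.sum_ite_eq]
  split_ifs with h
  · rfl
  · rw [hw _ (by simpa using h), zero_mul]

/-- The coefficient of `z^(s+2)` in `(1 + z)² · d/dz (1 + z)^b = b (1 + z)^(b+1)`. -/
theorem choose_two_smul (b s : ℕ) :
    (s + 3) * b.choose (s + 3) + 2 * ((s + 2) * b.choose (s + 2)) + (s + 1) * b.choose (s + 1) =
      b * (b + 1).choose (s + 2) := by
  cases b with
  | zero => simp [Nat.choose_eq_zero_of_lt]
  | succ b =>
    have h : ∀ k, (k + 1) * (b + 1).choose (k + 1) = (b + 1) * b.choose k := fun k => by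
      rw [mul_comm, ← Nat.add_one_mul_choose_eq]
    have h0 : (s + 3) * (b + 1).choose (s + 3) = _ := h (s + 2)
    have h1 : (s + 2) * (b + 1).choose (s + 2) = _ := h (s + 1)
    have h2 := h s
    rw [h0, h1, h2, Nat.choose_succ_succ (b + 1) (s + 1), Nat.choose_succ_succ b (s + 1),
      Nat.choose_succ_succ b s]
    simp only [Nat.succ_eq_add_one]
    ring

/-- Both sides are linear in the numbers `constCoeff (Dl i (Dl j f))`, as `attach` has no constant
term. On the left the three summands of `Al` give the three binomials of `choose_two_smul`; on the
right the sum over splittings of `b` is `sum_antidiagonal_choose_mul_choose`. -/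
theorem constCoeff_comm_pointOp [CharZero K] (u : K) (b : ℕ) (f : MvPowerSeries ℕ+ K) :
    constCoeff (comm (pointOp u b) (Al u) f) =
      u ^ 2 * (b / 2 * ∑ p ∈ antidiagonal b,
        constCoeff (pointOp u p.2 (pointOp u p.1 f))) := by
  set g : ℕ → ℕ → K := fun i j => constCoeff (Dl i (Dl j f)) with hg
  set N := b + 1 with hN
  have hM : ∀ k a : ℕ, constCoeff (comm (Dl k) (Ml a) f) = (k / 2 : K) *
      (if a ≤ k then ∑ p ∈ antidiagonal (k - a), g p.1 p.2 else 0) := by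
    intro k a
    rw [comm_Ml_apply, map_smul, map_add, constCoeff_apply (attach _ _ _), constantCoeff_attach,
      zero_add, map_smul, smul_eq_mul, smul_eq_mul, ← mul_assoc, mul_one_div, splitSum]
    congr 1
    split_ifs
    · rw [map_sum]
    · rw [map_zero]
  let w : ℕ → K := fun k => b.choose k * u ^ k * (k / 2)
  have hw : ∀ k, N ≤ k → w k = 0 := fun k hk => by
    simp only [w]
    rw [Nat.choose_eq_zero_of_lt (by omega), Nat.cast_zero, zero_mul, zero_mul]
  have hL : ∀ a : ℕ, constCoeff (comm (pointOp u b) (Ml a) f) =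
      ∑ i ∈ Finset.range N, ∑ j ∈ Finset.range N, w (i + j + a) * g i j := by
    intro a
    rw [← sum_range_mul_sum_antidiagonal w hw, pointOp_eq_sum u (Nat.lt_succ_self b)]
    have : comm (∑ k ∈ Finset.range N, (b.choose k * u ^ k : K) • Dl k)
        (Ml a : Module.End K (MvPowerSeries ℕ+ K)) =
        ∑ k ∈ Finset.range N, (b.choose k * u ^ k : K) •
          comm (Dl k : Module.End K (MvPowerSeries ℕ+ K)) (Ml a) := by
      simp only [comm, Finset.sum_mul, Finset.mul_sum, smul_mul_assoc, mul_smul_comm,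
        ← Finset.sum_sub_distrib, smul_sub]
    rw [this, LinearMap.sum_apply, map_sum]
    refine Finset.sum_congr rfl fun k _ => ?_
    rw [LinearMap.smul_apply, map_smul, hM, smul_eq_mul, ← mul_assoc]
  have hR : ∀ p ∈ antidiagonal b, constCoeff (pointOp u p.2 (pointOp u p.1 f)) =
      ∑ i ∈ Finset.range N, ∑ j ∈ Finset.range N,
        (p.1.choose i * p.2.choose j : K) * (u ^ (i + j) * g i j) := by
    rintro ⟨p, p'⟩ hp
    rw [Finset.HasAntidiagonal.mem_antidiagonal] at hp
    simp only at hp ⊢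
    rw [pointOp_eq_sum u (show p < N by omega), pointOp_eq_sum u (show p' < N by omega)]
    simp only [LinearMap.sum_apply, LinearMap.smul_apply, map_sum, map_smul, smul_eq_mul,
      Finset.mul_sum]
    refine Finset.sum_congr rfl fun i _ => Finset.sum_congr rfl fun j _ => ?_
    simp only [hg, Dl_comm i j]
    ring
  rw [Al, comm_add, comm_add, comm_smul, comm_smul, LinearMap.add_apply, LinearMap.add_apply,
    LinearMap.smul_apply, LinearMap.smul_apply, map_add, map_add, map_smul, map_smul, hL, hL, hL,
    smul_eq_mul, smul_eq_mul, Finset.sum_congr rfl hR, Finset.sum_comm (s := antidiagonal b)]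
  simp only [Finset.sum_comm (s := antidiagonal b), Finset.mul_sum, ← Finset.sum_add_distrib]
  refine Finset.sum_congr rfl fun i _ => Finset.sum_congr rfl fun j _ => ?_
  simp only [← mul_assoc, ← Finset.sum_mul]
  -- The binomial identity covers only `i + j ≥ 1`; the remaining term has the factor `Dl 0 = 0`.
  rcases Nat.eq_zero_or_pos (i + j) with h0 | h0
  · have : g i j = 0 := by
      rw [hg]
      simp [show i = 0 by omega, Dl_zero]
    rw [this]; ring
  obtain ⟨s, hs⟩ : ∃ s, i + j = s + 1 := ⟨i + j - 1, by omega⟩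
  have h1 : ∑ p ∈ antidiagonal b, (p.1.choose i * p.2.choose j : K) =
      ((b + 1).choose (s + 2) : K) := by
    rw [show s + 2 = i + j + 1 by omega, ← sum_antidiagonal_choose_mul_choose]
    push_cast
    rfl
  have h2 := congrArg (Nat.cast : ℕ → K) (choose_two_smul b s)
  push_cast at h2
  simp only [mul_assoc _ (Nat.cast (Nat.choose _ _)) (Nat.cast (Nat.choose _ _)),
    ← Finset.mul_sum, h1]
  simp only [w, hs, add_assoc, Nat.reduceAdd]
  push_cast
  linear_combination (u ^ (s + 3) * g i j / 2) * h2

/-- Up to `u ^ 2` this is the same operator on lists as `Ml 0` seen through `Dl`, which links the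
exponential series to the Hurwitz numbers. -/
theorem nPoint_Al [CharZero K] (u : K) (f : MvPowerSeries ℕ+ K) (l : List ℕ) :
    nPoint (pointOp u) constCoeff (Al u f) l =
      u ^ 2 * cutJoin (nPoint (pointOp u) constCoeff f) l := by
  refine nPoint_eq_cutJoin _ _ (Al u)
    (fun b f => (comm (pointOp u b) (Al u) : Module.End K (MvPowerSeries ℕ+ K)) f) (u ^ 2)
    ?_ ?_ ?_ ?_ f l
  · intro b f
    rw [comm_apply]; abel
  · intro b b' f
    rw [← sub_eq_iff_eq_add, ← comm_apply, comm_comm_pointOp]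
    rfl
  · intro f
    simp only [Al, LinearMap.add_apply, LinearMap.smul_apply, map_add, map_smul,
      constCoeff_apply, constantCoeff_Ml, smul_zero, add_zero]
  · exact fun b f => constCoeff_comm_pointOp u b f

/-! ### A series is determined by its `n`-point functions -/

/-- For `u ≠ 0` the powers of `1 + uz` span all polynomials in `z`. -/
theorem opOf_mem {u : K} (hu : u ≠ 0) {N : Submodule K (MvPowerSeries ℕ+ K)}
    {f : MvPowerSeries ℕ+ K} (h : ∀ b, pointOp u b f ∈ N) (P : Polynomial K) :
    opOf P f ∈ N := by
  -- The inverse substitution `z = u⁻¹ (w - 1)` of `w = 1 + uz`.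
  let Q := P.comp (Polynomial.C u⁻¹ * (Polynomial.X - 1))
  have hQ : P = Q.comp (1 + Polynomial.C u * Polynomial.X) := by
    have : (Polynomial.C u⁻¹ * (Polynomial.X - 1)).comp (1 + Polynomial.C u * Polynomial.X) =
        (Polynomial.X : Polynomial K) := by
      simp only [Polynomial.mul_comp, Polynomial.sub_comp, Polynomial.X_comp, Polynomial.C_comp,
        Polynomial.one_comp, add_sub_cancel_left]
      rw [← mul_assoc, ← map_mul, inv_mul_cancel₀ hu, map_one, one_mul]
    rw [Polynomial.comp_assoc, this, Polynomial.comp_X]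
  rw [hQ, Polynomial.comp_eq_sum_left, Polynomial.sum_def, map_sum, LinearMap.sum_apply]
  refine Submodule.sum_mem _ fun k _ => ?_
  rw [← Polynomial.smul_eq_C_mul, map_smul, LinearMap.smul_apply]
  exact N.smul_mem _ (h k)

/-- The series with vanishing n-point functions are closed under all `pointOp u b`, hence by
`opOf_mem` under all `Dl k`. So all iterated derivatives have zero constant term, and in
characteristic zero all coefficients vanish. -/
theorem eq_zero_of_nPoint_eq_zero [CharZero K] {u : K} (hu : u ≠ 0) {f : MvPowerSeries ℕ+ K}
    (h : ∀ l : List ℕ, (∀ b ∈ l, 0 < b) → nPoint (pointOp u) constCoeff f l = 0) : f = 0 := by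
  let N : Submodule K (MvPowerSeries ℕ+ K) :=
    { carrier := {f | ∀ l : List ℕ, (∀ b ∈ l, 0 < b) → nPoint (pointOp u) constCoeff f l = 0}
      add_mem' := fun {f g} hf hg l hl => by rw [nPoint_add, hf l hl, hg l hl, add_zero]
      zero_mem' := fun l _ => by
        have := nPoint_smul (pointOp u) constCoeff (0 : K) (0 : MvPowerSeries ℕ+ K) l
        rwa [zero_smul, zero_mul] at this
      smul_mem' := fun c f hf l hl => by rw [nPoint_smul, hf l hl, mul_zero] }
  have hD : ∀ f ∈ N, ∀ k : ℕ, Dl k f ∈ N := by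
    intro f hf k
    have := opOf_mem hu (N := N) (f := f) (fun b => ?_) (Polynomial.monomial k 1)
    · rwa [opOf_monomial, one_smul] at this
    · rcases Nat.eq_zero_or_pos b with rfl | hb
      · rw [pointOp_zero]
        exact N.zero_mem
      · intro l hl
        exact hf (b :: l) (by simpa [hb] using hl)
  have key : ∀ (n : ℕ) (s : ℕ+ →₀ ℕ), s.degree = n → ∀ f ∈ N, coeff s f = 0 := by
    intro n
    induction n with
    | zero =>
      intro s hs f hf
      rw [(Finsupp.degree_eq_zero_iff s).1 hs]
      exact hf [] (by simp)
    | succ n ih =>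
      intro s hs f hf
      obtain ⟨i, hi⟩ : ∃ i, s i ≠ 0 := by
        by_contra! h0
        rw [(Finsupp.degree_eq_zero_iff s).2 (Finsupp.ext h0)] at hs
        omega
      have hle : Finsupp.single i 1 ≤ s := by simpa using Nat.one_le_iff_ne_zero.2 hi
      have h1 := ih (s - Finsupp.single i 1) (by
        have := congrArg Finsupp.degree (tsub_add_cancel_of_le hle)
        rw [map_add, Finsupp.degree_single] at this
        omega) (Dl i f) (hD f hf i)
      rw [coeff_Dl, tsub_add_cancel_of_le hle] at h1
      have h2 : ((i : ℕ) : K) ≠ 0 := Nat.cast_ne_zero.2 i.ne_zero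
      have h3 : (((s - Finsupp.single i 1 : ℕ+ →₀ ℕ) i : ℕ) + 1 : K) ≠ 0 :=
        Nat.cast_add_one_ne_zero _
      exact (mul_eq_zero.1 ((mul_eq_zero.1 h1).resolve_left h2)).resolve_left h3
  ext1 s
  rw [key _ s rfl f h, map_zero]

end GJV

namespace GJV

open PowerSeries
open Finset.HasAntidiagonal (antidiagonal)

/-! ### Solution of the cut-and-join equation -/

/-- The power series `e^{rt}`. -/
noncomputable def expS (r : ℚ) : ℚ⟦X⟧ := rescale r (exp ℚ)

theorem expS_mul (r s : ℚ) : expS r * expS s = expS (r + s) := exp_mul_exp_eq_exp_add r s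

theorem derivative_expS (r : ℚ) : derivative ℚ (expS r) = C r * expS r := by
  ext n
  rw [coeff_derivative, coeff_C_mul, expS, coeff_rescale, coeff_rescale, coeff_exp, coeff_exp,
    Nat.factorial_succ, pow_succ]
  simp only [Algebra.algebraMap_self, RingHom.id_apply]
  push_cast
  have : (n.factorial : ℚ) ≠ 0 := by positivity
  field_simp

/-- The power series `2 sinh(bt/2)`. -/
noncomputable def sinhS (b : ℕ) : ℚ⟦X⟧ := expS (b / 2) - expS (-(b / 2))

/-- The power series `2 cosh(bt/2)`. -/
noncomputable def coshS (b : ℕ) : ℚ⟦X⟧ := expS (b / 2) + expS (-(b / 2))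

theorem derivative_sinhS (b : ℕ) : derivative ℚ (sinhS b) = C (b / 2 : ℚ) * coshS b := by
  rw [sinhS, coshS, map_sub, derivative_expS, derivative_expS, map_neg]
  ring

theorem two_mul_sinhS_add (b c : ℕ) :
    2 * sinhS (b + c) = sinhS b * coshS c + coshS b * sinhS c := by
  have h1 : expS ((b + c : ℕ) / 2) = expS (b / 2) * expS (c / 2) := by
    rw [expS_mul]; push_cast; ring_nf
  have h2 : expS (-((b + c : ℕ) / 2)) = expS (-(b / 2)) * expS (-(c / 2)) := by
    rw [expS_mul]; push_cast; ring_nf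
  simp only [sinhS, coshS, h1, h2]
  ring

/-- A product of two hyperbolic sines is a hyperbolic cosine of the sum minus one of the difference.
The first is constant on the antidiagonal; the second, multiplied by `sinhS 1`, telescopes to `sinhS
(b + 1)`. -/
theorem sinhS_mul_sum (b : ℕ) :
    sinhS 1 * ∑ p ∈ antidiagonal b, sinhS p.1 * sinhS p.2 =
      C (b : ℚ) * (coshS b * sinhS 1) - sinhS b * coshS 1 := by
  have ht : ∀ r : ℚ, sinhS 1 * expS r = expS (r + 1 / 2) - expS (r - 1 / 2) := fun r => by
    rw [sinhS, sub_mul, expS_mul, expS_mul]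
    push_cast
    ring_nf
  have h1 : ∀ p ∈ antidiagonal b, sinhS 1 * (sinhS p.1 * sinhS p.2) =
      coshS b * sinhS 1 - (sinhS 1 * expS ((p.1 - p.2) / 2) + sinhS 1 * expS ((p.2 - p.1) / 2)) := by
    rintro ⟨i, j⟩ hp
    rw [Finset.HasAntidiagonal.mem_antidiagonal] at hp
    subst hp
    simp only [sinhS, coshS]
    rw [show ((i - j) / 2 : ℚ) = i / 2 + -(j / 2) by ring,
      show ((j - i) / 2 : ℚ) = -(i / 2) + j / 2 by ring,
      show (((i + j : ℕ) : ℚ) / 2) = i / 2 + j / 2 by push_cast; ring, neg_add]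
    simp only [← expS_mul]
    ring
  have h2 : ∑ p ∈ antidiagonal b, sinhS 1 * expS ((p.1 - p.2) / 2) = sinhS (b + 1) := by
    have := Finset.Nat.sum_antidiagonal_eq_sum_range_succ
      (fun i j : ℕ => sinhS 1 * expS ((i - j) / 2)) b
    rw [this]
    have h3 : ∀ i ∈ Finset.range (b + 1), sinhS 1 * expS ((i - (b - i : ℕ)) / 2) =
        expS ((2 * (i + 1 : ℕ) - b - 1) / 2) - expS ((2 * i - b - 1) / 2) := by
      intro i hi
      rw [ht, Nat.cast_sub (by simpa [Nat.lt_succ_iff] using hi)]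
      push_cast
      ring_nf
    rw [Finset.sum_congr rfl h3,
      Finset.sum_range_sub (fun i : ℕ => expS ((2 * i - b - 1) / 2)), sinhS]
    push_cast
    ring_nf
  have h3 : ∑ p ∈ antidiagonal b, sinhS 1 * expS ((p.2 - p.1) / 2) = sinhS (b + 1) := by
    rw [← h2, ← Finset.Nat.sum_antidiagonal_swap]
    rfl
  rw [Finset.mul_sum, Finset.sum_congr rfl h1, Finset.sum_sub_distrib, Finset.sum_add_distrib,
    h2, h3, Finset.sum_const, Finset.Nat.card_antidiagonal, ← two_mul, two_mul_sinhS_add,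
    nsmul_eq_mul, map_natCast]
  push_cast
  ring

/-- The product of the `2 sinh(bt/2)`. -/
noncomputable def sinhProd (l : List ℕ) : ℚ⟦X⟧ := (l.map sinhS).prod

theorem sinhProd_cons (b : ℕ) (l : List ℕ) : sinhProd (b :: l) = sinhS b * sinhProd l := by
  simp [sinhProd]

theorem insertPoint_mul (a : ℚ⟦X⟧) (b : ℕ) (F : List ℕ → ℚ⟦X⟧) (l : List ℕ) :
    insertPoint b (fun l => a * F l) l = a * insertPoint b F l :=
  (map_insertPoint (AddMonoidHom.mulLeft a) b l F).symm

theorem cutJoin_mul (a : ℚ⟦X⟧) (F : List ℕ → ℚ⟦X⟧) (l : List ℕ) :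
    cutJoin (fun l => a * F l) l = a * cutJoin F l :=
  (map_cutJoin (AddMonoidHom.mulLeft a) l F).symm

theorem derivative_mul' (f g : ℚ⟦X⟧) :
    derivative ℚ (f * g) = derivative ℚ f * g + f * derivative ℚ g := by
  rw [Derivation.leibniz, smul_eq_mul, smul_eq_mul]; ring

/-- The addition theorem expresses `bc · sinhS (b + c)` through the derivatives of `sinhS b` and
`sinhS c`, so the join terms add up by Leibniz to a derivative of the product. The cut term is
`sinhS_mul_sum`. The factor `sinhS 1` avoids division. -/
theorem sinhS_mul_insertPoint (b : ℕ) (l : List ℕ) :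
    sinhS 1 * insertPoint b sinhProd l =
      b * (sinhS 1 * sinhS b * derivative ℚ (sinhProd l)) +
      (l.sum : ℕ) * (sinhS 1 * derivative ℚ (sinhS b) * sinhProd l) +
      b * (sinhS 1 * derivative ℚ (sinhS b) - derivative ℚ (sinhS 1) * sinhS b) * sinhProd l := by
  have h2 : (C (1 / 2 : ℚ) : ℚ⟦X⟧) * 2 = 1 := by
    rw [← map_ofNat (C (R := ℚ)) 2, ← map_mul]; norm_num
  have hC : ∀ n : ℕ, (C (n / 2 : ℚ) : ℚ⟦X⟧) = n * C (1 / 2 : ℚ) := fun n => by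
    rw [← map_natCast (C (R := ℚ)), ← map_mul, mul_one_div]
  induction l with
  | nil =>
    have h1 : ∀ p ∈ antidiagonal b, sinhProd [p.1, p.2] = sinhS p.1 * sinhS p.2 :=
      fun p _ => by simp [sinhProd]
    simp only [insertPoint]
    rw [Finset.sum_congr rfl h1, mul_smul_comm, sinhS_mul_sum, smul_eq_C_mul, derivative_sinhS,
      derivative_sinhS, hC, hC, map_natCast]
    simp only [sinhProd, List.map_nil, List.prod_nil, Derivation.map_one_eq_zero, List.sum_nil]
    push_cast
    ring
  | cons c l ih =>
    have h := two_mul_sinhS_add b c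
    have h3 : (b * c : ℚ⟦X⟧) * sinhS (b + c) = b * sinhS b * derivative ℚ (sinhS c) +
        c * derivative ℚ (sinhS b) * sinhS c := by
      rw [derivative_sinhS, derivative_sinhS, hC, hC]
      linear_combination (b * c * C (1 / 2 : ℚ)) * h - (b * c * sinhS (b + c)) * h2
    simp only [insertPoint, sinhProd_cons]
    rw [insertPoint_mul, smul_eq_C_mul, map_mul, map_natCast, map_natCast, derivative_mul',
      List.sum_cons, Nat.cast_add]
    linear_combination sinhS 1 * sinhProd l * h3 + sinhS c * ih

/-- With `P = sinhProd l` and `S = sinhS 1` this says `cutJoin P / S = d · (P / S)'`, cleared of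
denominators. -/
theorem sinhS_mul_cutJoin (l : List ℕ) :
    sinhS 1 * cutJoin sinhProd l = (l.sum : ℕ) *
      (sinhS 1 * derivative ℚ (sinhProd l) - derivative ℚ (sinhS 1) * sinhProd l) := by
  induction l with
  | nil => simp [cutJoin]
  | cons b l ih =>
    simp only [cutJoin, sinhProd_cons]
    rw [cutJoin_mul, mul_add, sinhS_mul_insertPoint, derivative_mul', List.sum_cons,
      Nat.cast_add]
    linear_combination sinhS b * ih

/-- The power series `sinh(t/2) / (t/2)`. -/
noncomputable def sinhc : ℚ⟦X⟧ :=
  mk fun n => if Even n then (1 / (2 ^ n * (n + 1).factorial) : ℚ) else 0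

theorem constantCoeff_sinhc : constantCoeff sinhc = 1 := by
  rw [← coeff_zero_eq_constantCoeff_apply, sinhc, coeff_mk]
  simp

theorem sinhS_eq (b : ℕ) : sinhS b = (b : ℚ⟦X⟧) * X * rescale (b : ℚ) sinhc := by
  ext n
  rw [mul_assoc, ← map_natCast (C (R := ℚ)), coeff_C_mul]
  cases n with
  | zero =>
    rw [coeff_zero_X_mul, mul_zero, sinhS, expS, expS, map_sub, coeff_rescale, coeff_rescale]
    simp
  | succ n =>
    rw [coeff_succ_X_mul, coeff_rescale, sinhc, coeff_mk, sinhS, expS, expS, map_sub,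
      coeff_rescale, coeff_rescale, coeff_exp]
    simp only [Algebra.algebraMap_self, RingHom.id_apply]
    split_ifs with h
    · rw [(h.add_one).neg_pow, div_pow, pow_succ, pow_succ]
      field_simp
      ring
    · rw [(Nat.not_even_iff_odd.1 h).add_one.neg_pow]
      ring

/-- The inverse of `sinh(t/2) / (t/2)`. -/
noncomputable def sinhcInv : ℚ⟦X⟧ := sinhc⁻¹

theorem sinhc_mul_inv : sinhc * sinhcInv = 1 :=
  PowerSeries.mul_inv_cancel _ (by rw [constantCoeff_sinhc]; exact one_ne_zero)

theorem constantCoeff_sinhcInv : constantCoeff sinhcInv = 1 := by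
  rw [sinhcInv, constantCoeff_inv, constantCoeff_sinhc, inv_one]

/-- The quotient of the product of the `2 sinh(bt/2)` by `2 sinh(t/2)`. -/
noncomputable def sinhQuot (l : List ℕ) : ℚ⟦X⟧ :=
  (l.prod : ℚ⟦X⟧) * (X ^ (l.length - 1) *
    (sinhcInv * (l.map fun b : ℕ => rescale (b : ℚ) sinhc).prod))

theorem sinhS_one_mul_sinhQuot {l : List ℕ} (hl : l ≠ []) :
    sinhS 1 * sinhQuot l = sinhProd l := by
  have h : ∀ l : List ℕ, sinhProd l =
      (l.prod : ℚ⟦X⟧) * X ^ l.length * (l.map fun b : ℕ => rescale (b : ℚ) sinhc).prod := by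
    intro l
    induction l with
    | nil => simp [sinhProd]
    | cons b l ih =>
      rw [sinhProd_cons, ih, sinhS_eq]
      simp only [List.prod_cons, List.length_cons, List.map_cons]
      push_cast
      ring
  have hX : (X : ℚ⟦X⟧) ^ l.length = X ^ (l.length - 1) * X := by
    rw [← pow_succ, Nat.sub_add_cancel (List.length_pos_iff.2 hl)]
  rw [h, sinhQuot, sinhS_eq, hX, Nat.cast_one, Nat.cast_one, rescale_one, RingHom.id_apply]
  linear_combination ((l.prod : ℚ⟦X⟧) * X ^ (l.length - 1) * X *
    (l.map fun b : ℕ => rescale (b : ℚ) sinhc).prod) * sinhc_mul_inv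

theorem sinhS_one_ne_zero : sinhS 1 ≠ 0 := by
  intro h
  have h1 := congrArg (coeff 1) h
  rw [sinhS_eq, Nat.cast_one, Nat.cast_one, rescale_one, RingHom.id_apply, one_mul,
    coeff_succ_X_mul, coeff_zero_eq_constantCoeff_apply, constantCoeff_sinhc, map_zero] at h1
  exact one_ne_zero h1

theorem cutJoin_sinhQuot {l : List ℕ} (hl : l ≠ []) :
    cutJoin sinhQuot l = (l.sum : ℕ) * derivative ℚ (sinhQuot l) := by
  have h1 : sinhS 1 * cutJoin sinhQuot l = cutJoin sinhProd l := by
    rw [← cutJoin_mul]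
    exact cutJoin_congr l _ _ fun l' h0 _ => sinhS_one_mul_sinhQuot h0
  have h2 := sinhS_mul_cutJoin l
  rw [← h1, ← sinhS_one_mul_sinhQuot hl, derivative_mul'] at h2
  refine mul_left_cancel₀ sinhS_one_ne_zero (mul_left_cancel₀ sinhS_one_ne_zero ?_)
  rw [h2]
  ring

/-- The one-point initial condition of the cut-and-join equation. -/
def onePoint : List ℕ → ℚ
  | [b] => b
  | _ => 0

/-- Since `d` is preserved, `cutJoin_sinhQuot` says that `sinhQuot` at the argument `d t` solves
`dF/dt = cutJoin F`. Its value at `t = 0` is `onePoint`, because `X ^ (n - 1)` leaves only lists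
with one entry. -/
theorem cutJoin_iterate_onePoint (m : ℕ) {l : List ℕ} (hl : l ≠ []) :
    cutJoin^[m] onePoint l = m.factorial * (l.sum : ℚ) ^ m * coeff m (sinhQuot l) := by
  induction m generalizing l with
  | zero =>
    rw [Function.iterate_zero, id_eq, sinhQuot, coeff_zero_eq_constantCoeff_apply]
    simp only [map_mul, map_pow, constantCoeff_X, constantCoeff_sinhcInv, map_natCast]
    match l with
    | [b] =>
      have : constantCoeff (rescale (b : ℚ) sinhc) = 1 := by
        rw [← coeff_zero_eq_constantCoeff_apply, coeff_rescale, pow_zero, one_mul,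
          coeff_zero_eq_constantCoeff_apply, constantCoeff_sinhc]
      simp [onePoint, this]
    | _ :: _ :: _ => simp [onePoint]
  | succ m ih =>
    rw [Function.iterate_succ_apply', cutJoin_congr l _
      (fun l' => (AddMonoidHom.mulLeft ((m.factorial : ℚ) * (l.sum : ℚ) ^ m)).comp
        (coeff (R := ℚ) m).toAddMonoidHom (sinhQuot l')) fun l' h0 hs => ?_, ← map_cutJoin,
      cutJoin_sinhQuot hl]
    · simp only [AddMonoidHom.comp_apply, AddMonoidHom.coe_mulLeft,
        LinearMap.toAddMonoidHom_coe, ← map_natCast (C (R := ℚ)), coeff_C_mul, coeff_derivative]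
      rw [Nat.factorial_succ]
      push_cast
      ring
    · rw [ih h0, hs]
      rfl

end GJV

namespace GJV

open MvPowerSeries
open Finset.HasAntidiagonal (antidiagonal)

variable {K : Type*} [Field K]

/-! ### The cut-and-join operator on monomials -/

variable {ι : Type*} [DecidableEq ι] (w : ι → ℕ+)

theorem Dl_prod (n : ℕ) (C : Finset ι) :
    Dl n (∏ c ∈ C, (X (w c) : MvPowerSeries ℕ+ K)) =
      ∑ c ∈ C, if (w c : ℕ) = n then (n : MvPowerSeries ℕ+ K) * ∏ c' ∈ C.erase c, X (w c')
        else 0 := by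
  induction C using Finset.induction_on with
  | empty =>
    have := Dl_natCast (K := K) n 1
    simpa using this
  | insert a C ha ih =>
    rw [Finset.prod_insert ha, Dl_mul, ih, Finset.sum_insert ha, Finset.erase_insert ha, Dl_q,
      ite_mul, zero_mul, Finset.mul_sum]
    congr 1
    refine Finset.sum_congr rfl fun c hc => ?_
    rw [mul_ite, mul_zero, Finset.erase_insert_of_ne (fun h : a = c => ha (h ▸ hc)),
      Finset.prod_insert fun h => ha (Finset.mem_of_mem_erase h)]
    congr 1
    ring

/-- The variable `q_n`, with `q_0 = 0`. -/
noncomputable def Xn (n : ℕ) : MvPowerSeries ℕ+ K := if h : 0 < n then X ⟨n, h⟩ else 0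

theorem Xn_coe (n : ℕ+) : (Xn n : MvPowerSeries ℕ+ K) = X n := dif_pos n.pos

theorem Xn_zero : (Xn 0 : MvPowerSeries ℕ+ K) = 0 := dif_neg (lt_irrefl 0)

/-- Leibniz selects one factor, which is replaced by two whose indices add up to its own. The ends
of the antidiagonal contribute nothing since `Xn 0 = 0`. -/
theorem cutl_zero_prod (C : Finset ι) :
    cutl 0 (∏ c ∈ C, (X (w c) : MvPowerSeries ℕ+ K)) =
      ∑ c ∈ C, (w c : MvPowerSeries ℕ+ K) * ((∑ p ∈ antidiagonal (w c : ℕ), Xn p.1 * Xn p.2) *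
        ∏ c' ∈ C.erase c, X (w c')) := by
  rw [cutl_apply]
  simp only [tsub_zero, Dl_prod, Finset.mul_sum]
  let b : ι → ℕ × ℕ → MvPowerSeries ℕ+ K := fun c p =>
    Xn p.1 * Xn p.2 * if (w c : ℕ) = p.1 + p.2 then
      ((p.1 + p.2 : ℕ) : MvPowerSeries ℕ+ K) * ∏ c' ∈ C.erase c, X (w c') else 0
  have ig : (fun p : ℕ+ × ℕ+ => ((p.1 : ℕ), (p.2 : ℕ))).Injective := by
    rintro ⟨i, j⟩ ⟨i', j'⟩ h
    simpa using h
  have h1 : ∀ c, ∀ p, p ∉ Set.range (fun p : ℕ+ × ℕ+ => ((p.1 : ℕ), (p.2 : ℕ))) → b c p = 0 := by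
    rintro c ⟨i, j⟩ hp
    rcases Nat.eq_zero_or_pos i with rfl | hi
    · simp [b, Xn_zero]
    rcases Nat.eq_zero_or_pos j with rfl | hj
    · simp [b, Xn_zero]
    exact absurd ⟨(⟨i, hi⟩, ⟨j, hj⟩), rfl⟩ hp
  have h2 : ∀ c, ∀ p, p ∉ antidiagonal (w c : ℕ) → b c p = 0 := by
    rintro c p hp
    simp only [b]
    rw [if_neg fun h => hp (Finset.HasAntidiagonal.mem_antidiagonal.2 h.symm), mul_zero]
  have hb : ∀ c, CoeffFinite fun p : ℕ+ × ℕ+ => b c (p.1, p.2) := fun c s =>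
    (coeffFinite_of_finset (h2 c) s).preimage ig.injOn
  have he : (fun p : ℕ+ × ℕ+ => ∑ c ∈ C, (X p.1 * X p.2 : MvPowerSeries ℕ+ K) *
      if (w c : ℕ) = p.1 + p.2 then ((p.1 + p.2 : ℕ) : MvPowerSeries ℕ+ K) *
        ∏ c' ∈ C.erase c, X (w c') else 0) = fun p => ∑ c ∈ C, b c (p.1, p.2) := by
    ext1 p
    simp only [b, Xn_coe]
  rw [he, coeffSum_sum _ _ fun c _ => hb c]
  refine Finset.sum_congr rfl fun c _ => ?_
  rw [coeffSum_comp ig (h1 c), coeffSum_eq_sum (h2 c), Finset.sum_mul, Finset.mul_sum]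
  refine Finset.sum_congr rfl fun p hp => ?_
  rw [Finset.HasAntidiagonal.mem_antidiagonal] at hp
  simp only [b]
  rw [if_pos hp.symm, hp]
  ring

theorem joinl_zero_prod (C : Finset ι) :
    joinl 0 (∏ c ∈ C, (X (w c) : MvPowerSeries ℕ+ K)) =
      ∑ c ∈ C, ∑ c' ∈ C.erase c, (w c * w c' : MvPowerSeries ℕ+ K) *
        (X (w c + w c') * ∏ c'' ∈ (C.erase c).erase c', X (w c'')) := by
  rw [joinl_apply]
  let b : ι → ι → ℕ+ × ℕ+ → MvPowerSeries ℕ+ K := fun c c' p =>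
    if (w c : ℕ) = p.2 then if (w c' : ℕ) = p.1 then X (addIdx 0 p) * ((((p.2 : ℕ) : MvPowerSeries ℕ+ K) *
      (((p.1 : ℕ) : MvPowerSeries ℕ+ K) * ∏ c'' ∈ (C.erase c).erase c', X (w c''))))
    else 0 else 0
  have he : (fun p : ℕ+ × ℕ+ => X (addIdx 0 p) *
      Dl p.1 (Dl p.2 (∏ c ∈ C, (X (w c) : MvPowerSeries ℕ+ K)))) =
      fun p => ∑ c ∈ C, ∑ c' ∈ C.erase c, b c c' p := by
    ext1 p
    rw [Dl_prod, map_sum, Finset.mul_sum]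
    refine Finset.sum_congr rfl fun c _ => ?_
    simp only [b]
    split_ifs with h
    · rw [Dl_mul, Dl_natCast, zero_mul, zero_add, Dl_prod, Finset.mul_sum, Finset.mul_sum]
      refine Finset.sum_congr rfl fun c' _ => ?_
      split_ifs
      · rfl
      · rw [mul_zero, mul_zero]
    · rw [map_zero, mul_zero, Finset.sum_const_zero]
  have h1 : ∀ c c', ∀ p, p ∉ ({(w c', w c)} : Finset (ℕ+ × ℕ+)) → b c c' p = 0 := by
    rintro c c' ⟨i, j⟩ hp
    simp only [b]
    split_ifs with h h'
    · refine absurd ?_ hp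
      rw [Finset.mem_singleton, ← PNat.eq h, ← PNat.eq h']
    · rfl
    · rfl
  rw [he, coeffSum_sum _ _ fun c _ => ?_]
  · refine Finset.sum_congr rfl fun c _ => ?_
    rw [coeffSum_sum _ _ fun c' _ => coeffFinite_of_finset (h1 c c')]
    refine Finset.sum_congr rfl fun c' _ => ?_
    rw [coeffSum_eq_sum (h1 c c'), Finset.sum_singleton]
    simp only [b]
    rw [if_pos trivial, if_pos trivial, show addIdx 0 (w c', w c) = w c + w c' from
      PNat.eq (by rw [coe_addIdx, PNat.add_coe]; ring)]
    ring
  · intro s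
    refine (((C.erase c).image fun c' => (w c', w c)).finite_toSet).subset fun p hp => ?_
    by_contra h0
    refine hp ?_
    simp only [map_sum]
    refine Finset.sum_eq_zero fun c' hc' => ?_
    rw [h1 c c' p, map_zero]
    intro h
    exact h0 (Finset.mem_image.2 ⟨c', hc', (Finset.mem_singleton.1 h).symm⟩)

theorem constCoeff_prod (C : Finset ι) :
    constCoeff (∏ c ∈ C, (X (w c) : MvPowerSeries ℕ+ K)) = if C = ∅ then 1 else 0 := by
  rw [constCoeff_apply, map_prod]
  split_ifs with h
  · simp [h]
  · obtain ⟨c, hc⟩ := Finset.nonempty_iff_ne_empty.2 h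
    exact Finset.prod_eq_zero hc (constantCoeff_X _)

/-- The `n`-point functions of a monomial count the enumerations of its factors. -/
theorem nPoint_prod [Fintype ι] {n : ℕ} (b : Fin n → ℕ) (C : Finset ι) :
    nPoint Dl constCoeff (∏ c ∈ C, (X (w c) : MvPowerSeries ℕ+ K)) (List.ofFn b) =
      (∏ i, (b i : K)) * (Fintype.card {f : Fin n → ι //
        f.Injective ∧ (∀ c, c ∈ C ↔ ∃ i, f i = c) ∧ ∀ i, (w (f i) : ℕ) = b i} : K) := by
  induction n generalizing C with
  | zero =>
    rw [List.ofFn_zero, nPoint, constCoeff_prod, Finset.univ_eq_empty, Finset.prod_empty, one_mul]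
    split_ifs with h
    · subst h
      rw [Fintype.card_eq_one_iff.2, Nat.cast_one]
      exact ⟨⟨Fin.elim0, fun i => i.elim0, by simp, fun i => i.elim0⟩,
        fun f => Subtype.ext (Subsingleton.elim _ _)⟩
    · rw [Fintype.card_eq_zero_iff.2, Nat.cast_zero]
      refine ⟨fun f => h ?_⟩
      refine Finset.eq_empty_of_forall_notMem fun c hc => ?_
      obtain ⟨i, -⟩ := (f.2.2.1 c).1 hc
      exact i.elim0
  | succ n ih =>
    rw [List.ofFn_succ, nPoint_cons, Dl_prod, nPoint_sum, Fin.prod_univ_succ]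
    have h1 : ∀ c ∈ C, nPoint Dl constCoeff (if (w c : ℕ) = b 0 then
        (b 0 : MvPowerSeries ℕ+ K) * ∏ c' ∈ C.erase c, X (w c') else 0)
        (List.ofFn fun i => b i.succ) = if (w c : ℕ) = b 0 then
        (b 0 : K) * ((∏ i : Fin n, (b i.succ : K)) * (Fintype.card {f : Fin n → ι //
        f.Injective ∧ (∀ c', c' ∈ C.erase c ↔ ∃ i, f i = c') ∧
          ∀ i, (w (f i) : ℕ) = b i.succ} : K)) else 0 := by
      intro c _
      split_ifs
      · rw [← ih, ← nsmul_eq_mul, ← Nat.cast_smul_eq_nsmul K, nPoint_smul]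
      · rw [← zero_smul K (0 : MvPowerSeries ℕ+ K), nPoint_smul, zero_mul]
    rw [Finset.sum_congr rfl h1, ← Finset.sum_filter, ← Finset.mul_sum, ← Finset.mul_sum,
      ← mul_assoc]
    congr 1
    rw [← Nat.cast_sum]
    congr 1
    -- An enumeration is its first value together with an enumeration of the remaining factors.
    let e : {f : Fin (n + 1) → ι // f.Injective ∧ (∀ c, c ∈ C ↔ ∃ i, f i = c) ∧
        ∀ i, (w (f i) : ℕ) = b i} ≃ (c : {c // c ∈ C.filter fun c => (w c : ℕ) = b 0}) ×
        {f : Fin n → ι // f.Injective ∧ (∀ c', c' ∈ C.erase c ↔ ∃ i, f i = c') ∧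
          ∀ i, (w (f i) : ℕ) = b i.succ} :=
      { toFun := fun f => ⟨⟨f.1 0, Finset.mem_filter.2 ⟨(f.2.2.1 _).2 ⟨0, rfl⟩, f.2.2.2 0⟩⟩,
          ⟨fun i => f.1 i.succ, fun i j h => Fin.succ_injective _ (f.2.1 h), fun c' => by
            rw [Finset.mem_erase]
            refine (and_congr_right' (f.2.2.1 c')).trans ?_
            constructor
            · rintro ⟨h, i, rfl⟩
              refine ⟨i.pred fun h0 => h (by rw [h0]), congrArg f.1 (Fin.succ_pred _ _)⟩
            · rintro ⟨i, rfl⟩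
              exact ⟨fun h => Fin.succ_ne_zero _ (f.2.1 h), _, rfl⟩, fun i => f.2.2.2 i.succ⟩⟩
        invFun := fun g => ⟨Fin.cons g.1.1 g.2.1, by
          rw [Fin.cons_injective_iff]
          refine ⟨?_, g.2.2.1⟩
          rintro ⟨i, hi⟩
          exact (Finset.mem_erase.1 ((g.2.2.2.1 g.1.1).2 ⟨i, hi⟩)).1 rfl, fun c => by
          rw [Fin.exists_fin_succ]
          simp only [Fin.cons_zero, Fin.cons_succ, ← g.2.2.2.1, Finset.mem_erase]
          have := (Finset.mem_filter.1 g.1.2).1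
          by_cases h : (g.1 : ι) = c
          · subst h; simp [this]
          · simp [h, Ne.symm h], fun i => by
          refine Fin.cases ?_ (fun i => ?_) i
          · simpa using (Finset.mem_filter.1 g.1.2).2
          · simpa using g.2.2.2.2 i⟩
        left_inv := fun f => Subtype.ext (Fin.cons_self_tail _)
        right_inv := fun g => rfl }
    rw [Fintype.card_congr e, Fintype.card_sigma]
    exact (Finset.sum_coe_sort (C.filter fun c => (w c : ℕ) = b 0) fun c => Fintype.card
      {f : Fin n → ι // f.Injective ∧ (∀ c', c' ∈ C.erase c ↔ ∃ i, f i = c') ∧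
          ∀ i, (w (f i) : ℕ) = b i.succ}).symm

end GJV

namespace GJV

open MvPowerSeries Equiv
open Finset.HasAntidiagonal (antidiagonal)

/-! ### Orbits of a permutation multiplied by a transposition -/

section Orbits

variable {α : Type*} [Fintype α] [DecidableEq α]

/-- The orbit of `x` under `σ`. -/
def orb (σ : Perm α) (x : α) : Finset α := {y | σ.SameCycle x y}

/-- The set of orbits of `σ`. -/
def orbs (σ : Perm α) : Finset (Finset α) := Finset.univ.image (orb σ)

theorem mem_orb {σ : Perm α} {x y : α} : y ∈ orb σ x ↔ σ.SameCycle x y := by simp [orb]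

theorem self_mem_orb (σ : Perm α) (x : α) : x ∈ orb σ x := mem_orb.2 (Perm.SameCycle.refl σ x)

theorem orb_eq_orb {σ : Perm α} {x y : α} : orb σ x = orb σ y ↔ σ.SameCycle x y := by
  constructor
  · intro h
    rw [← mem_orb, h]
    exact self_mem_orb σ y
  · intro h
    ext z
    rw [mem_orb, mem_orb]
    exact ⟨h.symm.trans, h.trans⟩

theorem orb_mem_orbs (σ : Perm α) (x : α) : orb σ x ∈ orbs σ :=
  Finset.mem_image_of_mem _ (Finset.mem_univ x)

theorem mem_orbs {σ : Perm α} {c : Finset α} : c ∈ orbs σ ↔ ∃ x, orb σ x = c := by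
  simp [orbs]

theorem eq_orb_of_mem {σ : Perm α} {c : Finset α} (hc : c ∈ orbs σ) {x : α} (hx : x ∈ c) :
    c = orb σ x := by
  obtain ⟨y, rfl⟩ := mem_orbs.1 hc
  exact orb_eq_orb.2 (mem_orb.1 hx)

theorem sum_orb {M : Type*} [AddCommMonoid M] (σ : Perm α) (F : Finset α → M) :
    ∑ x, F (orb σ x) = ∑ c ∈ orbs σ, c.card • F c := by
  rw [← Finset.sum_fiberwise_of_maps_to (t := orbs σ) (g := orb σ) fun x _ => orb_mem_orbs σ x]
  refine Finset.sum_congr rfl fun c hc => ?_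
  have h : Finset.univ.filter (fun x => orb σ x = c) = c := by
    ext x
    simp only [Finset.mem_filter, Finset.mem_univ, true_and]
    exact ⟨fun h => h ▸ self_mem_orb σ x, fun h => (eq_orb_of_mem hc h).symm⟩
  rw [Finset.sum_congr rfl fun x hx => by rw [(Finset.mem_filter.1 hx).2], Finset.sum_const, h]

/-- An equivalence relation containing the steps of `σ` contains its orbit relation. -/
theorem SameCycle.rel {σ : Perm α} {r : α → α → Prop} (hr : Equivalence r)
    (h : ∀ a, r a (σ a)) {a b : α} (hab : σ.SameCycle a b) : r a b := by
  obtain ⟨n, rfl⟩ := hab.exists_nat_pow_eq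
  induction n with
  | zero => exact hr.refl a
  | succ n ih =>
    rw [pow_succ', Perm.mul_apply]
    exact hr.trans (ih ⟨n, by simp⟩) (h _)

/-- The transposition sends `y` to `x`; from then on the path follows `σ` until it meets `x` or `y`.
-/
theorem pow_mul_swap_apply {σ : Perm α} {x y : α} {k : ℕ} (hk : 0 < k)
    (h : ∀ j, 0 < j → j < k → (σ ^ j) x ≠ x ∧ (σ ^ j) x ≠ y) :
    ((σ * swap x y) ^ k) y = (σ ^ k) x := by
  induction k with
  | zero => exact absurd hk (lt_irrefl 0)
  | succ k ih =>
    rw [pow_succ', Perm.mul_apply, pow_succ', Perm.mul_apply]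
    rcases Nat.eq_zero_or_pos k with rfl | hk'
    · simp
    · rw [ih hk' fun j h1 h2 => h j h1 (by omega), Perm.mul_apply,
        swap_apply_of_ne_of_ne (h k hk' (by omega)).1 (h k hk' (by omega)).2]

/-- The length of the orbit of `x`. -/
noncomputable def period (σ : Perm α) (x : α) : ℕ := Function.minimalPeriod σ x

theorem period_pos (σ : Perm α) (x : α) : 0 < period σ x := by
  refine Function.minimalPeriod_pos_of_mem_periodicPts ?_
  exact ⟨orderOf σ, orderOf_pos σ, by
    rw [Function.IsPeriodicPt, Function.IsFixedPt, Perm.iterate_eq_pow, pow_orderOf_eq_one]; rfl⟩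

theorem pow_period (σ : Perm α) (x : α) : (σ ^ period σ x) x = x := by
  rw [← Perm.iterate_eq_pow]
  exact Function.iterate_minimalPeriod

theorem pow_injOn_period (σ : Perm α) (x : α) :
    Set.InjOn (fun i : ℕ => (σ ^ i) x) (Set.Iio (period σ x)) := by
  simp only [← Perm.iterate_eq_pow]
  exact Function.iterate_injOn_Iio_minimalPeriod

theorem orb_eq_image (σ : Perm α) (x : α) :
    orb σ x = (Finset.range (period σ x)).image fun i => (σ ^ i) x := by
  ext y
  rw [mem_orb, Finset.mem_image]
  constructor
  · intro h
    obtain ⟨i, rfl⟩ := h.exists_nat_pow_eq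
    refine ⟨i % period σ x, Finset.mem_range.2 (Nat.mod_lt _ (period_pos σ x)), ?_⟩
    rw [← Perm.iterate_eq_pow, ← Perm.iterate_eq_pow, period, Function.iterate_mod_minimalPeriod_eq]
  · rintro ⟨i, -, rfl⟩
    exact ⟨i, by simp⟩

theorem card_orb (σ : Perm α) (x : α) : (orb σ x).card = period σ x := by
  rw [orb_eq_image, Finset.card_image_of_injOn, Finset.card_range]
  simpa using pow_injOn_period σ x

theorem sameCycle_mul_swap {σ : Perm α} {x y : α} (h : ¬ σ.SameCycle x y) :
    (σ * swap x y).SameCycle y x := by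
  refine ⟨period σ x, ?_⟩
  rw [zpow_natCast, pow_mul_swap_apply (period_pos σ x), pow_period]
  intro j h1 h2
  refine ⟨fun h0 => ?_, fun h0 => h ⟨j, by simpa using h0⟩⟩
  exact h1.ne' (pow_injOn_period σ x h2 (period_pos σ x) (by simpa using h0))

/-- The product links `x` and `y`, so each step of `σ` stays inside an orbit of the product.
Conversely each step of the product stays in an orbit of `σ` or in the union of the two orbits. -/
theorem orb_mul_swap {σ : Perm α} {x y : α} (h : ¬ σ.SameCycle x y) (a : α) :
    orb (σ * swap x y) a =
      if a ∈ orb σ x ∪ orb σ y then orb σ x ∪ orb σ y else orb σ a := by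
  have hxy := sameCycle_mul_swap h
  have hle : ∀ {a b : α}, σ.SameCycle a b → (σ * swap x y).SameCycle a b := by
    refine fun hab => SameCycle.rel (r := (σ * swap x y).SameCycle)
      ⟨fun _ => Perm.SameCycle.refl _ _, fun h => h.symm, fun h h' => h.trans h'⟩ (fun a => ?_) hab
    by_cases hx : a = x
    · subst hx
      refine hxy.symm.trans ⟨1, ?_⟩
      simp
    by_cases hy : a = y
    · subst hy
      refine hxy.trans ⟨1, ?_⟩
      simp
    · exact ⟨1, by simp [swap_apply_of_ne_of_ne hx hy]⟩
  have hU : ∀ {a b : α}, σ.SameCycle a b → (a ∈ orb σ x ∪ orb σ y ↔ b ∈ orb σ x ∪ orb σ y) := by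
    intro a b hab
    simp only [Finset.mem_union, mem_orb]
    exact ⟨fun h => h.imp (fun h => h.trans hab) fun h => h.trans hab,
      fun h => h.imp (fun h => h.trans hab.symm) fun h => h.trans hab.symm⟩
  have hge : ∀ {a b : α}, (σ * swap x y).SameCycle a b →
      σ.SameCycle a b ∨ a ∈ orb σ x ∪ orb σ y ∧ b ∈ orb σ x ∪ orb σ y := by
    refine fun hab => SameCycle.rel (σ := σ * swap x y)
      (r := fun a b => σ.SameCycle a b ∨ a ∈ orb σ x ∪ orb σ y ∧ b ∈ orb σ x ∪ orb σ y)
      ⟨fun _ => Or.inl (Perm.SameCycle.refl _ _), ?_, ?_⟩ (fun a => ?_) hab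
    · rintro a b (h | h)
      · exact Or.inl h.symm
      · exact Or.inr h.symm
    · rintro a b c (h | h) (h' | h')
      · exact Or.inl (h.trans h')
      · exact Or.inr ⟨(hU h).2 h'.1, h'.2⟩
      · exact Or.inr ⟨h.1, (hU h').1 h.2⟩
      · exact Or.inr ⟨h.1, h'.2⟩
    · by_cases hx : a = x
      · subst hx
        refine Or.inr ⟨by simp [self_mem_orb], ?_⟩
        simp only [Perm.mul_apply, swap_apply_left, Finset.mem_union, mem_orb]
        exact Or.inr ⟨1, by simp⟩
      by_cases hy : a = y
      · subst hy
        refine Or.inr ⟨by simp [self_mem_orb], ?_⟩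
        simp only [Perm.mul_apply, swap_apply_right, Finset.mem_union, mem_orb]
        exact Or.inl ⟨1, by simp⟩
      · exact Or.inl ⟨1, by simp [swap_apply_of_ne_of_ne hx hy]⟩
  have hall : ∀ b ∈ orb σ x ∪ orb σ y, (σ * swap x y).SameCycle x b := by
    intro b hb
    rcases Finset.mem_union.1 hb with hb | hb
    · exact hle (mem_orb.1 hb)
    · exact hxy.symm.trans (hle (mem_orb.1 hb))
  ext b
  split_ifs with ha
  · rw [mem_orb]
    exact ⟨fun hb => (hge hb).elim (fun h => (hU h).1 ha) fun h => h.2,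
      fun hb => (hall a ha).symm.trans (hall b hb)⟩
  · rw [mem_orb, mem_orb]
    exact ⟨fun hb => (hge hb).elim id fun h => absurd h.1 ha, hle⟩

theorem orbs_mul_swap {σ : Perm α} {x y : α} (h : ¬ σ.SameCycle x y) :
    orbs (σ * swap x y) =
      insert (orb σ x ∪ orb σ y) (((orbs σ).erase (orb σ x)).erase (orb σ y)) := by
  have hx : x ∈ orb σ x ∪ orb σ y := Finset.mem_union_left _ (self_mem_orb σ x)
  ext c
  simp only [mem_orbs, Finset.mem_insert, Finset.mem_erase, orb_mul_swap h]
  constructor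
  · rintro ⟨a, rfl⟩
    split_ifs with ha
    · exact Or.inl rfl
    · rw [Finset.mem_union, mem_orb, mem_orb, not_or] at ha
      refine Or.inr ⟨fun h => ha.2 (orb_eq_orb.1 h).symm, fun h => ha.1 (orb_eq_orb.1 h).symm,
        a, rfl⟩
  · rintro (rfl | ⟨h1, h2, a, rfl⟩)
    · exact ⟨x, if_pos hx⟩
    · refine ⟨a, if_neg ?_⟩
      rw [Finset.mem_union, mem_orb, mem_orb, not_or]
      exact ⟨fun h => h2 (orb_eq_orb.2 h).symm, fun h => h1 (orb_eq_orb.2 h).symm⟩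

theorem union_orb_notMem {σ : Perm α} {x y : α} (h : ¬ σ.SameCycle x y) :
    orb σ x ∪ orb σ y ∉ orbs σ := by
  intro h0
  have hx := eq_orb_of_mem h0 (Finset.mem_union_left _ (self_mem_orb σ x))
  refine h (mem_orb.1 ?_)
  rw [← hx]
  exact Finset.mem_union_right _ (self_mem_orb σ y)

theorem disjoint_orb {σ : Perm α} {x y : α} (h : ¬ σ.SameCycle x y) :
    Disjoint (orb σ x) (orb σ y) := by
  rw [Finset.disjoint_left]
  intro a ha hb
  exact h ((mem_orb.1 ha).trans (mem_orb.1 hb).symm)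

/-- From `(σ ^ k) x` the product runs through `σ x, …, (σ ^ k) x` and closes up after exactly `k`
steps without meeting `x`. -/
theorem split_orb {σ : Perm α} {x : α} {k : ℕ} (hk : 0 < k) (hk' : k < period σ x) :
    ¬ (σ * swap x ((σ ^ k) x)).SameCycle x ((σ ^ k) x) ∧
      (orb (σ * swap x ((σ ^ k) x)) ((σ ^ k) x)).card = k := by
  set y := (σ ^ k) x with hy
  set τ := σ * swap x y with hτ
  have hne : ∀ i j, i < period σ x → j < period σ x → i ≠ j → (σ ^ i) x ≠ (σ ^ j) x :=
    fun i j hi hj hij h => hij (pow_injOn_period σ x hi hj h)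
  have hpow : ∀ j, 0 < j → j ≤ k → (τ ^ j) y = (σ ^ j) x := by
    intro j h1 h2
    refine pow_mul_swap_apply h1 fun i h3 h4 => ⟨?_, hne i k (by omega) hk' (by omega)⟩
    have := hne i 0 (by omega) (by omega) (by omega)
    simpa using this
  have hper : period τ y = k := by
    refine le_antisymm ?_ ?_
    · refine Function.IsPeriodicPt.minimalPeriod_le hk ?_
      rw [Function.IsPeriodicPt, Function.IsFixedPt, Perm.iterate_eq_pow, hpow k hk le_rfl]
    · by_contra! hlt
      have h1 := hpow _ (period_pos τ y) hlt.le
      rw [pow_period] at h1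
      exact hne k _ hk' (by omega) hlt.ne' h1
  refine ⟨fun h => ?_, by rw [card_orb, hper]⟩
  have hx : x ∈ orb τ y := mem_orb.2 h.symm
  rw [orb_eq_image, hper] at hx
  obtain ⟨i, hi, hix⟩ := Finset.mem_image.1 hx
  rw [Finset.mem_range] at hi
  rcases Nat.eq_zero_or_pos i with rfl | hi0
  · have := hne k 0 hk' (by omega) (by omega)
    simp only [pow_zero, Perm.one_apply] at hix this
    exact this hix
  · rw [hpow i hi0 hi.le] at hix
    have := hne i 0 (by omega) (by omega) (by omega)
    simp only [pow_zero, Perm.one_apply] at this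
    exact this hix

end Orbits

/-! ### The cycle type monomial and the sum over transpositions -/

section CycleMonomial

variable {K : Type*} [Field K] {α : Type*} [Fintype α] [DecidableEq α]

/-- The product of the variables `q_{|c|}` over the orbits `c` of `σ`. -/
noncomputable def cycleMon (σ : Perm α) : MvPowerSeries ℕ+ K :=
  ∏ c ∈ orbs σ, X c.card.toPNat'

theorem toPNat'_card_orb (σ : Perm α) (x : α) :
    (((orb σ x).card.toPNat' : ℕ+) : ℕ) = (orb σ x).card := by
  rw [Nat.toPNat'_coe, if_pos (Finset.card_pos.2 ⟨x, self_mem_orb σ x⟩)]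

theorem toPNat'_card {σ : Perm α} {c : Finset α} (hc : c ∈ orbs σ) :
    ((c.card.toPNat' : ℕ+) : ℕ) = c.card := by
  obtain ⟨x, rfl⟩ := mem_orbs.1 hc
  exact toPNat'_card_orb σ x

theorem cycleMon_mul_swap_of_not_sameCycle {σ : Perm α} {x y : α} (h : ¬ σ.SameCycle x y) :
    (cycleMon (σ * swap x y) : MvPowerSeries ℕ+ K) =
      Xn ((orb σ x).card + (orb σ y).card) *
        ∏ c ∈ ((orbs σ).erase (orb σ x)).erase (orb σ y), X c.card.toPNat' := by
  rw [cycleMon, orbs_mul_swap h, Finset.prod_insert fun h0 =>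
    union_orb_notMem h (Finset.mem_of_mem_erase (Finset.mem_of_mem_erase h0)), ← Xn_coe,
    Nat.toPNat'_coe, if_pos (Finset.card_pos.2 ⟨x, Finset.mem_union_left _ (self_mem_orb σ x)⟩),
    Finset.card_union_of_disjoint (disjoint_orb h)]

theorem cycleMon_mul_swap_pow {σ : Perm α} {x : α} {k : ℕ} (hk : 0 < k) (hk' : k < period σ x) :
    (cycleMon (σ * swap x ((σ ^ k) x)) : MvPowerSeries ℕ+ K) =
      Xn k * Xn (period σ x - k) * ∏ c ∈ (orbs σ).erase (orb σ x), X c.card.toPNat' := by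
  obtain ⟨h1, h2⟩ := split_orb hk hk'
  set y := (σ ^ k) x with hy
  set τ := σ * swap x y with hτ
  -- A second multiplication by the transposition joins the two pieces again, so the merging lemmas
  -- apply to `τ`.
  have hσ : τ * swap x y = σ := by rw [hτ, mul_assoc, swap_mul_self, mul_one]
  have ho := orbs_mul_swap h1
  have hox := orb_mul_swap h1 x
  rw [hσ] at ho hox
  rw [if_pos (Finset.mem_union_left _ (self_mem_orb τ x))] at hox
  have hd := Finset.card_union_of_disjoint (disjoint_orb h1)
  rw [← hox, card_orb, h2] at hd
  have hxy : orb τ y ≠ orb τ x := fun h => h1 (orb_eq_orb.1 h).symm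
  rw [ho, hox, Finset.erase_insert fun h0 =>
    union_orb_notMem h1 (Finset.mem_of_mem_erase (Finset.mem_of_mem_erase h0)), cycleMon,
    ← Finset.mul_prod_erase _ _ (orb_mem_orbs τ x),
    ← Finset.mul_prod_erase _ _ (Finset.mem_erase.2 ⟨hxy, orb_mem_orbs τ y⟩), ← Xn_coe, ← Xn_coe,
    toPNat'_card_orb, toPNat'_card_orb, h2, show (orb τ x).card = period σ x - k by omega]
  ring

end CycleMonomial

end GJV

namespace GJV

open MvPowerSeries Equiv
open Finset.HasAntidiagonal (antidiagonal)

/-! ### `M_0` as multiplication by the sum of all transpositions -/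

section SwapSum

variable {K : Type*} [Field K] {α : Type*} [Fintype α] [DecidableEq α]

/-- The transpositions of `α`. -/
abbrev Transposition (α : Type*) [DecidableEq α] : Type _ := {t : Perm α // t.IsSwap}

noncomputable instance : Fintype (Transposition α) := Fintype.ofFinite _

theorem two_nsmul_sum_transposition {M : Type*} [AddCommMonoid M] (F : Perm α → M) :
    2 • ∑ t : Transposition α, F t = ∑ x : α, ∑ y : α, if y = x then 0 else F (swap x y) := by
  let g : {p : α × α // p.2 ≠ p.1} → Transposition α := fun p =>
    ⟨swap p.1.1 p.1.2, p.1.1, p.1.2, p.2.symm, rfl⟩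
  have hg : ∀ t : Transposition α, (Finset.univ.filter fun p => g p = t).card = 2 := by
    intro t
    -- The ordered pairs giving `t` correspond, through their first entry, to the two points moved
    -- by `t`.
    rw [← Perm.card_support_eq_two.2 t.2]
    refine Finset.card_bij (fun p _ => p.1.1) ?_ ?_ ?_
    · rintro ⟨⟨x, y⟩, hxy⟩ hp
      rw [← (Finset.mem_filter.1 hp).2, Perm.mem_support]
      simpa [g] using hxy
    · rintro ⟨⟨x, y⟩, hxy⟩ hp ⟨⟨x', y'⟩, hxy'⟩ hp' h
      simp only at h
      subst h
      have h1 := congrArg Subtype.val ((Finset.mem_filter.1 hp).2.trans (Finset.mem_filter.1 hp').2.symm)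
      have h2 := congrArg (fun s : Perm α => s x) h1
      simp only [g, swap_apply_left] at h2
      subst h2
      rfl
    · intro x hx
      obtain ⟨t, a, b, hab, rfl⟩ := t
      have hx' := Perm.mem_support.1 hx
      refine ⟨⟨(x, swap a b x), hx'⟩, ?_, rfl⟩
      rw [Finset.mem_filter, and_iff_right (Finset.mem_univ _)]
      refine Subtype.ext ?_
      simp only [g]
      by_cases hxa : x = a
      · rw [hxa, swap_apply_left]
      by_cases hxb : x = b
      · rw [hxb, swap_apply_right, swap_comm]
      · exact absurd (swap_apply_of_ne_of_ne hxa hxb) hx'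
  have h1 : ∑ p, F (g p) = 2 • ∑ t : Transposition α, F t := by
    rw [← Finset.sum_fiberwise_of_maps_to (t := Finset.univ) (g := g) fun _ _ => Finset.mem_univ _,
      Finset.smul_sum]
    refine Finset.sum_congr rfl fun t _ => ?_
    rw [Finset.sum_congr rfl fun p hp => by rw [(Finset.mem_filter.1 hp).2], Finset.sum_const, hg]
  rw [← h1, ← Fintype.sum_prod_type' fun x y => if y = x then 0 else F (swap x y)]
  rw [← Finset.sum_subtype (p := fun p : α × α => p.2 ≠ p.1)
    (Finset.univ.filter fun p : α × α => p.2 ≠ p.1) (by simp) fun p => F (swap p.1 p.2),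
    Finset.sum_filter]
  refine Finset.sum_congr rfl fun p _ => ?_
  by_cases h : p.2 = p.1
  · rw [if_pos h, if_neg (not_not.2 h)]
  · rw [if_neg h, if_pos h]

/-- The factor `c.card` is the choice of a point `x` in the orbit, and cutting off a piece of length
`k` is the choice of `y = (σ ^ k) x`. The case `k = 0`, that is `y = x`, vanishes by `Xn 0 = 0`. -/
theorem cutl_zero_cycleMon (σ : Perm α) :
    cutl 0 (cycleMon σ : MvPowerSeries ℕ+ K) =
      ∑ x, ∑ y ∈ orb σ x, if y = x then 0 else cycleMon (σ * swap x y) := by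
  rw [cycleMon, cutl_zero_prod]
  have h1 : ∀ c ∈ orbs σ, ((c.card.toPNat' : ℕ+) : MvPowerSeries ℕ+ K) *
      ((∑ p ∈ antidiagonal (c.card.toPNat' : ℕ), Xn p.1 * Xn p.2) *
        ∏ c' ∈ (orbs σ).erase c, X c'.card.toPNat') =
      c.card • ((∑ p ∈ antidiagonal c.card, Xn p.1 * Xn p.2) *
        ∏ c' ∈ (orbs σ).erase c, X c'.card.toPNat') := fun c hc => by
    rw [toPNat'_card hc, nsmul_eq_mul]
  rw [Finset.sum_congr rfl h1, ← sum_orb σ fun c =>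
    (∑ p ∈ antidiagonal c.card, Xn p.1 * Xn p.2) *
      ∏ c' ∈ (orbs σ).erase c, (X c'.card.toPNat' : MvPowerSeries ℕ+ K)]
  refine Finset.sum_congr rfl fun x _ => ?_
  rw [orb_eq_image σ x, Finset.sum_image (by simpa using pow_injOn_period σ x), ← orb_eq_image,
    card_orb, Finset.Nat.sum_antidiagonal_eq_sum_range_succ
      (fun i j => (Xn i * Xn j : MvPowerSeries ℕ+ K)), Finset.sum_range_succ, Nat.sub_self,
    Xn_zero, mul_zero, add_zero, Finset.sum_mul]
  refine Finset.sum_congr rfl fun k hk => ?_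
  rw [Finset.mem_range] at hk
  rcases Nat.eq_zero_or_pos k with rfl | hk0
  · rw [pow_zero, Perm.one_apply, if_pos rfl, Xn_zero, zero_mul, zero_mul]
  · rw [if_neg, cycleMon_mul_swap_pow hk0 hk]
    intro h
    exact hk0.ne' (pow_injOn_period σ x hk (period_pos σ x) (by simpa using h))

/-- The product of the two orbit lengths counts the choices of `x` and `y` in two different orbits,
which the transposition merges. -/
theorem joinl_zero_cycleMon (σ : Perm α) :
    joinl 0 (cycleMon σ : MvPowerSeries ℕ+ K) =
      ∑ x, ∑ y, if y ∈ orb σ x then 0 else cycleMon (σ * swap x y) := by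
  let F : Finset α → Finset α → MvPowerSeries ℕ+ K := fun c c' => if c' = c then 0 else
    Xn (c.card + c'.card) * ∏ c'' ∈ ((orbs σ).erase c).erase c', X c''.card.toPNat'
  have h1 : ∀ c ∈ orbs σ, ∑ c' ∈ (orbs σ).erase c,
      (((c.card.toPNat' : ℕ+) : MvPowerSeries ℕ+ K) * ((c'.card.toPNat' : ℕ+) :
        MvPowerSeries ℕ+ K)) * (X (c.card.toPNat' + c'.card.toPNat') *
          ∏ c'' ∈ ((orbs σ).erase c).erase c', X c''.card.toPNat') =
      c.card • ∑ y, F c (orb σ y) := by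
    intro c hc
    rw [sum_orb σ (F c), ← Finset.add_sum_erase _ _ hc]
    simp only [F]
    rw [if_pos trivial, smul_zero, zero_add, Finset.smul_sum]
    refine Finset.sum_congr rfl fun c' hc' => ?_
    rw [if_neg (Finset.mem_erase.1 hc').1, ← Xn_coe, PNat.add_coe, toPNat'_card hc,
      toPNat'_card (Finset.mem_erase.1 hc').2, nsmul_eq_mul, nsmul_eq_mul, mul_assoc]
  rw [cycleMon, joinl_zero_prod, Finset.sum_congr rfl h1,
    ← sum_orb σ fun c => ∑ y, F c (orb σ y)]
  refine Finset.sum_congr rfl fun x _ => Finset.sum_congr rfl fun y _ => ?_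
  simp only [F, orb_eq_orb, mem_orb]
  by_cases h : σ.SameCycle x y
  · rw [if_pos h, if_pos h.symm]
  · rw [if_neg h, if_neg fun h' => h h'.symm, cycleMon_mul_swap_of_not_sameCycle h]

/-- A transposition cuts an orbit if its two points share it and joins two orbits otherwise; the 1/2
in `Ml` corrects for ordered pairs. -/
theorem Ml_zero_cycleMon [CharZero K] (σ : Perm α) :
    Ml 0 (cycleMon σ : MvPowerSeries ℕ+ K) = ∑ t : Transposition α, cycleMon (σ * (t : Perm α)) := by
  have h := two_nsmul_sum_transposition fun t : Perm α => (cycleMon (σ * t) : MvPowerSeries ℕ+ K)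
  have h2 : (2 : K) ≠ 0 := two_ne_zero
  refine smul_right_injective _ h2 ?_
  beta_reduce
  rw [← Nat.cast_ofNat (R := K), Nat.cast_smul_eq_nsmul K 2 (∑ _, _), h, Ml, LinearMap.add_apply,
    LinearMap.smul_apply, LinearMap.smul_apply, ← smul_add, smul_smul,
    show ((2 : ℕ) : K) * (1 / 2) = 1 by norm_num, one_smul, cutl_zero_cycleMon,
    joinl_zero_cycleMon, ← Finset.sum_add_distrib]
  refine Finset.sum_congr rfl fun x _ => ?_
  rw [← Finset.sum_filter_add_sum_filter_not Finset.univ (fun y => y ∈ orb σ x)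
    fun y => if y = x then 0 else _]
  congr 1
  · exact Finset.sum_congr (by ext; simp) fun _ _ => rfl
  · rw [Finset.sum_filter]
    refine Finset.sum_congr rfl fun y _ => ?_
    by_cases h : y ∈ orb σ x
    · rw [if_pos h, if_neg (not_not.2 h)]
    · rw [if_neg h, if_pos h, if_neg]
      rintro rfl
      exact h (self_mem_orb _ _)

theorem Ml_zero_iterate_cycleMon [CharZero K] (m : ℕ) (σ : Perm α) :
    (Ml 0)^[m] (cycleMon σ : MvPowerSeries ℕ+ K) =
      ∑ t : Fin m → Transposition α,
        (cycleMon (σ * (List.ofFn fun i => (t i : Perm α)).prod) : MvPowerSeries ℕ+ K) := by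
  induction m generalizing σ with
  | zero => simp
  | succ m ih =>
    rw [Function.iterate_succ_apply, Ml_zero_cycleMon, ← Module.End.coe_pow, map_sum]
    simp only [Module.End.coe_pow]
    rw [Finset.sum_congr rfl fun (t : Transposition α) _ => ih (σ * (t : Perm α)),
      ← (Fin.consEquiv fun _ => Transposition α).sum_comp, Fintype.sum_prod_type]
    refine Finset.sum_congr rfl fun t _ => Finset.sum_congr rfl fun t' _ => ?_
    rw [List.ofFn_succ, List.prod_cons, mul_assoc]
    rfl

end SwapSum

/-! ### Labellings -/

section Labelling

variable {α : Type*} [Fintype α] [DecidableEq α]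

/-- The labellings of the orbits of `σ` by `Fin n` such that the `i`-th one has length `b i`. -/
abbrev Labelling {n : ℕ} (b : Fin n → ℕ) (σ : Perm α) : Type _ :=
  {l : α → Fin n // (∀ x y, l x = l y ↔ σ.SameCycle x y) ∧ ∀ i, Nat.card {x // l x = i} = b i}

/-- A labelling and an enumeration of the orbits determine each other: the `i`-th orbit is the fibre
over `i`, which is non-empty because `b i > 0`. -/
theorem nPoint_cycleMon {K : Type*} [Field K] {n : ℕ} (b : Fin n → ℕ) (hb : ∀ i, 0 < b i)
    (σ : Perm α) :
    nPoint Dl constCoeff (cycleMon σ : MvPowerSeries ℕ+ K) (List.ofFn b) =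
      (∏ i, (b i : K)) * (Nat.card (Labelling b σ) : K) := by
  rw [cycleMon, nPoint_prod, ← Nat.card_eq_fintype_card]
  congr 2
  symm
  have hfib : ∀ (l : α → Fin n) (i : Fin n),
      (Finset.univ.filter fun x => l x = i).card = Nat.card {x // l x = i} := fun l i => by
    rw [Nat.card_eq_fintype_card, Fintype.card_subtype]
  have horb : ∀ l : Labelling b σ, ∀ x, Finset.univ.filter (fun y => l.1 y = l.1 x) = orb σ x := by
    intro l x
    ext y
    rw [Finset.mem_filter, mem_orb, l.2.1]
    simp [Perm.sameCycle_comm]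
  have hsurj : ∀ l : Labelling b σ, ∀ i, ∃ x, l.1 x = i := by
    intro l i
    have := hb i
    rw [← l.2.2 i, ← hfib, Finset.card_pos] at this
    obtain ⟨x, hx⟩ := this
    exact ⟨x, (Finset.mem_filter.1 hx).2⟩
  refine Nat.card_congr (Equiv.ofBijective (fun l => ⟨fun i =>
    Finset.univ.filter fun x => l.1 x = i, ?_, ?_, ?_⟩) ⟨?_, ?_⟩)
  · intro i j hij
    obtain ⟨x, rfl⟩ := hsurj l i
    have : x ∈ Finset.univ.filter fun y => l.1 y = j := by
      beta_reduce at hij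
      rw [← hij]; simp
    exact (Finset.mem_filter.1 this).2
  · intro c
    rw [mem_orbs]
    constructor
    · rintro ⟨x, rfl⟩
      exact ⟨l.1 x, horb l x⟩
    · rintro ⟨i, rfl⟩
      obtain ⟨x, rfl⟩ := hsurj l i
      exact ⟨x, (horb l x).symm⟩
  · intro i
    obtain ⟨x, hx⟩ := hsurj l i
    rw [Nat.toPNat'_coe, if_pos, hfib, l.2.2]
    exact Finset.card_pos.2 ⟨x, by simp [hx]⟩
  · intro l l' h
    ext1
    funext x
    have h1 : (Finset.univ.filter fun y => l.1 y = l.1 x) =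
        Finset.univ.filter fun y => l'.1 y = l.1 x := congrFun (congrArg Subtype.val h) (l.1 x)
    have h2 : x ∈ Finset.univ.filter fun y => l'.1 y = l.1 x := by
      rw [← h1]; simp
    exact (Finset.mem_filter.1 h2).2.symm
  · rintro ⟨f, hf, hC, hw⟩
    have hx : ∀ x, ∃ i, f i = orb σ x := fun x => (hC _).1 (orb_mem_orbs σ x)
    choose l hl using hx
    have hfl : ∀ i, Finset.univ.filter (fun x => l x = i) = f i := by
      intro i
      ext x
      rw [Finset.mem_filter, and_iff_right (Finset.mem_univ x)]
      constructor
      · rintro rfl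
        rw [hl]
        exact self_mem_orb σ x
      · intro hx
        refine hf ?_
        rw [hl, ← eq_orb_of_mem ((hC _).2 ⟨i, rfl⟩) hx]
    refine ⟨⟨l, fun x y => ?_, fun i => ?_⟩, Subtype.ext (funext hfl)⟩
    · rw [← orb_eq_orb, ← hl x, ← hl y]
      exact ⟨congrArg f, fun h => hf h⟩
    · rw [← hfib, hfl, ← hw i, toPNat'_card ((hC _).2 ⟨i, rfl⟩)]

end Labelling

end GJV

namespace GJV

open MvPowerSeries Equiv

/-! ### The count of coverings -/

section FullCycles

variable {α : Type*} [Fintype α] [DecidableEq α]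

/-- The permutations with a single orbit. -/
abbrev FullCycle (α : Type*) : Type _ := {σ : Perm α // ∀ x y, σ.SameCycle x y}

noncomputable instance : Fintype (FullCycle α) := Fintype.ofFinite _

theorem card_fullCycle [Nonempty α] :
    Fintype.card (FullCycle α) = (Fintype.card α - 1).factorial := by
  -- On a single point the identity has one orbit but is not a cycle in the sense of `Perm.IsCycle`.
  rcases Nat.lt_or_ge (Fintype.card α) 2 with h | h
  · have : Subsingleton α := Fintype.card_le_one_iff_subsingleton.1 (by omega)
    rw [Nat.sub_eq_zero_of_le (by omega), Nat.factorial_zero, Fintype.card_eq_one_iff]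
    refine ⟨⟨1, fun x y => Subsingleton.elim x y ▸ Perm.SameCycle.refl _ _⟩, fun σ => ?_⟩
    exact Subtype.ext (Subsingleton.elim _ _)
  · have h1 := Perm.card_of_cycleType_singleton (α := α) h le_rfl
    rw [Nat.choose_self, mul_one] at h1
    rw [← h1, Fintype.card_of_subtype]
    intro σ
    rw [Finset.mem_filter, and_iff_right (Finset.mem_univ σ)]
    constructor
    · intro hσ
      have hc : σ.IsCycle := by
        rw [← Perm.card_cycleType_eq_one, hσ, Multiset.card_singleton]
      have hs : σ.support = Finset.univ := by
        rw [hc.cycleType, Multiset.singleton_inj] at hσ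
        exact Finset.eq_univ_of_card _ hσ
      have hm : ∀ x, σ x ≠ x := fun x => Perm.mem_support.1 (hs ▸ Finset.mem_univ x)
      exact fun x y => hc.sameCycle (hm x) (hm y)
    · intro hσ
      have hm : ∀ x, σ x ≠ x := by
        intro x hx
        have : Nontrivial α := Fintype.one_lt_card_iff_nontrivial.1 h
        obtain ⟨y, hy⟩ := exists_ne x
        obtain ⟨i, hi⟩ := hσ x y
        rw [Perm.zpow_apply_eq_self_of_apply_eq_self hx] at hi
        exact hy hi.symm
      have hc : σ.IsCycle := ⟨Classical.arbitrary α, hm _, fun y _ => hσ _ y⟩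
      rw [hc.cycleType]
      congr 1
      rw [show σ.support = Finset.univ from
        Finset.eq_univ_of_forall fun x => Perm.mem_support.2 (hm x), Finset.card_univ]

theorem cycleMon_fullCycle {K : Type*} [Field K] [Nonempty α] (σ : FullCycle α) :
    (cycleMon (σ : Perm α) : MvPowerSeries ℕ+ K) = Xn (Fintype.card α) := by
  have h : ∀ x, orb (σ : Perm α) x = Finset.univ := fun x =>
    Finset.eq_univ_of_forall fun y => mem_orb.2 (σ.2 x y)
  have h1 : orbs (σ : Perm α) = {Finset.univ} := by
    ext c
    rw [mem_orbs, Finset.mem_singleton]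
    simp only [h]
    exact ⟨fun ⟨_, h⟩ => h.symm, fun h => ⟨Classical.arbitrary α, h.symm⟩⟩
  rw [cycleMon, h1, Finset.prod_singleton, ← Xn_coe, Nat.toPNat'_coe,
    if_pos (Finset.card_pos.2 Finset.univ_nonempty), Finset.card_univ]

end FullCycles

/-! ### Hurwitz numbers as iterates of the cut-and-join operator -/

section Coverings

variable {n : ℕ} (m : ℕ) (b : Fin n → ℕ)

/-- A covering is determined by its monodromy around `0`, its transpositions and its labelling. -/
noncomputable def coveringEquiv : Covering m b ≃
    (σ : FullCycle (Fin (∑ i, b i))) × (t : Fin m → Transposition (Fin (∑ i, b i))) ×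
      Labelling b ((σ : Perm (Fin (∑ i, b i))) * (List.ofFn fun i => (t i : Perm _)).prod) where
  toFun X := ⟨⟨X.zero, X.zero_full⟩, fun i => ⟨X.swap i, X.swap_isSwap i⟩, X.label, by
    have h : X.zero * (List.ofFn X.swap).prod = X.infty⁻¹ := mul_eq_one_iff_eq_inv.1 X.prod_eq_one
    refine ⟨fun x y => ?_, X.card_label⟩
    rw [X.label_eq_iff]
    simp only [h, Perm.sameCycle_inv]⟩
  invFun Y :=
    { zero := Y.1
      swap := fun i => Y.2.1 i
      infty := ((Y.1 : Perm (Fin (∑ i, b i))) * (List.ofFn fun i => (Y.2.1 i : Perm _)).prod)⁻¹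
      label := Y.2.2.1
      zero_full := Y.1.2
      swap_isSwap := fun i => (Y.2.1 i).2
      prod_eq_one := mul_inv_cancel _
      label_eq_iff := fun x y => by rw [Perm.sameCycle_inv]; exact Y.2.2.2.1 x y
      card_label := Y.2.2.2.2 }
  left_inv X := by
    ext1
    · rfl
    · rfl
    · exact (mul_eq_one_iff_eq_inv'.1 X.prod_eq_one).symm
    · rfl
  right_inv Y := rfl

instance : Finite (Covering m b) := Finite.of_equiv _ (coveringEquiv m b).symm

/-- Orbit-stabilizer: an orbit has `d! / |Aut|` elements, so weighting classes by `1 / |Aut|`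
divides the number of coverings by `d!`. -/
theorem hurwitz_eq_card (g : ℕ) :
    hurwitz g b = (Nat.card (Covering (2 * g + n - 1) b) : ℚ) / (∑ i, b i).factorial := by
  classical
  have : Fintype (Covering (2 * g + n - 1) b) := Fintype.ofFinite _
  have : Fintype (MulAction.orbitRel.Quotient (Perm (Fin (∑ i, b i)))
    (Covering (2 * g + n - 1) b)) := Fintype.ofFinite _
  have : ∀ X : Covering (2 * g + n - 1) b, Fintype (MulAction.stabilizer
    (Perm (Fin (∑ i, b i))) X) := fun _ => Fintype.ofFinite _
  have h := MulAction.card_eq_sum_card_group_div_card_stabilizer (Perm (Fin (∑ i, b i)))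
    (Covering (2 * g + n - 1) b)
  rw [hurwitz, finsum_eq_sum_of_fintype, Nat.card_eq_fintype_card, h, Nat.cast_sum,
    Finset.sum_div]
  refine Finset.sum_congr rfl fun ω _ => ?_
  have h1 : ((∑ i, b i).factorial : ℚ) ≠ 0 := by positivity
  rw [Nat.cast_div, Fintype.card_perm, Fintype.card_fin, Nat.card_eq_fintype_card]
  · field_simp
  · simpa only [Nat.card_eq_fintype_card] using Subgroup.card_subgroup_dvd_card
      (MulAction.stabilizer (Perm (Fin (∑ i, b i))) ω.out)
  · exact Nat.cast_ne_zero.2 Fintype.card_ne_zero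

theorem nPoint_zero {K E : Type*} [Field K] [AddCommGroup E] [Module K E]
    (δ : ℕ → Module.End K E) (ε : E →ₗ[K] K) (l : List ℕ) : nPoint δ ε 0 l = 0 := by
  rw [← zero_smul K (0 : E), nPoint_smul, zero_mul]

/-- The condition `l.sum = d` makes the single variable `q_d` agree with `onePoint`, which does not
know the degree. -/
theorem nPoint_Xn {K : Type*} [Field K] (d : ℕ) (l : List ℕ) (h : l.sum = d) :
    nPoint Dl constCoeff (Xn d : MvPowerSeries ℕ+ K) l = ((onePoint l : ℚ) : K) := by
  rcases Nat.eq_zero_or_pos d with rfl | hd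
  · rw [Xn_zero, nPoint_zero]
    rcases l with _ | ⟨b, _ | ⟨c, l⟩⟩
    · simp [onePoint]
    · have : b = 0 := by simpa using h
      simp [onePoint, this]
    · simp [onePoint]
  lift d to ℕ+ using hd
  rw [Xn_coe]
  rcases l with _ | ⟨b, _ | ⟨c, l⟩⟩
  · exact absurd h.symm d.ne_zero
  · have : b = d := by simpa using h
    subst this
    rw [nPoint_cons, Dl_q, if_pos rfl, nPoint, constCoeff_apply, map_natCast]
    simp [onePoint]
  · rw [nPoint_cons, nPoint_cons, Dl_q]
    have : Dl c (if (d : ℕ) = b then (b : MvPowerSeries ℕ+ K) else 0) = 0 := by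
      split_ifs
      · exact Dl_natCast _ _
      · exact map_zero _
    rw [this, nPoint_zero]
    simp [onePoint]

theorem nPoint_iterate_Ml_zero {K : Type*} [Field K] [CharZero K] (f : MvPowerSeries ℕ+ K) :
    nPoint Dl constCoeff ((Ml 0)^[m] f) = cutJoin^[m] (nPoint Dl constCoeff f) := by
  induction m with
  | zero => rfl
  | succ m ih =>
    rw [Function.iterate_succ_apply', Function.iterate_succ_apply', ← ih]
    exact funext fun l => nPoint_Ml_zero _ l

theorem cutJoin_iterate_congr {V : Type*} [AddCommGroup V] [Module ℚ V] {F F' : List ℕ → V}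
    {d : ℕ} (h : ∀ l : List ℕ, l.sum = d → F l = F' l) (l : List ℕ) (hl : l.sum = d) :
    cutJoin^[m] F l = cutJoin^[m] F' l := by
  induction m generalizing l with
  | zero => exact h l hl
  | succ m ih =>
    rw [Function.iterate_succ_apply', Function.iterate_succ_apply']
    exact cutJoin_congr l _ _ fun l' _ h' => ih l' (h'.trans hl)

/-- For a fixed monodromy at `0` the sum over transpositions is `(Ml 0)^[m]` applied to `q_d`. The
result does not depend on which of the `(d - 1)!` full cycles is taken. -/
theorem card_covering (hn : 1 ≤ n) (hb : ∀ i, 0 < b i) :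
    (∏ i, (b i : ℚ)) * Nat.card (Covering m b) =
      ((∑ i, b i) - 1).factorial * cutJoin^[m] onePoint (List.ofFn b) := by
  have hd : 0 < ∑ i, b i := Finset.sum_pos (fun i _ => hb i) ⟨⟨0, hn⟩, Finset.mem_univ _⟩
  have : Nonempty (Fin (∑ i, b i)) := ⟨⟨0, hd⟩⟩
  have hL : ∀ σ : Perm (Fin (∑ i, b i)), Finite (Labelling b σ) := fun _ => inferInstance
  have hm : ∀ σ : FullCycle (Fin (∑ i, b i)), ∑ t : Fin m → Transposition (Fin (∑ i, b i)),
      (∏ i, (b i : ℚ)) * Nat.card (Labelling b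
        ((σ : Perm (Fin (∑ i, b i))) * (List.ofFn fun i => (t i : Perm _)).prod)) =
      cutJoin^[m] onePoint (List.ofFn b) := by
    intro σ
    simp only [← nPoint_cycleMon b hb]
    rw [← nPoint_sum, ← Ml_zero_iterate_cycleMon, cycleMon_fullCycle, Fintype.card_fin,
      nPoint_iterate_Ml_zero]
    refine cutJoin_iterate_congr m (d := ∑ i, b i) (fun l hl => ?_) _ (List.sum_ofFn ..)
    rw [nPoint_Xn _ l hl, Rat.cast_id]
  rw [Nat.card_congr (coveringEquiv m b), Nat.card_sigma]
  simp only [Nat.card_sigma]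
  push_cast
  simp only [Finset.mul_sum, hm]
  rw [Finset.sum_const, Finset.card_univ, card_fullCycle, Fintype.card_fin, nsmul_eq_mul]

theorem hurwitz_eq (g : ℕ) (hn : 1 ≤ n) (hb : ∀ i, 0 < b i) :
    (∏ i, (b i : ℚ)) * ((∑ i, b i : ℕ) * hurwitz g b) =
      cutJoin^[2 * g + n - 1] onePoint (List.ofFn b) := by
  have hd : 0 < ∑ i, b i := Finset.sum_pos (fun i _ => hb i) ⟨⟨0, hn⟩, Finset.mem_univ _⟩
  have h := card_covering (2 * g + n - 1) b hn hb
  rw [hurwitz_eq_card]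
  have h1 : ((∑ i, b i).factorial : ℚ) = (∑ i, b i : ℕ) * ((∑ i, b i) - 1).factorial := by
    rw [← Nat.cast_mul, Nat.mul_factorial_pred hd.ne']
  have h2 : (((∑ i, b i) - 1).factorial : ℚ) ≠ 0 := by positivity
  have h3 : ((∑ i, b i : ℕ) : ℚ) ≠ 0 := Nat.cast_ne_zero.2 hd.ne'
  rw [h1]
  refine mul_left_cancel₀ h2 ?_
  rw [← h]
  field_simp

end Coverings

end GJV

namespace GJV

open PowerSeries
open Finset.HasAntidiagonal (antidiagonal)

/-! ### Hurwitz numbers are polynomial -/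

theorem sinhQuot_ofFn {n : ℕ} (b : Fin n → ℕ) :
    sinhQuot (List.ofFn b) = ((∏ i, b i : ℕ) : ℚ⟦X⟧) * (X ^ (n - 1) *
      (sinhcInv * ∏ i, rescale (b i : ℚ) sinhc)) := by
  rw [sinhQuot, List.prod_ofFn, List.length_ofFn, List.map_ofFn, List.prod_ofFn]
  rfl

/-- Here `m = 2g + n - 1`, and two of the `m` factors `d` are divided out. The condition `3 ≤ 2g +
n` says that `m - 2` is not negative. -/
theorem hurwitz_div_eq {n : ℕ} (b : Fin n → ℕ) (g : ℕ) (hn : 1 ≤ n) (hg : 3 ≤ 2 * g + n)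
    (hb : ∀ i, 0 < b i) :
    hurwitz g b / ((∑ i, b i : ℕ) * (2 * g + n - 1).factorial : ℚ) =
      (∑ i, b i : ℕ) ^ (2 * g + n - 3) *
        coeff (2 * g) (sinhcInv * ∏ i, rescale (b i : ℚ) sinhc) := by
  have h := hurwitz_eq b g hn hb
  have hl : List.ofFn b ≠ [] := fun h => by
    have := congrArg List.length h
    rw [List.length_ofFn, List.length_nil] at this
    omega
  rw [cutJoin_iterate_onePoint _ hl, sinhQuot_ofFn, List.sum_ofFn, ← map_natCast (C (R := ℚ)),
    coeff_C_mul, show 2 * g + n - 1 = 2 * g + (n - 1) by omega, coeff_X_pow_mul,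
    show 2 * g + (n - 1) = 2 * g + n - 3 + 2 by omega] at h
  rw [show 2 * g + n - 1 = 2 * g + n - 3 + 2 by omega]
  have hP : ((∏ i, b i : ℕ) : ℚ) ≠ 0 :=
    Nat.cast_ne_zero.2 (Finset.prod_ne_zero_iff.2 fun i _ => (hb i).ne')
  have hd : ((∑ i, b i : ℕ) : ℚ) ≠ 0 :=
    Nat.cast_ne_zero.2 (Finset.sum_pos (fun i _ => hb i) ⟨⟨0, hn⟩, Finset.mem_univ _⟩).ne'
  have hm : ((2 * g + n - 3 + 2).factorial : ℚ) ≠ 0 := Nat.cast_ne_zero.2 (Nat.factorial_ne_zero _)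
  rw [← Nat.cast_prod] at h
  rw [div_eq_iff (mul_ne_zero hd hm)]
  refine mul_left_cancel₀ (mul_ne_zero hP hd) ?_
  rw [mul_assoc, h]
  ring

/-- The coefficient of `t^k` in the product of the `sinh(bᵢt/2) / (bᵢt/2)` as a polynomial in
the `bᵢ`. -/
noncomputable def sinhcPoly (n k : ℕ) : MvPolynomial (Fin n) ℚ :=
  coeff k (∏ i : Fin n, rescale (MvPolynomial.X i) (map MvPolynomial.C sinhc))

theorem eval_sinhcPoly {n : ℕ} (k : ℕ) (b : Fin n → ℚ) :
    MvPolynomial.eval b (sinhcPoly n k) = coeff k (∏ i, rescale (b i) sinhc) := by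
  rw [sinhcPoly, ← coeff_map, map_prod]
  congr 1
  refine Finset.prod_congr rfl fun i _ => ?_
  ext j
  simp [coeff_rescale]

theorem sinhcPoly_isHomogeneous (n k : ℕ) : (sinhcPoly n k).IsHomogeneous k := by
  rw [sinhcPoly, coeff_prod]
  refine MvPolynomial.IsHomogeneous.sum _ _ _ fun l hl => ?_
  rw [Finset.mem_finsuppAntidiag] at hl
  rw [← hl.1]
  refine MvPolynomial.IsHomogeneous.prod _ _ _ fun i _ => ?_
  rw [coeff_rescale, coeff_map, mul_comm]
  exact (MvPolynomial.isHomogeneous_X_pow i (l i)).C_mul _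

theorem rescale_neg_one_sinhc : rescale (-1 : ℚ) sinhc = sinhc := by
  ext j
  rw [coeff_rescale, sinhc, coeff_mk]
  split_ifs with hj
  · rw [hj.neg_one_pow, one_mul]
  · rw [mul_zero]

theorem sinhcPoly_of_odd (n : ℕ) {k : ℕ} (hk : Odd k) : sinhcPoly n k = 0 := by
  refine MvPolynomial.funext fun b => ?_
  rw [map_zero, eval_sinhcPoly]
  have h2 : rescale (-1 : ℚ) (∏ i, rescale (b i) sinhc) = ∏ i, rescale (b i) sinhc := by
    rw [map_prod]
    refine Finset.prod_congr rfl fun i _ => ?_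
    rw [rescale_rescale, mul_comm, ← rescale_rescale, rescale_neg_one_sinhc]
  have h3 := congrArg (coeff k) h2
  rw [coeff_rescale, hk.neg_one_pow] at h3
  linarith

theorem coeff_sinhcInv_mul_prod {n : ℕ} (g : ℕ) (b : Fin n → ℚ) :
    coeff (2 * g) (sinhcInv * ∏ i, rescale (b i) sinhc) =
      ∑ j ∈ Finset.range (g + 1), coeff (2 * j) sinhcInv *
        MvPolynomial.eval b (sinhcPoly n (2 * (g - j))) := by
  rw [coeff_mul]
  simp only [← eval_sinhcPoly]
  symm
  refine Finset.sum_of_injOn (fun j => (2 * j, 2 * (g - j))) ?_ ?_ ?_ ?_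
  · intro i _ j _ h
    have := (Prod.mk.inj h).1
    omega
  · intro j hj
    rw [Finset.mem_coe, Finset.mem_range] at hj
    rw [Finset.mem_coe, Finset.HasAntidiagonal.mem_antidiagonal]
    change 2 * j + 2 * (g - j) = 2 * g
    omega
  · rintro ⟨p, p'⟩ hp hp'
    rw [Finset.HasAntidiagonal.mem_antidiagonal] at hp
    simp only at hp ⊢
    -- The product of the even series `rescale (b i) sinhc` has no odd coefficients.
    rcases Nat.even_or_odd' p' with ⟨k, hk | hk⟩
    · refine absurd ⟨g - k, ?_, ?_⟩ hp'
      · rw [Finset.mem_coe, Finset.mem_range]; omega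
      · simp only [Prod.mk.injEq]; omega
    · rw [sinhcPoly_of_odd n ⟨k, hk⟩, map_zero, mul_zero]
  · intro j _
    rfl

/-- The part of the Goulden-Jackson-Vakil polynomial which belongs to `λ_{2j}`. -/
noncomputable def hurwitzPoly (g n j : ℕ) : MvPolynomial (Fin n) ℚ :=
  MvPolynomial.C (coeff (2 * j) sinhcInv) *
    ((∑ i, MvPolynomial.X i) ^ (2 * g + n - 3) * sinhcPoly n (2 * (g - j)))

theorem hurwitzPoly_isHomogeneous {g n j : ℕ} (hg : 3 ≤ 2 * g + n) (hj : j ≤ g) :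
    (hurwitzPoly g n j).IsHomogeneous (4 * g + n - 3 - 2 * j) := by
  have h1 : (∑ i : Fin n, MvPolynomial.X i : MvPolynomial (Fin n) ℚ).IsHomogeneous 1 :=
    MvPolynomial.IsHomogeneous.sum _ _ _ fun i _ => MvPolynomial.isHomogeneous_X ℚ i
  have h2 := ((h1.pow (2 * g + n - 3)).mul (sinhcPoly_isHomogeneous n (2 * (g - j)))).C_mul
    (coeff (2 * j) sinhcInv)
  rw [show 4 * g + n - 3 - 2 * j = 1 * (2 * g + n - 3) + 2 * (g - j) by omega]
  exact h2

theorem hurwitz_div_eq_sum {n : ℕ} (b : Fin n → ℕ) (g : ℕ) (hn : 1 ≤ n) (hg : 3 ≤ 2 * g + n)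
    (hb : ∀ i, 0 < b i) :
    hurwitz g b / ((∑ i, b i : ℕ) * (2 * g + n - 1).factorial : ℚ) =
      ∑ j ∈ Finset.range (g + 1), MvPolynomial.eval (fun i => (b i : ℚ)) (hurwitzPoly g n j) := by
  rw [hurwitz_div_eq b g hn hg hb, coeff_sinhcInv_mul_prod, Finset.mul_sum]
  refine Finset.sum_congr rfl fun j _ => ?_
  simp only [hurwitzPoly, map_mul, map_pow, map_sum, MvPolynomial.eval_C, MvPolynomial.eval_X,
    Nat.cast_sum]
  ring

/-- The symmetry is read off from the closed formula, without relabelling any coverings. -/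
theorem hurwitz_comp_perm {n : ℕ} (b : Fin n → ℕ) (g : ℕ) (hn : 1 ≤ n) (hg : 3 ≤ 2 * g + n)
    (hb : ∀ i, 0 < b i) (σ : Equiv.Perm (Fin n)) :
    hurwitz g (b ∘ σ) / ((∑ i, b i : ℕ) * (2 * g + n - 1).factorial : ℚ) =
      hurwitz g b / ((∑ i, b i : ℕ) * (2 * g + n - 1).factorial : ℚ) := by
  have h := hurwitz_div_eq (b ∘ σ) g hn hg fun i => hb _
  simp only [Function.comp_apply] at h
  rw [Equiv.sum_comp σ b, Equiv.prod_comp σ fun i => rescale (b i : ℚ) sinhc] at h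
  rw [h, hurwitz_div_eq b g hn hg hb]

/-! ### The intersection numbers -/

/-- The polynomial with given coefficients in degree `N`. -/
noncomputable def polyOf {n : ℕ} (N : ℕ) (c : (Fin n → ℕ) → ℚ) : MvPolynomial (Fin n) ℚ :=
  ∑ d ∈ Finset.piAntidiag Finset.univ N, MvPolynomial.monomial (Finsupp.equivFunOnFinite.symm d) (c d)

theorem eval_polyOf {n : ℕ} (N : ℕ) (c : (Fin n → ℕ) → ℚ) (b : Fin n → ℚ) :
    MvPolynomial.eval b (polyOf N c) =
      ∑ d ∈ Finset.piAntidiag Finset.univ N, c d * ∏ i, b i ^ d i := by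
  rw [polyOf, map_sum]
  refine Finset.sum_congr rfl fun d _ => ?_
  rw [MvPolynomial.eval_monomial, Finsupp.prod_fintype _ _ fun i => pow_zero _]
  rfl

theorem coeff_polyOf {n : ℕ} (N : ℕ) (c : (Fin n → ℕ) → ℚ) (d : Fin n → ℕ) :
    MvPolynomial.coeff (Finsupp.equivFunOnFinite.symm d) (polyOf N c) =
      if ∑ i, d i = N then c d else 0 := by
  rw [polyOf, MvPolynomial.coeff_sum]
  simp only [MvPolynomial.coeff_monomial, EmbeddingLike.apply_eq_iff_eq]
  rw [Finset.sum_ite_eq']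
  simp [Finset.mem_piAntidiag]

theorem polyOf_coeff {n N : ℕ} {p : MvPolynomial (Fin n) ℚ} (hp : p.IsHomogeneous N) :
    polyOf N (fun d => MvPolynomial.coeff (Finsupp.equivFunOnFinite.symm d) p) = p := by
  ext s
  obtain ⟨d, rfl⟩ := Finsupp.equivFunOnFinite.symm.surjective s
  rw [coeff_polyOf]
  split_ifs with h
  · rfl
  · refine (hp.coeff_eq_zero fun h' => h ?_).symm
    rw [← h', Finsupp.degree_eq_sum]
    rfl

/-- Polynomials that agree at all positive integers are equal, and the parts for different `j` have
different degrees, so no coefficients mix. -/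
theorem coeff_unique {n g : ℕ} (hg : 3 ≤ 2 * g + n) (c c' : ℕ → (Fin n → ℕ) → ℚ)
    (h : ∀ b : Fin n → ℕ, (∀ i, 0 < b i) →
      ∑ j ∈ Finset.range (g + 1), (-1) ^ j *
        ∑ d ∈ Finset.piAntidiag Finset.univ (4 * g + n - 3 - 2 * j), c j d * ∏ i, (b i : ℚ) ^ d i =
      ∑ j ∈ Finset.range (g + 1), (-1) ^ j *
        ∑ d ∈ Finset.piAntidiag Finset.univ (4 * g + n - 3 - 2 * j), c' j d * ∏ i, (b i : ℚ) ^ d i)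
    {j : ℕ} (hj : j ≤ g) {d : Fin n → ℕ} (hd : 4 * g + n = 2 * j + ∑ i, d i + 3) :
    c j d = c' j d := by
  have hp : ∑ j ∈ Finset.range (g + 1), (-1 : ℚ) ^ j • polyOf (4 * g + n - 3 - 2 * j) (c j) =
      ∑ j ∈ Finset.range (g + 1), (-1 : ℚ) ^ j • polyOf (4 * g + n - 3 - 2 * j) (c' j) := by
    refine MvPolynomial.funext_set (fun _ => (Nat.cast : ℕ → ℚ) '' Set.Ioi 0)
      (fun _ => (Set.Ioi_infinite 0).image Nat.cast_injective.injOn) fun x hx => ?_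
    choose b hb hb' using fun i => hx i trivial
    obtain rfl : (fun i => (b i : ℚ)) = x := funext hb'
    simp only [map_sum, MvPolynomial.smul_eval, eval_polyOf]
    exact h b hb
  have h1 := congrArg (MvPolynomial.coeff (Finsupp.equivFunOnFinite.symm d)) hp
  simp only [MvPolynomial.coeff_sum, MvPolynomial.coeff_smul, coeff_polyOf, smul_eq_mul] at h1
  have h2 : ∀ c : ℕ → (Fin n → ℕ) → ℚ, (∑ k ∈ Finset.range (g + 1), (-1 : ℚ) ^ k *
      if ∑ i, d i = 4 * g + n - 3 - 2 * k then c k d else 0) = (-1) ^ j * c j d := by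
    intro c
    rw [Finset.sum_eq_single j]
    · rw [if_pos (by omega)]
    · intro k hk hkj
      rw [Finset.mem_range] at hk
      rw [if_neg (by omega), mul_zero]
    · intro hj'
      exact absurd (Finset.mem_range.2 (by omega)) hj'
  rw [h2, h2] at h1
  exact mul_left_cancel₀ (pow_ne_zero _ (by norm_num)) h1

/-- For `n = 0` the equation reads `4g = 2j + 3`, which parity excludes; for `g = 0` it forces `n ≥
3`. So the pairs `(0, 1)` and `(0, 2)` never meet a non-zero number. -/
theorem genus_bound {g j n s : ℕ} (h : 4 * g + n = 2 * j + s + 3)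
    (hs : n = 0 → s = 0) : 1 ≤ n ∧ 3 ≤ 2 * g + n := by
  rcases Nat.eq_zero_or_pos n with h0 | h0
  · have := hs h0
    omega
  · omega

theorem sum_eq_zero_of_fin_zero {n : ℕ} (d : Fin n → ℕ) (hn : n = 0) : ∑ i, d i = 0 := by
  subst hn
  exact Finset.sum_empty

theorem IsIntersectionNumbers.unique {I I' : ℕ → List ℕ → ℚ} (h : IsIntersectionNumbers I)
    (h' : IsIntersectionNumbers I') : I = I' := by
  funext j l
  revert l
  rw [List.forall_iff_forall_tuple]
  intro n d
  by_cases hg : ∃ g, j ≤ g ∧ 4 * g + (List.ofFn d).length = 2 * j + (List.ofFn d).sum + 3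
  · obtain ⟨g, hj, hd⟩ := hg
    rw [List.length_ofFn, List.sum_ofFn] at hd
    obtain ⟨hn, hg⟩ := genus_bound hd (sum_eq_zero_of_fin_zero d)
    refine coeff_unique hg (fun j d => I j (List.ofFn d)) (fun j d => I' j (List.ofFn d))
      (fun b hb => ?_) hj hd
    rw [← h.hurwitz_eq g n hn hg b hb, ← h'.hurwitz_eq g n hn hg b hb]
  · rw [h.eq_zero _ _ hg, h'.eq_zero _ _ hg]

theorem IsIntersectionNumbers.comp_perm {I : ℕ → List ℕ → ℚ} (h : IsIntersectionNumbers I)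
    (j : ℕ) {n : ℕ} (d : Fin n → ℕ) (σ : Equiv.Perm (Fin n)) :
    I j (List.ofFn (d ∘ σ)) = I j (List.ofFn d) := by
  by_cases hg : ∃ g, j ≤ g ∧ 4 * g + n = 2 * j + ∑ i, d i + 3
  · obtain ⟨g, hj, hd⟩ := hg
    obtain ⟨hn, hg⟩ := genus_bound hd (sum_eq_zero_of_fin_zero d)
    refine coeff_unique hg (fun j d => I j (List.ofFn (d ∘ σ))) (fun j d => I j (List.ofFn d))
      (fun b hb => ?_) hj hd
    rw [← h.hurwitz_eq g n hn hg b hb, ← hurwitz_comp_perm b g hn hg hb σ,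
      ← Equiv.sum_comp σ b]
    refine Eq.trans ?_ (h.hurwitz_eq g n hn hg (b ∘ σ) fun i => hb _).symm
    refine Finset.sum_congr rfl fun j _ => ?_
    congr 1
    refine Finset.sum_equiv (σ.symm.arrowCongr (Equiv.refl ℕ)) (fun d => ?_) fun d _ => ?_
    · simp only [Finset.mem_piAntidiag, Finset.mem_univ, implies_true, and_true]
      rw [show Finset.univ.sum ((σ.symm.arrowCongr (Equiv.refl ℕ)) d) = ∑ i, d i from
        Equiv.sum_comp σ d]
    · simp only [Equiv.arrowCongr_apply, Equiv.symm_symm, Equiv.coe_refl, Function.comp_apply, id_eq]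
      rw [Equiv.prod_comp σ fun i => (b i : ℚ) ^ d i]
      rfl
  · rw [h.eq_zero, h.eq_zero]
    · rwa [List.length_ofFn, List.sum_ofFn]
    · rw [List.length_ofFn, List.sum_ofFn]
      simpa only [Function.comp_apply, Equiv.sum_comp σ d] using hg

/-- Needed because `gTerm` lists a multiset in an unspecified order. -/
theorem IsIntersectionNumbers.perm {I : ℕ → List ℕ → ℚ} (h : IsIntersectionNumbers I)
    (j : ℕ) {l l' : List ℕ} (hl : l.Perm l') : I j l = I j l' := by
  obtain ⟨⟨n, d⟩, rfl⟩ := List.equivSigmaTuple.symm.surjective l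
  obtain ⟨⟨n', d'⟩, rfl⟩ := List.equivSigmaTuple.symm.surjective l'
  change (List.ofFn d).Perm (List.ofFn d') at hl
  change I j (List.ofFn d) = I j (List.ofFn d')
  obtain rfl : n = n' := by simpa using hl.length_eq
  have hs : d ∘ Tuple.sort d = d' ∘ Tuple.sort d' := by
    have hp := ((Tuple.sort d).ofFn_comp_perm d).trans
      (hl.trans ((Tuple.sort d').ofFn_comp_perm d').symm)
    exact List.ofFn_injective (hp.eq_of_pairwise'
      (Tuple.monotone_sort d).sortedLE_ofFn.pairwise
      (Tuple.monotone_sort d').sortedLE_ofFn.pairwise)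
  rw [← h.comp_perm j d (Tuple.sort d), hs, h.comp_perm]

/-- The coefficients of the Goulden-Jackson-Vakil polynomial. -/
noncomputable def hurwitzCoeff (g j : ℕ) (x : (n : ℕ) × (Fin n → ℕ)) : ℚ :=
  MvPolynomial.coeff (Finsupp.equivFunOnFinite.symm x.2) (hurwitzPoly g x.1 j)

open Classical in
/-- The intersection numbers `⟨λ_{2j} τ_{d₁} ⋯ τ_{dₙ}⟩`. -/
noncomputable def intersectionNumber (j : ℕ) (l : List ℕ) : ℚ :=
  if h : ∃ g, j ≤ g ∧ 4 * g + l.length = 2 * j + l.sum + 3 then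
    (-1) ^ j * hurwitzCoeff h.choose j (List.equivSigmaTuple l)
  else 0

theorem intersectionNumber_ofFn {g j n : ℕ} {d : Fin n → ℕ} (hj : j ≤ g)
    (hd : 4 * g + n = 2 * j + ∑ i, d i + 3) :
    intersectionNumber j (List.ofFn d) =
      (-1) ^ j * MvPolynomial.coeff (Finsupp.equivFunOnFinite.symm d) (hurwitzPoly g n j) := by
  have h : ∃ g, j ≤ g ∧ 4 * g + (List.ofFn d).length = 2 * j + (List.ofFn d).sum + 3 :=
    ⟨g, hj, by rwa [List.length_ofFn, List.sum_ofFn]⟩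
  -- The dimension equation determines `g`, so the chosen genus is the given one.
  have hc : h.choose = g := by
    have := h.choose_spec.2
    simp only [List.length_ofFn, List.sum_ofFn] at this hd ⊢
    omega
  rw [intersectionNumber, dif_pos h, hc]
  have he : List.equivSigmaTuple (List.ofFn d) = ⟨n, d⟩ :=
    List.equivSigmaTuple.apply_symm_apply ⟨n, d⟩
  rw [he]
  rfl

theorem isIntersectionNumbers_intersectionNumber : IsIntersectionNumbers intersectionNumber where
  hurwitz_eq g n hn hg b hb := by
    rw [hurwitz_div_eq_sum b g hn hg hb]
    refine Finset.sum_congr rfl fun j hj => ?_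
    have hj : j ≤ g := Nat.lt_succ_iff.1 (Finset.mem_range.1 hj)
    rw [← polyOf_coeff (hurwitzPoly_isHomogeneous hg hj), eval_polyOf, Finset.mul_sum]
    refine Finset.sum_congr rfl fun d hd => ?_
    have hd := (Finset.mem_piAntidiag.1 hd).1
    change ∑ i, d i = _ at hd
    rw [intersectionNumber_ofFn hj (by omega), ← mul_assoc, ← mul_assoc, ← mul_pow]
    norm_num
  eq_zero j d h := by
    rw [intersectionNumber, dif_neg h]

theorem existsUnique_intersectionNumbers :
    ∃! I : ℕ → List ℕ → ℚ, IsIntersectionNumbers I :=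
  ⟨_, isIntersectionNumbers_intersectionNumber,
    fun _ h => h.unique isIntersectionNumbers_intersectionNumber⟩

end GJV

namespace GJV

open MvPowerSeries
open Finset.HasAntidiagonal (antidiagonal)

variable {K : Type*} [Field K]

/-! ### The series `T_k` and their products -/

/-- `T_0 = q_1`, `T_{k+1} = (u Λ_0 + Λ_1) T_k`. -/
noncomputable def Tl (u : K) : ℕ → MvPowerSeries ℕ+ K
  | 0 => X 1
  | k + 1 => u • Λl 0 (Tl u k) + Λl 1 (Tl u k)

theorem constCoeff_Tl (u : K) (k : ℕ) : constCoeff (Tl u k) = 0 := by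
  rw [constCoeff_apply]
  cases k with
  | zero => exact constantCoeff_X _
  | succ k =>
    rw [Tl, map_add, constantCoeff_smul,
      constantCoeff_Λl, constantCoeff_Λl, smul_zero, add_zero]

theorem Dl_one (n : ℕ) : Dl n (1 : MvPowerSeries ℕ+ K) = 0 := by
  simpa using Dl_natCast (K := K) n 1

theorem Λl_one (a : ℕ) : Λl a (1 : MvPowerSeries ℕ+ K) = 0 := by
  rw [Λl_apply]
  simp only [Dl_one, mul_zero]
  exact coeffSum_eq_sum (T := ∅) fun _ _ => rfl

theorem Ml_one (a : ℕ) : Ml a (1 : MvPowerSeries ℕ+ K) = 0 := by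
  have h {ι : Type} : coeffSum (fun _ : ι => (0 : MvPowerSeries ℕ+ K)) = 0 :=
    coeffSum_eq_sum (T := ∅) fun _ _ => rfl
  rw [Ml, LinearMap.add_apply, LinearMap.smul_apply, LinearMap.smul_apply, cutl_apply, joinl_apply]
  simp only [Dl_one, map_zero, mul_zero, h, smul_zero, add_zero]

theorem eulerOp_one (u : K) : eulerOp u (1 : MvPowerSeries ℕ+ K) = 0 := by
  rw [eulerOp, LinearMap.add_apply, LinearMap.smul_apply, Λl_one, Λl_one, smul_zero, add_zero]

theorem Al_one (u : K) : Al u (1 : MvPowerSeries ℕ+ K) = 0 := by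
  simp only [Al, LinearMap.add_apply, LinearMap.smul_apply, Ml_one, smul_zero, add_zero]

theorem pointOp_mul (u : K) (b : ℕ) (f g : MvPowerSeries ℕ+ K) :
    pointOp u b (f * g) = pointOp u b f * g + f * pointOp u b g := by
  rw [pointOp_eq_sum u (Nat.lt_succ_self b)]
  simp only [LinearMap.sum_apply, LinearMap.smul_apply, Finset.sum_mul, Finset.mul_sum,
    ← Finset.sum_add_distrib]
  refine Finset.sum_congr rfl fun k _ => ?_
  rw [Dl_mul, smul_add, smul_mul_assoc, mul_smul_comm]

theorem pointOp_X_one (u : K) (b : ℕ) :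
    pointOp u b (X 1) = (b * u) • (1 : MvPowerSeries ℕ+ K) := by
  rw [pointOp_eq_sum u (Nat.lt_add_of_pos_right (show 0 < 2 by norm_num)), LinearMap.sum_apply,
    Finset.sum_eq_single 1]
  · rw [LinearMap.smul_apply, Dl_q, PNat.one_coe, if_pos rfl, Nat.choose_one_right, pow_one,
      Nat.cast_one]
  · intro k _ hk
    rw [LinearMap.smul_apply, Dl_q, PNat.one_coe, if_neg hk.symm, smul_zero]
  · intro h
    exact absurd (Finset.mem_range.2 (by omega)) h

/-- The recursion is `T_{k+1} = u · eulerOp T_k`. As `pointOp u b (T_k)` is a constant, which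
`eulerOp u` kills, each step only multiplies it by `b u`. -/
theorem pointOp_Tl {u : K} (hu : u ≠ 0) (b k : ℕ) :
    pointOp u b (Tl u k) = (b * u) ^ (k + 1) • (1 : MvPowerSeries ℕ+ K) := by
  induction k with
  | zero => rw [Tl, pointOp_X_one, zero_add, pow_one]
  | succ k ih =>
    have h : Tl u (k + 1) = u • eulerOp u (Tl u k) := by
      rw [Tl, eulerOp, LinearMap.add_apply, LinearMap.smul_apply, smul_add, smul_smul,
        mul_inv_cancel₀ hu, one_smul]
    rw [h, map_smul, pointOp_eulerOp hu, ih, map_smul, eulerOp_one,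
      smul_zero, add_zero, smul_smul, smul_smul]
    congr 1
    ring

/-- The product of the `T_i^{k_i}/k_i!`. -/
noncomputable def tauMon (u : K) (k : ℕ →₀ ℕ) : MvPowerSeries ℕ+ K :=
  k.prod fun i m => ((m.factorial : K)⁻¹) • Tl u i ^ m

theorem tauMon_eq_prod (u : K) {k : ℕ →₀ ℕ} {B : ℕ} (h : k.support ⊆ Finset.range B) :
    tauMon u k = ∏ i ∈ Finset.range B, (((k i).factorial : K)⁻¹) • Tl u i ^ k i :=
  Finsupp.prod_of_support_subset k h _ fun i _ => by simp

theorem pointOp_prod (u : K) (b : ℕ) {ι : Type*} [DecidableEq ι] (S : Finset ι)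
    (f : ι → MvPowerSeries ℕ+ K) :
    pointOp u b (∏ i ∈ S, f i) = ∑ i ∈ S, pointOp u b (f i) * ∏ j ∈ S.erase i, f j := by
  have h1 : pointOp u b (1 : MvPowerSeries ℕ+ K) = 0 := by
    have := pointOp_mul u b (1 : MvPowerSeries ℕ+ K) 1
    simpa using this
  induction S using Finset.induction_on with
  | empty => rw [Finset.prod_empty, Finset.sum_empty, h1]
  | insert a S ha ih =>
    rw [Finset.prod_insert ha, pointOp_mul, ih, Finset.sum_insert ha, Finset.erase_insert ha,
      Finset.mul_sum]
    congr 1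
    refine Finset.sum_congr rfl fun c hc => ?_
    rw [Finset.erase_insert_of_ne (fun h : a = c => ha (h ▸ hc)),
      Finset.prod_insert fun h => ha (Finset.mem_of_mem_erase h)]
    ring

theorem pointOp_pow_div_factorial [CharZero K] (u : K) (b m : ℕ) {t : MvPowerSeries ℕ+ K} {c : K}
    (ht : pointOp u b t = c • 1) :
    pointOp u b (((m.factorial : K)⁻¹) • t ^ m) =
      if m = 0 then 0 else c • (((m - 1).factorial : K)⁻¹) • t ^ (m - 1) := by
  have h : ∀ m : ℕ, pointOp u b (t ^ (m + 1)) = ((m + 1 : ℕ) * c : K) • t ^ m := by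
    intro m
    induction m with
    | zero => rw [zero_add, pow_one, ht, Nat.cast_one, one_mul, pow_zero]
    | succ m ih =>
      rw [pow_succ, pointOp_mul, ih, ht, mul_smul_comm, mul_one, smul_mul_assoc, ← pow_succ,
        ← add_smul]
      congr 1
      push_cast
      ring
  cases m with
  | zero =>
    have := pointOp_mul u b (1 : MvPowerSeries ℕ+ K) 1
    rw [if_pos rfl, map_smul, pow_zero]
    have h1 : pointOp u b (1 : MvPowerSeries ℕ+ K) = 0 := by simpa using this
    rw [h1, smul_zero]
  | succ m =>
    rw [if_neg m.succ_ne_zero, map_smul, h, smul_smul, smul_smul, Nat.add_sub_cancel,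
      Nat.factorial_succ]
    congr 1
    have h1 : ((m + 1 : ℕ) : K) ≠ 0 := Nat.cast_ne_zero.2 m.succ_ne_zero
    have h2 : (m.factorial : K) ≠ 0 := Nat.cast_ne_zero.2 m.factorial_ne_zero
    rw [Nat.cast_mul]
    field_simp

/-- The divided powers absorb the exponents, so a derivation removes one factor `T_i` at the sole
cost of `(b u)^(i+1)`. -/
theorem pointOp_tauMon [CharZero K] {u : K} (hu : u ≠ 0) (b : ℕ) {k : ℕ →₀ ℕ} {B : ℕ}
    (h : k.support ⊆ Finset.range B) :
    pointOp u b (tauMon u k) = ∑ i ∈ Finset.range B,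
      if k i = 0 then 0 else (b * u) ^ (i + 1) • tauMon u (k - Finsupp.single i 1) := by
  rw [tauMon_eq_prod u h, pointOp_prod]
  refine Finset.sum_congr rfl fun i hi => ?_
  rw [pointOp_pow_div_factorial u b (k i) (pointOp_Tl hu b i)]
  split_ifs
  · rw [zero_mul]
  · rw [smul_mul_assoc]
    congr 1
    have h' : (k - Finsupp.single i 1).support ⊆ Finset.range B := fun j hj => h (by
      rw [Finsupp.mem_support_iff] at hj ⊢
      rw [Finsupp.tsub_apply] at hj
      omega)
    rw [tauMon_eq_prod u h', ← Finset.mul_prod_erase _ _ hi, Finsupp.tsub_apply,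
      Finsupp.single_eq_same]
    congr 1
    refine Finset.prod_congr rfl fun j hj => ?_
    rw [Finsupp.tsub_apply, Finsupp.single_eq_of_ne (Finset.ne_of_mem_erase hj), tsub_zero]

theorem constCoeff_tauMon [CharZero K] (u : K) (k : ℕ →₀ ℕ) :
    constCoeff (tauMon u k) = if k = 0 then 1 else 0 := by
  rw [constCoeff_apply, tauMon, Finsupp.prod, map_prod]
  split_ifs with h
  · rw [h, Finsupp.support_zero, Finset.prod_empty]
  · obtain ⟨i, hi⟩ := Finsupp.support_nonempty_iff.2 h
    refine Finset.prod_eq_zero hi ?_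
    rw [constantCoeff_smul, map_pow, ← constCoeff_apply, constCoeff_Tl,
      zero_pow (Finsupp.mem_support_iff.1 hi), smul_zero]

theorem sum_piFinset_succ {M α : Type*} [AddCommMonoid M] [DecidableEq α] {n : ℕ} (S : Finset α)
    (F : (Fin (n + 1) → α) → M) :
    ∑ d ∈ Fintype.piFinset fun _ : Fin (n + 1) => S, F d =
      ∑ i ∈ S, ∑ d ∈ Fintype.piFinset fun _ : Fin n => S, F (Fin.cons i d) := by
  rw [← Finset.sum_product']
  refine Finset.sum_nbij' (fun d => (d 0, Fin.tail d)) (fun x => Fin.cons x.1 x.2) ?_ ?_ ?_ ?_ ?_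
  · intro d hd
    rw [Fintype.mem_piFinset] at hd
    rw [Finset.mem_product, Fintype.mem_piFinset]
    exact ⟨hd 0, fun i => hd i.succ⟩
  · rintro ⟨i, d⟩ hd
    rw [Finset.mem_product, Fintype.mem_piFinset] at hd
    rw [Fintype.mem_piFinset]
    exact Fin.cases hd.1 hd.2
  · exact fun d _ => Fin.cons_self_tail d
  · exact fun x _ => rfl
  · intro d _
    rw [Fin.cons_self_tail]

/-- The n-point functions of a product of the `T_i`. -/
theorem nPoint_tauMon [CharZero K] {u : K} (hu : u ≠ 0) {n : ℕ} (b : Fin n → ℕ) {k : ℕ →₀ ℕ} {B : ℕ}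
    (h : k.support ⊆ Finset.range B) :
    nPoint (pointOp u) constCoeff (tauMon u k) (List.ofFn b) =
      ∑ d ∈ Fintype.piFinset fun _ : Fin n => Finset.range B,
        if ∑ i, Finsupp.single (d i) 1 = k then ∏ i, (b i * u) ^ (d i + 1) else 0 := by
  induction n generalizing k with
  | zero =>
    rw [List.ofFn_zero, nPoint, constCoeff_tauMon, Fintype.piFinset_of_isEmpty]
    simp [eq_comm]
  | succ n ih =>
    rw [List.ofFn_succ, nPoint_cons, pointOp_tauMon hu _ h, nPoint_sum, sum_piFinset_succ]
    refine Finset.sum_congr rfl fun i hi => ?_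
    simp only [Fin.sum_univ_succ, Fin.prod_univ_succ, Fin.cons_zero, Fin.cons_succ]
    split_ifs with hk
    · rw [nPoint_zero]
      refine (Finset.sum_eq_zero fun d _ => if_neg fun h' => ?_).symm
      have := DFunLike.congr_fun h' i
      rw [Finsupp.add_apply, Finsupp.single_eq_same, hk] at this
      omega
    · have h' : (k - Finsupp.single i 1).support ⊆ Finset.range B := fun j hj => h (by
        rw [Finsupp.mem_support_iff] at hj ⊢
        rw [Finsupp.tsub_apply] at hj
        omega)
      have hle : Finsupp.single i 1 ≤ k := by simpa using Nat.one_le_iff_ne_zero.2 hk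
      rw [nPoint_smul, ih _ h', Finset.mul_sum]
      refine Finset.sum_congr rfl fun d _ => ?_
      rw [mul_ite, mul_zero]
      congr 1
      rw [eq_iff_iff, eq_tsub_iff_add_eq_of_le hle, add_comm]

/-! ### Sums over monomials of given weight -/

/-- The weight of `τ₀^{k₀} τ₁^{k₁} ⋯`, where `τ_i` has weight `i + 1`. -/
noncomputable def tauWeight : (ℕ →₀ ℕ) →+ ℕ := Finsupp.weight fun i => i + 1

theorem tauWeight_single (i m : ℕ) : tauWeight (Finsupp.single i m) = m * (i + 1) := by
  rw [tauWeight, Finsupp.weight_single, smul_eq_mul]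

theorem mul_le_tauWeight (k : ℕ →₀ ℕ) (i : ℕ) : k i * (i + 1) ≤ tauWeight k := by
  have h : Finsupp.single i (k i) ≤ k := by simp
  rw [← tauWeight_single, ← tsub_add_cancel_of_le h, map_add]
  simp

theorem lt_of_tauWeight {k : ℕ →₀ ℕ} {i : ℕ} (h : k i ≠ 0) : i < tauWeight k :=
  (Nat.le_mul_of_pos_left (i + 1) (Nat.pos_of_ne_zero h)).trans (mul_le_tauWeight k i)

theorem support_subset_range_tauWeight (k : ℕ →₀ ℕ) : k.support ⊆ Finset.range (tauWeight k) :=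
  fun _ hi => Finset.mem_range.2 (lt_of_tauWeight (Finsupp.mem_support_iff.1 hi))

theorem finite_tauWeight (N : ℕ) : {k : ℕ →₀ ℕ | tauWeight k = N}.Finite := by
  refine (Set.finite_Iic (∑ i ∈ Finset.range N, Finsupp.single i N)).subset fun k hk i => ?_
  rw [Set.mem_ofPred_eq] at hk
  subst hk
  by_cases h : k i = 0
  · rw [h]; exact Nat.zero_le _
  · rw [Finsupp.finsetSum_apply]
    refine le_trans ?_ (Finset.single_le_sum (fun _ _ => Nat.zero_le _)
      (Finset.mem_range.2 (lt_of_tauWeight h)))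
    rw [Finsupp.single_eq_same]
    exact (Nat.le_mul_of_pos_right (k i) i.succ_pos).trans (mul_le_tauWeight k i)

/-- The monomials of weight `N` in the `τ_i`. -/
noncomputable def tauExponents (N : ℕ) : Finset (ℕ →₀ ℕ) := (finite_tauWeight N).toFinset

theorem mem_tauExponents {N : ℕ} {k : ℕ →₀ ℕ} : k ∈ tauExponents N ↔ tauWeight k = N :=
  (finite_tauWeight N).mem_toFinset

theorem tauWeight_sum_single {n : ℕ} (d : Fin n → ℕ) :
    tauWeight (∑ i, Finsupp.single (d i) 1) = ∑ i, d i + n := by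
  rw [map_sum]
  simp only [tauWeight_single, one_mul, Finset.sum_add_distrib]
  simp

/-- Assigning an index `d i` to each point determines the exponent vector `k`; summing over all `k`
of weight `N` leaves the free sum over `d` with `∑ (d i + 1) = N`. -/
theorem nPoint_sum_tauMon [CharZero K] {u : K} (hu : u ≠ 0) {n : ℕ} (b : Fin n → ℕ) (N : ℕ)
    (F : (ℕ →₀ ℕ) → K) :
    nPoint (pointOp u) constCoeff (∑ k ∈ tauExponents N, F k • tauMon u k) (List.ofFn b) =
      if n ≤ N then ∑ d ∈ Finset.piAntidiag Finset.univ (N - n),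
        F (∑ i, Finsupp.single (d i) 1) * ∏ i, (b i * u) ^ (d i + 1) else 0 := by
  have h1 : ∀ k ∈ tauExponents N, nPoint (pointOp u) constCoeff (F k • tauMon u k) (List.ofFn b) =
      ∑ d ∈ Fintype.piFinset fun _ : Fin n => Finset.range N,
        if ∑ i, Finsupp.single (d i) 1 = k then F k * ∏ i, (b i * u) ^ (d i + 1) else 0 := by
    intro k hk
    have hs := support_subset_range_tauWeight k
    rw [mem_tauExponents.1 hk] at hs
    rw [nPoint_smul, nPoint_tauMon hu b hs, Finset.mul_sum]
    simp only [mul_ite, mul_zero]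
  rw [nPoint_sum, Finset.sum_congr rfl h1, Finset.sum_comm]
  simp only [Finset.sum_ite_eq, mem_tauExponents, tauWeight_sum_single]
  rw [← Finset.sum_filter]
  split_ifs with h
  · refine Finset.sum_congr ?_ fun _ _ => rfl
    ext d
    rw [Finset.mem_filter, Fintype.mem_piFinset, Finset.mem_piAntidiag]
    simp only [Finset.mem_univ, implies_true, and_true, Finset.mem_range]
    change (_ ∧ _) ↔ ∑ i, d i = _
    constructor
    · omega
    · intro hd
      refine ⟨fun i => ?_, by omega⟩
      have := Finset.single_le_sum (f := d) (fun _ _ => Nat.zero_le _) (Finset.mem_univ i)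
      have := i.pos
      omega
  · refine Finset.sum_eq_zero fun d hd => ?_
    have := (Finset.mem_filter.1 hd).2
    omega

end GJV

namespace GJV

open MvPowerSeries

/-! ### The homogeneous parts of `G` -/

theorem tauWeight_eq (k : ℕ →₀ ℕ) :
    tauWeight k = (Finsupp.toMultiset k).toList.sum + (Finsupp.toMultiset k).toList.length := by
  rw [Multiset.sum_toList, Multiset.length_toList]
  induction k using Finsupp.induction_linear with
  | zero => simp
  | add k k' h h' => simp only [map_add, h, h', Multiset.sum_add, Multiset.card_add]; ring
  | single i m =>
    rw [tauWeight_single, Finsupp.toMultiset_single]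
    simp [mul_add, Multiset.sum_nsmul, add_comm]

theorem toList_perm_ofFn {n : ℕ} (d : Fin n → ℕ) :
    (Finsupp.toMultiset (∑ i, Finsupp.single (d i) 1)).toList.Perm (List.ofFn d) := by
  rw [← Multiset.coe_eq_coe, Multiset.coe_toList, map_sum]
  simp only [Finsupp.toMultiset_single, one_smul]
  induction n with
  | zero => simp
  | succ n ih =>
    rw [Fin.sum_univ_succ, ih, List.ofFn_succ, ← Multiset.cons_coe, Multiset.singleton_add]

/-! ### The weights occurring in `G` and their comparison with the cut-and-join iterates -/

section Vanishing

variable {I : ℕ → List ℕ → ℚ}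

theorem IsIntersectionNumbers.exists_genus (hI : IsIntersectionNumbers I) {j : ℕ} {l : List ℕ}
    (h : I j l ≠ 0) : ∃ g, j ≤ g ∧ 4 * g + l.length = 2 * j + l.sum + 3 := by
  by_contra h0
  exact h (hI.eq_zero j l h0)

theorem IsIntersectionNumbers.exists_weight (hI : IsIntersectionNumbers I) {j : ℕ} {k : ℕ →₀ ℕ}
    (h : I j (Finsupp.toMultiset k).toList ≠ 0) :
    ∃ m, 2 ≤ m ∧ j < m ∧ 2 * j + 1 + tauWeight k = 2 * m := by
  obtain ⟨g, hj, hg⟩ := hI.exists_genus h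
  have h1 := tauWeight_eq k
  generalize (Finsupp.toMultiset k).toList = l at *
  obtain ⟨h2, h3⟩ := genus_bound hg fun h0 => by rw [List.length_eq_zero_iff.1 h0, List.sum_nil]
  -- The number of simple branch points: the dimension equation makes the weight exactly twice this
  -- number.
  exact ⟨2 * g + l.length - 1, by omega, by omega, by omega⟩

/-- The part of weight `2m` of the Goulden-Jackson-Vakil polynomial. -/
noncomputable def weightSum (I : ℕ → List ℕ → ℚ) (m : ℕ) {n : ℕ} (b : Fin n → ℕ) : ℚ :=
  ∑ j ∈ Finset.range m, if n ≤ 2 * m - 1 - 2 * j then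
    (-1) ^ j * ∑ d ∈ Finset.piAntidiag Finset.univ (2 * m - 1 - 2 * j - n),
      I j (List.ofFn d) * ∏ i, (b i : ℚ) ^ d i else 0

/-- Apart from the factor `X ^ (n - 1)` all series involved are even. -/
theorem coeff_sinhQuot_eq_zero {n m : ℕ} (hn : 1 ≤ n) (h : ¬ ∃ g, m + 1 = 2 * g + n) (b : Fin n → ℕ) :
    PowerSeries.coeff m (sinhQuot (List.ofFn b)) = 0 := by
  rw [sinhQuot_ofFn, ← map_natCast (PowerSeries.C (R := ℚ)), PowerSeries.coeff_C_mul,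
    PowerSeries.coeff_X_pow_mul']
  split_ifs with hm
  · have hodd : Odd (m - (n - 1)) := by
      rw [← Nat.not_even_iff_odd]
      rintro ⟨g, hg⟩
      exact h ⟨g, by omega⟩
    have h2 : PowerSeries.rescale (-1 : ℚ) sinhcInv = sinhcInv := by
      have := congrArg (PowerSeries.rescale (-1 : ℚ)) sinhc_mul_inv
      rw [map_mul, rescale_neg_one_sinhc, map_one, ← sinhc_mul_inv] at this
      refine mul_left_cancel₀ (fun h0 => ?_) this
      have := constantCoeff_sinhc
      rw [h0, map_zero] at this
      exact zero_ne_one this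
    have h3 : PowerSeries.rescale (-1 : ℚ)
        (sinhcInv * ∏ i, PowerSeries.rescale (b i : ℚ) sinhc) =
        sinhcInv * ∏ i, PowerSeries.rescale (b i : ℚ) sinhc := by
      rw [map_mul, map_prod, h2]
      congr 1
      refine Finset.prod_congr rfl fun i _ => ?_
      rw [PowerSeries.rescale_rescale, mul_comm, ← PowerSeries.rescale_rescale,
        rescale_neg_one_sinhc]
    have h4 := congrArg (PowerSeries.coeff (m - (n - 1))) h3
    rw [PowerSeries.coeff_rescale, hodd.neg_one_pow] at h4
    rw [show PowerSeries.coeff (m - (n - 1))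
      (sinhcInv * ∏ i, PowerSeries.rescale (b i : ℚ) sinhc) = 0 by linarith, mul_zero]
  · rw [mul_zero]

/-- If `m = 2g - 1 + n` this is the defining Hurwitz formula; otherwise the left side vanishes by
the dimension constraint and the right side by `coeff_sinhQuot_eq_zero`. -/
theorem weightSum_eq (hI : IsIntersectionNumbers I) {m n : ℕ} (hm : 2 ≤ m) (hn : 1 ≤ n)
    (b : Fin n → ℕ) (hb : ∀ i, 0 < b i) :
    (∑ i, b i : ℕ) ^ 2 * ((∏ i, (b i : ℚ)) * weightSum I m b) =
      (m.factorial : ℚ)⁻¹ * cutJoin^[m] onePoint (List.ofFn b) := by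
  have hl : List.ofFn b ≠ [] := fun h => by
    have := congrArg List.length h
    rw [List.length_ofFn, List.length_nil] at this
    omega
  by_cases h : ∃ g, m + 1 = 2 * g + n
  · obtain ⟨g, hg⟩ := h
    obtain rfl : m = 2 * g + n - 1 := by omega
    have h1 : weightSum I (2 * g + n - 1) b =
        hurwitz g b / ((∑ i, b i : ℕ) * (2 * g + n - 1).factorial : ℚ) := by
      rw [hI.hurwitz_eq g n hn (by omega) b hb, weightSum]
      symm
      -- The extra indices `g < j < m` contribute nothing: the dimension equation forces genus `g`,
      -- and the numbers vanish for `j > g`.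
      refine Finset.sum_subset_zero_on_sdiff (fun j hj => ?_) (fun j hj => ?_) fun j hj => ?_
      · rw [Finset.mem_range] at hj ⊢
        omega
      · rw [Finset.mem_sdiff, Finset.mem_range, Finset.mem_range] at hj
        split_ifs with h0
        · rw [Finset.sum_eq_zero, mul_zero]
          intro d hd
          rw [Finset.mem_piAntidiag] at hd
          have hd : ∑ i, d i = _ := hd.1
          rw [hI.eq_zero, zero_mul]
          rintro ⟨g', hg', h'⟩
          rw [List.length_ofFn, List.sum_ofFn] at h'
          omega
        · rfl
      · rw [Finset.mem_range] at hj
        rw [if_pos (by omega),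
          show 4 * g + n - 3 - 2 * j = 2 * (2 * g + n - 1) - 1 - 2 * j - n by omega]
    have hd : ((∑ i, b i : ℕ) : ℚ) ≠ 0 :=
      Nat.cast_ne_zero.2 (Finset.sum_pos (fun i _ => hb i) ⟨⟨0, hn⟩, Finset.mem_univ _⟩).ne'
    have hf : ((2 * g + n - 1).factorial : ℚ) ≠ 0 := Nat.cast_ne_zero.2 (Nat.factorial_ne_zero _)
    rw [h1, ← hurwitz_eq b g hn hb]
    field_simp
  · rw [cutJoin_iterate_onePoint m hl, coeff_sinhQuot_eq_zero hn h b, mul_zero, mul_zero]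
    suffices h0 : weightSum I m b = 0 by rw [h0, mul_zero, mul_zero]
    refine Finset.sum_eq_zero fun j hj => ?_
    rw [Finset.mem_range] at hj
    split_ifs with h0
    · rw [Finset.sum_eq_zero, mul_zero]
      intro d hd
      rw [Finset.mem_piAntidiag] at hd
      have hd : ∑ i, d i = _ := hd.1
      rw [hI.eq_zero, zero_mul]
      rintro ⟨g', hg', h'⟩
      rw [List.length_ofFn, List.sum_ofFn] at h'
      exact h ⟨g', by omega⟩
    · rfl

end Vanishing

variable {K : Type*} [Field K]

/-- The part of weight `2m` of `G`. -/
noncomputable def gPart (I : ℕ → List ℕ → ℚ) (u : K) (m : ℕ) : MvPowerSeries ℕ+ K :=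
  ∑ j ∈ Finset.range m, ∑ k ∈ tauExponents (2 * m - 1 - 2 * j),
    ((-1) ^ j * (I j (Finsupp.toMultiset k).toList : K) * u ^ (2 * j + 1)) • tauMon u k

theorem gPart_eq_zero {I : ℕ → List ℕ → ℚ} (hI : IsIntersectionNumbers I) (u : K) {m : ℕ}
    (hm : m < 2) : gPart I u m = 0 := by
  refine Finset.sum_eq_zero fun j hj => Finset.sum_eq_zero fun k hk => ?_
  rw [Finset.mem_range] at hj
  rw [mem_tauExponents] at hk
  have : I j (Finsupp.toMultiset k).toList = 0 := by
    by_contra h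
    obtain ⟨m', h1, h2, h3⟩ := hI.exists_weight h
    omega
  rw [this, Rat.cast_zero, mul_zero, zero_mul, zero_smul]

/-- The prefactor `u^(2j+1)` and the factors `(bᵢ u)^(dᵢ+1)` have total degree `2m` in `u`, and each
of the latter leaves one spare `bᵢ`. -/
theorem nPoint_gPart [CharZero K] {I : ℕ → List ℕ → ℚ} (hI : IsIntersectionNumbers I) {u : K}
    (hu : u ≠ 0) (m : ℕ) {n : ℕ} (b : Fin n → ℕ) :
    nPoint (pointOp u) constCoeff (gPart I u m) (List.ofFn b) =
      u ^ (2 * m) * (((∏ i, (b i : ℚ)) * weightSum I m b : ℚ) : K) := by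
  rw [gPart, nPoint_sum]
  simp only [nPoint_sum_tauMon hu b _
    fun k => (-1) ^ _ * (I _ (Finsupp.toMultiset k).toList : K) * u ^ (2 * _ + 1)]
  rw [weightSum]
  push_cast
  rw [Finset.mul_sum, Finset.mul_sum]
  refine Finset.sum_congr rfl fun j hj => ?_
  rw [Finset.mem_range] at hj
  split_ifs with h
  · push_cast
    simp only [Finset.mul_sum]
    refine Finset.sum_congr rfl fun d hd => ?_
    rw [Finset.mem_piAntidiag] at hd
    have hd : ∑ i, d i = _ := hd.1
    rw [hI.perm j (toList_perm_ofFn d)]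
    simp only [mul_pow, Finset.prod_mul_distrib]
    rw [Finset.prod_pow_eq_pow_sum, Finset.sum_add_distrib, hd]
    simp only [pow_succ _ (d _), Finset.prod_mul_distrib]
    have : 2 * m = 2 * j + 1 + (2 * m - 1 - 2 * j - n + ∑ _i : Fin n, 1) := by
      rw [Finset.sum_const, Finset.card_univ, Fintype.card_fin, smul_eq_mul]
      omega
    conv_rhs => rw [this, pow_add]
    ring
  · simp

theorem nPoint_X_one [CharZero K] {u : K} (hu : u ≠ 0) (l : List ℕ) :
    nPoint (pointOp u) constCoeff (u⁻¹ • X 1) l = ((onePoint l : ℚ) : K) := by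
  rw [nPoint_smul]
  have h0 : ∀ b, pointOp u b (1 : MvPowerSeries ℕ+ K) = 0 := fun b => by
    have := pointOp_mul u b (1 : MvPowerSeries ℕ+ K) 1
    simpa using this
  rcases l with _ | ⟨b, _ | ⟨c, l⟩⟩
  · simp [nPoint, constCoeff_apply, onePoint]
  · rw [nPoint_cons, pointOp_X_one, nPoint, map_smul, constCoeff_apply, map_one, smul_eq_mul,
      mul_one, onePoint, mul_left_comm, inv_mul_cancel₀ hu, mul_one, Rat.cast_natCast]
  · rw [nPoint_cons, nPoint_cons, pointOp_X_one, map_smul, h0, smul_zero, nPoint_zero, mul_zero,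
      onePoint, Rat.cast_zero]
    simp

theorem nPoint_iterate_Al [CharZero K] {u : K} (hu : u ≠ 0) (m : ℕ) (l : List ℕ) :
    nPoint (pointOp u) constCoeff ((Al u)^[m] (u⁻¹ • X 1)) l =
      u ^ (2 * m) * ((cutJoin^[m] onePoint l : ℚ) : K) := by
  induction m generalizing l with
  | zero => rw [Function.iterate_zero, id_eq, nPoint_X_one hu, mul_zero, pow_zero, one_mul]; rfl
  | succ m ih =>
    rw [Function.iterate_succ_apply', Function.iterate_succ_apply', nPoint_Al, funext ih]
    have h1 := map_cutJoin (AddMonoidHom.mulLeft (u ^ (2 * m))) l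
      fun l => ((cutJoin^[m] onePoint l : ℚ) : K)
    have h2 := map_cutJoin (Rat.castHom K).toAddMonoidHom l (cutJoin^[m] onePoint)
    simp only [AddMonoidHom.coe_mulLeft, RingHom.toAddMonoidHom_eq_coe, AddMonoidHom.coe_coe,
      Rat.coe_castHom] at h1 h2
    rw [← h1, ← h2]
    ring

/-- The homogeneous parts of the main theorem. -/
theorem eulerOp_eulerOp_gPart [CharZero K] {I : ℕ → List ℕ → ℚ} (hI : IsIntersectionNumbers I)
    {u : K} (hu : u ≠ 0) {m : ℕ} (hm : 2 ≤ m) :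
    eulerOp u (eulerOp u (gPart I u m)) = ((m.factorial : K)⁻¹) • (Al u)^[m] (u⁻¹ • X 1) := by
  rw [← sub_eq_zero]
  refine eq_zero_of_nPoint_eq_zero hu fun l hl => ?_
  rw [sub_eq_add_neg, ← neg_one_smul K, nPoint_add, nPoint_smul, nPoint_smul, nPoint_eulerOp hu,
    nPoint_eulerOp hu, nPoint_iterate_Al hu]
  revert l
  rw [List.forall_iff_forall_tuple]
  intro n b hb
  have hb : ∀ i, 0 < b i := fun i => hb _ ((List.mem_ofFn' b _).2 ⟨i, rfl⟩)
  rw [nPoint_gPart hI hu, List.sum_ofFn]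
  -- With no points the left side carries the factor `d = 0`, and the right side is a value of
  -- `cutJoin` at the empty list, as `m ≥ 1`.
  rcases Nat.eq_zero_or_pos n with rfl | hn
  · obtain ⟨m, rfl⟩ : ∃ m', m = m' + 1 := ⟨m - 1, by omega⟩
    rw [Function.iterate_succ_apply', List.ofFn_zero, cutJoin]
    simp
  · have h := congrArg (Rat.cast : ℚ → K) (weightSum_eq hI hm hn b hb)
    push_cast at h ⊢
    linear_combination (u ^ (2 * m)) * h

/-! ### The terms of weight at most two -/

/-- A first-order term of `M_a` sees `q_1` only if `i + j = a + 1`: never for `a = 0`, at `(1, 1)`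
for `a = 1`, at `(1, 2)` and `(2, 1)` for `a = 2`. -/
theorem Al_X_one [CharZero K] {u : K} (hu : u ≠ 0) :
    Al u (u⁻¹ • X 1) = u⁻¹ • (X 1 * X 2) + (X 1 : MvPowerSeries ℕ+ K) ^ 2 := by
  have hj : ∀ a, joinl a (X 1 : MvPowerSeries ℕ+ K) = 0 := fun a => by
    rw [joinl_apply, coeffSum_eq_sum (T := ∅), Finset.sum_empty]
    intro p _
    rw [Dl_q]
    split_ifs
    · rw [Dl_natCast, mul_zero]
    · rw [map_zero, mul_zero]
  have hp : ∀ i : ℕ+, (i : ℕ) = 1 ↔ i = 1 := fun i => PNat.coe_eq_one_iff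
  have hp2 : ∀ i : ℕ+, (i : ℕ) = 2 ↔ i = 2 := fun i =>
    ⟨fun h => PNat.eq h, fun h => by rw [h]; rfl⟩
  have h0 : cutl 0 (X 1 : MvPowerSeries ℕ+ K) = 0 := by
    rw [cutl_apply, coeffSum_eq_sum (T := ∅), Finset.sum_empty]
    rintro ⟨i, j⟩ _
    have := i.pos
    have := j.pos
    rw [Dl_q, PNat.one_coe, if_neg (by simp only; omega), mul_zero]
  have h1 : cutl 1 (X 1 : MvPowerSeries ℕ+ K) = X 1 * X 1 := by
    rw [cutl_apply, coeffSum_eq_sum (T := {(1, 1)}), Finset.sum_singleton]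
    · simp [Dl_q]
    rintro ⟨i, j⟩ h
    have := i.pos
    have := j.pos
    rw [Dl_q, PNat.one_coe, if_neg, mul_zero]
    intro h'
    simp only at h'
    refine h ?_
    rw [Finset.mem_singleton, Prod.mk.injEq, ← hp, ← hp]
    omega
  have h2 : cutl 2 (X 1 : MvPowerSeries ℕ+ K) = X 1 * X 2 + X 2 * X 1 := by
    rw [cutl_apply, coeffSum_eq_sum (T := {(1, 2), (2, 1)}), Finset.sum_pair (by decide)]
    · simp [Dl_q]
    rintro ⟨i, j⟩ h
    have := i.pos
    have := j.pos
    rw [Dl_q, PNat.one_coe, if_neg, mul_zero]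
    intro h'
    simp only at h'
    refine h ?_
    rw [Finset.mem_insert, Finset.mem_singleton, Prod.mk.injEq, Prod.mk.injEq, ← hp, ← hp,
      ← hp2, ← hp2]
    omega
  simp only [Al, Ml, LinearMap.add_apply, LinearMap.smul_apply, map_smul, hj, h0, h1, h2,
    smul_zero, add_zero]
  have e2 : (X 1 * X 2 + X 2 * X 1 : MvPowerSeries ℕ+ K) = (2 : K) • (X 1 * X 2) := by
    rw [two_smul, mul_comm (X 2)]
  rw [e2, smul_add, smul_smul, smul_smul, smul_smul, smul_smul, sq]
  congr 1
  · congr 1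
    field_simp
  · rw [show u⁻¹ * (2 * u) * (1 / 2) = (1 : K) by field_simp, one_smul]

end GJV

namespace GJV

open MvPowerSeries
open Finset.HasAntidiagonal (antidiagonal)

variable {K : Type*} [Field K]

/-! ### Weights -/

/-- The weight of a monomial in the `q_i`, where `q_i` has weight `i`. -/
noncomputable def qWeight : (ℕ+ →₀ ℕ) →+ ℕ := Finsupp.weight fun i : ℕ+ => (i : ℕ)

theorem qWeight_single (i : ℕ+) (m : ℕ) : qWeight (Finsupp.single i m) = m * i := by
  rw [qWeight, Finsupp.weight_single, smul_eq_mul]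

/-- A family of groups of scalars that is compatible with a parameter `u` of weight one. -/
structure WeightFamily (u : K) where
  /-- The scalars of weight `w`. -/
  scalars : ℤ → AddSubgroup K
  rat_mul_mem : ∀ (r : ℚ) {w : ℤ} {x : K}, x ∈ scalars w → (r : K) * x ∈ scalars w
  u_mul_mem : ∀ {w : ℤ} {x : K}, x ∈ scalars w → u * x ∈ scalars (w + 1)
  u_inv_mul_mem : ∀ {w : ℤ} {x : K}, x ∈ scalars w → u⁻¹ * x ∈ scalars (w - 1)

namespace WeightFamily

variable {u : K} (W : WeightFamily u)

/-- The series all of whose terms have weight `w`. -/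
def series (w : ℤ) : AddSubgroup (MvPowerSeries ℕ+ K) where
  carrier := {f | ∀ s, coeff s f ∈ W.scalars (w - qWeight s)}
  add_mem' hf hg s := by rw [map_add]; exact add_mem (hf s) (hg s)
  zero_mem' s := by rw [map_zero]; exact zero_mem _
  neg_mem' hf s := by rw [map_neg]; exact neg_mem (hf s)

variable {W} {w : ℤ} {f g : MvPowerSeries ℕ+ K}

theorem coeffSum_mem {ι : Type*} {a : ι → MvPowerSeries ℕ+ K} (h : ∀ i, a i ∈ W.series w) :
    coeffSum a ∈ W.series w := fun s => by
  rw [coeff_coeffSum]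
  exact finsum_induction (· ∈ W.scalars (w - qWeight s)) (zero_mem _)
    (fun _ _ hx hy => add_mem hx hy) fun i => h i s

theorem u_smul_mem (h : f ∈ W.series w) : u • f ∈ W.series (w + 1) := fun s => by
  rw [coeff_smul]
  have := W.u_mul_mem (h s)
  rwa [sub_add_eq_add_sub] at this

theorem u_inv_smul_mem (h : f ∈ W.series w) : u⁻¹ • f ∈ W.series (w - 1) := fun s => by
  rw [coeff_smul]
  have := W.u_inv_mul_mem (h s)
  rwa [sub_right_comm] at this

theorem rat_smul_mem (r : ℚ) (h : f ∈ W.series w) : (r : K) • f ∈ W.series w := fun s => by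
  rw [coeff_smul]
  exact W.rat_mul_mem r (h s)

theorem X_mul_mem (i : ℕ+) (h : f ∈ W.series w) : X i * f ∈ W.series (w + i) := fun s => by
  by_cases hs : s i = 0
  · rw [coeff_X_mul_eq_zero hs]
    exact zero_mem _
  · have hle : Finsupp.single i 1 ≤ s := by simpa using Nat.one_le_iff_ne_zero.2 hs
    obtain ⟨t, rfl⟩ := exists_add_of_le hle
    rw [X, coeff_add_monomial_mul, one_mul, map_add, qWeight_single, one_mul]
    have := h t
    rwa [show w - (qWeight t : ℤ) = w + i - ((i + qWeight t : ℕ) : ℤ) by push_cast; ring] at this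

theorem Dl_mem [CharZero K] (n : ℕ) (h : f ∈ W.series w) : Dl n f ∈ W.series (w - n) := by
  rcases Nat.eq_zero_or_pos n with rfl | hn
  · rw [Dl_zero]
    exact zero_mem _
  lift n to ℕ+ using hn
  intro s
  have h1 := W.rat_mul_mem ((n : ℕ) * (s n + 1) : ℚ) (h (s + Finsupp.single n 1))
  rw [map_add, qWeight_single, one_mul,
    show w - ((qWeight s + n : ℕ) : ℤ) = w - n - qWeight s by push_cast; ring] at h1
  rw [coeff_Dl, ← mul_assoc]
  push_cast at h1
  exact h1

theorem cast_weight_mem {w w' : ℤ} (h : f ∈ W.series w) (hw : w = w') : f ∈ W.series w' := hw ▸ h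

/-- The weight equation is required only for `n > 0`, which is what makes the truncated index in
`Λl` harmless. -/
theorem X_mul_Dl_mem [CharZero K] {n : ℕ} (i : ℕ+) (v : ℤ) (h : f ∈ W.series w) (hv : 0 < n → w - n + i = v) :
    X i * Dl n f ∈ W.series v := by
  rcases Nat.eq_zero_or_pos n with rfl | hn
  · rw [Dl_zero, LinearMap.zero_apply, mul_zero]
    exact zero_mem _
  · exact cast_weight_mem (X_mul_mem i (Dl_mem n h)) (hv hn)

theorem Λl_mem [CharZero K] (a : ℕ) (h : f ∈ W.series w) : Λl a f ∈ W.series (w + a) :=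
  coeffSum_mem fun i => X_mul_Dl_mem i _ h fun hn => by omega

theorem eulerOp_mem [CharZero K] (h : f ∈ W.series w) : eulerOp u f ∈ W.series w := by
  rw [eulerOp, LinearMap.add_apply, LinearMap.smul_apply]
  exact add_mem (cast_weight_mem (Λl_mem 0 h) (by simp))
    (cast_weight_mem (u_inv_smul_mem (Λl_mem 1 h)) (by simp))

section Mul

theorem one_mem (h1 : (1 : K) ∈ W.scalars 0) : (1 : MvPowerSeries ℕ+ K) ∈ W.series 0 := fun s => by
  classical
  rw [coeff_one]
  split_ifs with h
  · rw [h, map_zero]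
    exact h1
  · exact zero_mem _

/-- Multiplicativity is a hypothesis and not part of `WeightFamily`, since `avoidWeight` does not
have it. -/
theorem mul_mem {w w' : ℤ}
    (hmul : ∀ {v v' : ℤ} {x y : K}, x ∈ W.scalars v → y ∈ W.scalars v' → x * y ∈ W.scalars (v + v'))
    (hf : f ∈ W.series w) (hg : g ∈ W.series w') : f * g ∈ W.series (w + w') := fun s => by
  classical
  rw [coeff_mul]
  refine sum_mem fun p hp => ?_
  rw [Finset.HasAntidiagonal.mem_antidiagonal] at hp
  have := hmul (hf p.1) (hg p.2)
  rwa [← hp, map_add, show w + w' - ((qWeight p.1 + qWeight p.2 : ℕ) : ℤ) =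
    w - qWeight p.1 + (w' - qWeight p.2) by push_cast; ring]

theorem pow_mem (h1 : (1 : K) ∈ W.scalars 0)
    (hmul : ∀ {v v' : ℤ} {x y : K}, x ∈ W.scalars v → y ∈ W.scalars v' → x * y ∈ W.scalars (v + v'))
    (hf : f ∈ W.series w) (m : ℕ) : f ^ m ∈ W.series (m * w) := by
  induction m with
  | zero => rw [pow_zero, Nat.cast_zero, zero_mul]; exact one_mem h1
  | succ m ih =>
    rw [pow_succ]
    exact cast_weight_mem (mul_mem hmul ih hf) (by push_cast; ring)

theorem X_one_mem (h1 : (1 : K) ∈ W.scalars 0) :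
    (X 1 : MvPowerSeries ℕ+ K) ∈ W.series 1 := by
  have := X_mul_mem 1 (one_mem h1)
  simpa using this

theorem Tl_mem [CharZero K] (h1 : (1 : K) ∈ W.scalars 0) (k : ℕ) : Tl u k ∈ W.series (k + 1 : ℕ) := by
  induction k with
  | zero => exact X_one_mem h1
  | succ k ih =>
    rw [Tl]
    exact add_mem (cast_weight_mem (u_smul_mem (Λl_mem 0 ih)) (by push_cast; ring))
      (cast_weight_mem (Λl_mem 1 ih) (by push_cast; ring))

theorem tauMon_mem [CharZero K] (h1 : (1 : K) ∈ W.scalars 0)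
    (hmul : ∀ {v v' : ℤ} {x y : K}, x ∈ W.scalars v → y ∈ W.scalars v' → x * y ∈ W.scalars (v + v'))
    (k : ℕ →₀ ℕ) : tauMon u k ∈ W.series (tauWeight k) := by
  have h : ∀ S : Finset ℕ, ∏ i ∈ S, (((k i).factorial : K)⁻¹) • Tl u i ^ k i ∈
      W.series (∑ i ∈ S, k i * (i + 1) : ℕ) := by
    intro S
    induction S using Finset.induction_on with
    | empty => exact one_mem h1
    | insert a S ha ih =>
      rw [Finset.prod_insert ha, Finset.sum_insert ha, Nat.cast_add]
      refine mul_mem hmul ?_ ih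
      have := rat_smul_mem ((k a).factorial⁻¹ : ℚ) (pow_mem h1 hmul (Tl_mem h1 a) (k a))
      push_cast at this ⊢
      exact this
  have hk := h k.support
  rwa [show ∑ i ∈ k.support, k i * (i + 1) = tauWeight k from by
    rw [tauWeight, Finsupp.weight_apply]; rfl] at hk

end Mul

theorem u_pow_smul_mem (h : f ∈ W.series w) (m : ℕ) : u ^ m • f ∈ W.series (w + m) := by
  induction m with
  | zero => simpa using h
  | succ m ih =>
    rw [pow_succ', mul_smul]
    exact cast_weight_mem (u_smul_mem ih) (by push_cast; ring)

end WeightFamily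

end GJV

namespace GJV

open MvPowerSeries

variable {K : Type*} [Field K]

/-! ### The terms of the two series -/

/-- The terms of `G`. -/
noncomputable def gTerml (I : ℕ → List ℕ → ℚ) (u : K) (x : ℕ × (ℕ →₀ ℕ)) : MvPowerSeries ℕ+ K :=
  ((-1) ^ x.1 * (I x.1 (Finsupp.toMultiset x.2).toList : K) * u ^ (2 * x.1 + 1)) • tauMon u x.2

theorem gTerml_eq_zero {I : ℕ → List ℕ → ℚ} (u : K) {x : ℕ × (ℕ →₀ ℕ)}
    (h : I x.1 (Finsupp.toMultiset x.2).toList = 0) : gTerml I u x = 0 := by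
  rw [gTerml, h, Rat.cast_zero, mul_zero, zero_mul, zero_smul]

theorem gTerml_mem [CharZero K] {u : K} {W : WeightFamily u} (h1 : (1 : K) ∈ W.scalars 0)
    (hmul : ∀ {v v' : ℤ} {x y : K}, x ∈ W.scalars v → y ∈ W.scalars v' → x * y ∈ W.scalars (v + v'))
    (I : ℕ → List ℕ → ℚ) (x : ℕ × (ℕ →₀ ℕ)) :
    gTerml I u x ∈ W.series (2 * x.1 + 1 + tauWeight x.2 : ℕ) := by
  have := WeightFamily.rat_smul_mem ((-1) ^ x.1 * I x.1 (Finsupp.toMultiset x.2).toList)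
    (WeightFamily.u_pow_smul_mem (WeightFamily.tauMon_mem h1 hmul x.2) (2 * x.1 + 1))
  rw [smul_smul] at this
  push_cast at this
  exact WeightFamily.cast_weight_mem this (by push_cast; ring)

/-- The indices of the terms of weight `2m` of `G`. -/
noncomputable def gIndices (m : ℕ) : Finset (ℕ × (ℕ →₀ ℕ)) :=
  ((Finset.range m).sigma fun j => tauExponents (2 * m - 1 - 2 * j)).map
    (Equiv.sigmaEquivProd ℕ (ℕ →₀ ℕ)).toEmbedding

theorem mem_gIndices {m : ℕ} {x : ℕ × (ℕ →₀ ℕ)} (h : 2 * x.1 + 1 + tauWeight x.2 = 2 * m) :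
    x ∈ gIndices m := by
  refine Finset.mem_map.2 ⟨⟨x.1, x.2⟩, ?_, rfl⟩
  rw [Finset.mem_sigma, Finset.mem_range, mem_tauExponents]
  simp only
  omega

theorem gPart_eq_sum (I : ℕ → List ℕ → ℚ) (u : K) (m : ℕ) :
    gPart I u m = ∑ x ∈ gIndices m, gTerml I u x := by
  rw [gIndices, Finset.sum_map, Finset.sum_sigma]
  rfl

theorem gPart_mem [CharZero K] {u : K} {W : WeightFamily u} (h1 : (1 : K) ∈ W.scalars 0)
    (hmul : ∀ {v v' : ℤ} {x y : K}, x ∈ W.scalars v → y ∈ W.scalars v' → x * y ∈ W.scalars (v + v'))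
    (I : ℕ → List ℕ → ℚ) (m : ℕ) : gPart I u m ∈ W.series (2 * m : ℕ) := by
  refine sum_mem fun j hj => sum_mem fun k hk => ?_
  have := gTerml_mem h1 hmul I (j, k)
  rw [mem_tauExponents] at hk
  rw [Finset.mem_range] at hj
  refine WeightFamily.cast_weight_mem this ?_
  rw [hk]
  simp only
  omega

/-- `Al u` kills constants, so `c` survives only for `k = 0`; the part of `G` vanishes for `k < 2`,
which leaves the two explicit terms there. -/
theorem smul_iterate_Al [CharZero K] {I : ℕ → List ℕ → ℚ} (hI : IsIntersectionNumbers I)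
    {u : K} (hu : u ≠ 0) (c : K) (k : ℕ) :
    ((k.factorial : K)⁻¹) • (Al u)^[k] (C c + u⁻¹ • X 1) =
      (if k = 0 then C c + u⁻¹ • X 1 else 0) +
        (if k = 1 then u⁻¹ • (X 1 * X 2) + (X 1 : MvPowerSeries ℕ+ K) ^ 2 else 0) +
        eulerOp u (eulerOp u (gPart I u k)) := by
  have hC : Al u (C c : MvPowerSeries ℕ+ K) = 0 := by
    rw [← mul_one (C c), ← smul_eq_C_mul, map_smul, Al_one, smul_zero]
  have hk : ∀ m, (Al u)^[m + 1] (C c + u⁻¹ • X 1 : MvPowerSeries ℕ+ K) =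
      (Al u)^[m + 1] (u⁻¹ • X 1) := fun m => by
    rw [Function.iterate_succ_apply, Function.iterate_succ_apply, map_add, hC, zero_add]
  rcases k with _ | _ | k
  · rw [gPart_eq_zero hI u (by norm_num)]
    simp
  · rw [gPart_eq_zero hI u (by norm_num), hk, zero_add, Function.iterate_one, Al_X_one hu]
    simp
  · rw [if_neg (by omega), if_neg (by omega), hk, eulerOp_eulerOp_gPart hI hu (by omega)]
    simp

theorem tau_terms_eq (u c : K) (E : MvPowerSeries ℕ+ K) :
    C c + u⁻¹ • (X 1 + X 1 * X 2) + X 1 ^ 2 + E =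
      C c + u⁻¹ • X 1 + (u⁻¹ • (X 1 * X 2) + (X 1 : MvPowerSeries ℕ+ K) ^ 2) + E := by
  rw [smul_add]
  ring

/-! ### Formal sums over Laurent series -/

instance : CharZero (LaurentSeries ℂ) :=
  charZero_of_injective_ringHom (f := (HahnSeries.C : ℂ →+* LaurentSeries ℂ)) HahnSeries.C_injective

section HasFormalSum

variable {ι : Type*} {a a' : ι → Series} {S S' : Series}

theorem HasFormalSum.unique (h : HasFormalSum a S) (h' : HasFormalSum a S') : S = S' := by
  ext s e
  rw [(h s e).2, (h' s e).2]

theorem HasFormalSum.formalSum_eq (h : HasFormalSum a S) : formalSum a = S := by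
  have hs : FormallySummable a := ⟨S, h⟩
  rw [formalSum, dif_pos hs]
  exact hs.choose_spec.unique h

theorem FormallySummable.hasFormalSum (h : FormallySummable a) : HasFormalSum a (formalSum a) := by
  rw [formalSum, dif_pos h]
  exact h.choose_spec

theorem HasFormalSum.add (h : HasFormalSum a S) (h' : HasFormalSum a' S') :
    HasFormalSum (fun i => a i + a' i) (S + S') := by
  intro s e
  simp only [map_add, HahnSeries.coeff_add]
  refine ⟨((h s e).1.union (h' s e).1).subset fun i hi => ?_, ?_⟩
  · by_contra h0
    simp only [Set.mem_union, Set.mem_ofPred_eq, not_or, not_not] at h0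
    exact hi (by rw [h0.1, h0.2, add_zero])
  · rw [(h s e).2, (h' s e).2]
    exact (finsum_add_distrib (h s e).1 (h' s e).1).symm

theorem hasFormalSum_ite [DecidableEq ι] (i : ι) (f : Series) :
    HasFormalSum (fun k => if k = i then f else 0) f := by
  have h0 : ∀ s e k, k ≠ i → (coeff s (if k = i then f else 0)).coeff e = 0 := fun s e k hk => by
    rw [if_neg hk, map_zero, HahnSeries.coeff_zero]
  intro s e
  refine ⟨(Set.finite_singleton i).subset fun k hk => ?_, ?_⟩
  · by_contra h
    exact hk (h0 s e k h)
  · rw [finsum_eq_single _ i (h0 s e), if_pos rfl]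

/-- Coefficientwise finiteness alone does not make the sum a Laurent series; the exponents of `u`
must also be bounded below, uniformly in the family. -/
theorem formallySummable_of_bddBelow
    (h : ∀ s e, {i | (coeff s (a i)).coeff e ≠ 0}.Finite)
    (hb : ∀ s, ∃ N : ℤ, ∀ e i, (coeff s (a i)).coeff e ≠ 0 → N ≤ e) : FormallySummable a := by
  have hs : ∀ s, BddBelow (Function.support fun e => ∑ᶠ i, (coeff s (a i)).coeff e) := fun s => by
    obtain ⟨N, hN⟩ := hb s
    refine ⟨N, fun e he => ?_⟩
    by_contra h0
    refine he (finsum_eq_zero_of_forall_eq_zero fun i => ?_)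
    by_contra hi
    exact h0 (hN e i hi)
  exact ⟨fun s => HahnSeries.ofSuppBddBelow _ (hs s), fun s e => ⟨h s e, rfl⟩⟩

theorem CoeffFinite.hasFormalSum (h : CoeffFinite a) : HasFormalSum a (coeffSum a) := by
  intro s e
  constructor
  · refine (h s).subset fun i hi h0 => hi ?_
    rw [h0]; rfl
  · rw [coeff_coeffSum]
    exact (HahnSeries.coeff.addMonoidHom e : LaurentSeries ℂ →+ ℂ).map_finsum (h s)

theorem CoeffFinite.formalSum_eq (h : CoeffFinite a) : formalSum a = coeffSum a :=
  h.hasFormalSum.formalSum_eq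

end HasFormalSum

theorem D_eq (n : ℕ) (f : Series) : D n f = Dl n f := by
  unfold D
  split_ifs with h
  · rw [Dl_apply h]
  · rw [Dl, dif_neg h]; rfl

theorem Λ_eq (a : ℕ) (f : Series) : Λ a f = Λl a f := by
  unfold Λ
  simp only [D_eq]
  exact (coeffFinite_q_mul_self _).formalSum_eq

theorem M_eq (a : ℕ) (f : Series) : M a f = Ml a f := by
  change _ + _ • formalSum (fun p => q (addIdx a p) * D p.1 (D p.2 f)) = _
  simp only [D_eq]
  rw [(coeffFinite_q_mul_q_mul fun p => Dl (p.1 + p.2 - a) f).formalSum_eq,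
    (coeffFinite_q_addIdx_mul a fun p => Dl p.1 (Dl p.2 f)).formalSum_eq]
  rfl

end GJV

namespace GJV

open MvPowerSeries

/-! ### Weights over Laurent series -/

theorem u_ne_zero : u ≠ 0 := HahnSeries.single_ne_zero one_ne_zero

theorem coeff_ratCast_mul (r : ℚ) (x : LaurentSeries ℂ) (e : ℤ) :
    ((r : LaurentSeries ℂ) * x).coeff e = r * x.coeff e := by
  rw [← map_ratCast (HahnSeries.C : ℂ →+* LaurentSeries ℂ) r, HahnSeries.C_mul_eq_smul]
  rfl

theorem coeff_u_mul (x : LaurentSeries ℂ) (e : ℤ) : (u * x).coeff e = x.coeff (e - 1) := by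
  rw [HahnSeries.coeff_single_mul, one_mul]

theorem coeff_u_inv_mul (x : LaurentSeries ℂ) (e : ℤ) : (u⁻¹ * x).coeff e = x.coeff (e + 1) := by
  rw [HahnSeries.inv_single, HahnSeries.coeff_single_mul, inv_one, one_mul, sub_neg_eq_add]

/-- The Laurent series that are multiples of a power of `u`. -/
noncomputable def pureWeight : WeightFamily u where
  scalars w :=
    { carrier := {x | ∀ e, x.coeff e ≠ 0 → e = w}
      add_mem' := fun {x y} hx hy e he => by
        by_contra h
        exact he (by rw [HahnSeries.coeff_add, not_not.1 (mt (hx e) h), not_not.1 (mt (hy e) h),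
          add_zero])
      zero_mem' := fun e he => absurd HahnSeries.coeff_zero he
      neg_mem' := fun {x} hx e he => hx e (by rwa [HahnSeries.coeff_neg, neg_ne_zero] at he) }
  rat_mul_mem r _ x hx e he := hx e fun h => he (by rw [coeff_ratCast_mul, h, mul_zero])
  u_mul_mem hx e he := by
    rw [coeff_u_mul] at he
    rw [← hx _ he, sub_add_cancel]
  u_inv_mul_mem hx e he := by
    rw [coeff_u_inv_mul] at he
    rw [← hx _ he, add_sub_cancel_right]

/-- The Laurent series in which a given power of `u` does not occur. -/
noncomputable def avoidWeight : WeightFamily u where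
  scalars w :=
    { carrier := {x | x.coeff w = 0}
      add_mem' := fun {x y} hx hy => by
        rw [Set.mem_ofPred_eq] at hx hy ⊢
        rw [HahnSeries.coeff_add, hx, hy, add_zero]
      zero_mem' := HahnSeries.coeff_zero
      neg_mem' := fun {x} hx => by
        rw [Set.mem_ofPred_eq] at hx ⊢
        rw [HahnSeries.coeff_neg, hx, neg_zero] }
  rat_mul_mem r w x hx := by
    change (_ * x).coeff w = 0
    rw [coeff_ratCast_mul, show x.coeff w = 0 from hx, mul_zero]
  u_mul_mem {w x} hx := by
    change (_ * x).coeff _ = 0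
    rw [coeff_u_mul, add_sub_cancel_right]
    exact hx
  u_inv_mul_mem {w x} hx := by
    change (_ * x).coeff _ = 0
    rw [coeff_u_inv_mul, sub_add_cancel]
    exact hx

theorem mem_avoidWeight {w : ℤ} {x : LaurentSeries ℂ} :
    x ∈ avoidWeight.scalars w ↔ x.coeff w = 0 := Iff.rfl

theorem one_mem_pureWeight : (1 : LaurentSeries ℂ) ∈ pureWeight.scalars 0 := fun e he => by
  by_contra h
  exact he (HahnSeries.coeff_single_of_ne h)

theorem mul_mem_pureWeight {v v' : ℤ} {x y : LaurentSeries ℂ} (hx : x ∈ pureWeight.scalars v)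
    (hy : y ∈ pureWeight.scalars v') : x * y ∈ pureWeight.scalars (v + v') := by
  have h : ∀ {v : ℤ} {x : LaurentSeries ℂ}, x ∈ pureWeight.scalars v →
      x = HahnSeries.single v (x.coeff v) := fun {v x} hx => by
    ext e
    by_cases he : e = v
    · rw [he, HahnSeries.coeff_single_same]
    · rw [HahnSeries.coeff_single_of_ne he]
      exact not_not.1 (mt (hx e) he)
  rw [h hx, h hy, HahnSeries.single_mul_single]
  intro e he
  by_contra h0
  exact he (HahnSeries.coeff_single_of_ne h0)

theorem weight_of_coeff_ne_zero {f : Series} {w : ℤ} (hf : f ∈ pureWeight.series w) {s : ℕ+ →₀ ℕ}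
    {e : ℤ} (h : (coeff s f).coeff e ≠ 0) : e + qWeight s = w := by
  rw [hf s e h, sub_add_cancel]

theorem coeff_eq_of_sub_mem {f g : Series} {w : ℤ} (h : f - g ∈ avoidWeight.series w)
    {s : ℕ+ →₀ ℕ} {e : ℤ} (he : e + qWeight s = w) :
    (coeff s f).coeff e = (coeff s g).coeff e := by
  have h1 := h s
  rw [mem_avoidWeight, ← he, add_sub_cancel_right, map_sub, HahnSeries.coeff_sub] at h1
  exact sub_eq_zero.1 h1

/-! ### The series `G` -/

theorem T_eq (k : ℕ) : T k = Tl u k := by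
  induction k with
  | zero => rfl
  | succ k ih =>
    change u • Λ 0 (T k) + Λ 1 (T k) = _
    rw [Λ_eq, Λ_eq, ih]
    rfl

theorem gTerm_eq (I : ℕ → List ℕ → ℚ) : gTerm I = gTerml I u := by
  funext x
  unfold gTerm gTerml
  simp only [T_eq]
  rfl

theorem weight_gTerm {I : ℕ → List ℕ → ℚ} {x : ℕ × (ℕ →₀ ℕ)} {s : ℕ+ →₀ ℕ} {e : ℤ}
    (h : (coeff s (gTerm I x)).coeff e ≠ 0) :
    e + qWeight s = (2 * x.1 + 1 + tauWeight x.2 : ℕ) := by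
  rw [gTerm_eq] at h
  exact weight_of_coeff_ne_zero (gTerml_mem one_mem_pureWeight mul_mem_pureWeight I x) h

/-- A term contributes to a coefficient only if its weight matches. This bounds `j` and the weight
of `k`, hence leaves finitely many indices, and it keeps the exponents of `u` above `-qWeight s`. -/
theorem formallySummable_gTerm (I : ℕ → List ℕ → ℚ) : FormallySummable (gTerm I) := by
  refine formallySummable_of_bddBelow (fun s e => ?_) fun s => ⟨-qWeight s, fun e x h => ?_⟩
  · refine ((Finset.range ((e + qWeight s).toNat + 1)).finite_toSet.biUnion fun N _ =>
      (Finset.range (N + 1)).finite_toSet.prod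
        ((Finset.range (N + 1)).finite_toSet.biUnion fun n _ => finite_tauWeight n)).subset
      fun x h => ?_
    have := weight_gTerm h
    simp only [Set.mem_iUnion, Set.mem_prod, Finset.mem_coe, Finset.mem_range, Set.mem_ofPred_eq]
    exact ⟨(e + qWeight s).toNat, by omega, by omega, tauWeight x.2, by omega, rfl⟩
  · have := weight_gTerm h
    omega

theorem coeff_G (I : ℕ → List ℕ → ℚ) (s : ℕ+ →₀ ℕ) (e : ℤ) :
    (coeff s (G I)).coeff e = ∑ᶠ x, (coeff s (gTerm I x)).coeff e :=
  ((formallySummable_gTerm I).hasFormalSum s e).2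

theorem G_sub_gPart_mem (I : ℕ → List ℕ → ℚ) (m : ℕ) :
    G I - gPart I u m ∈ avoidWeight.series (2 * m : ℕ) := fun s => by
  rw [mem_avoidWeight, map_sub, HahnSeries.coeff_sub, coeff_G, sub_eq_zero, gPart_eq_sum, map_sum,
    HahnSeries.coeff_sum]
  simp only [← gTerm_eq]
  refine finsum_eq_sum_of_support_subset _ fun x hx => mem_gIndices ?_
  have := weight_gTerm hx
  omega

theorem G_mem_avoidWeight {I : ℕ → List ℕ → ℚ} (hI : IsIntersectionNumbers I) {w : ℤ}
    (hw : ∀ m : ℕ, w ≠ (2 * m : ℕ)) : G I ∈ avoidWeight.series w := fun s => by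
  rw [mem_avoidWeight, coeff_G]
  refine finsum_eq_zero_of_forall_eq_zero fun x => ?_
  by_contra h
  have h1 := weight_gTerm h
  have h2 : I x.1 (Finsupp.toMultiset x.2).toList ≠ 0 := fun h0 => h (by
    rw [gTerm_eq, gTerml_eq_zero u h0, map_zero, HahnSeries.coeff_zero])
  obtain ⟨m, -, -, h3⟩ := hI.exists_weight h2
  exact hw m (by omega)

/-- A coefficient has one weight `e + qWeight s`, so at most one `m` contributes. There `G` may be
replaced by its part of that weight before applying `eulerOp`, because `eulerOp` preserves
`avoidWeight`; no interchange with the infinite sum is needed. -/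
theorem hasFormalSum_eulerOp_gPart {I : ℕ → List ℕ → ℚ} (hI : IsIntersectionNumbers I) :
    HasFormalSum (fun m => eulerOp u (eulerOp u (gPart I u m))) (eulerOp u (eulerOp u (G I))) := by
  have hm : ∀ m, eulerOp u (eulerOp u (gPart I u m)) ∈ pureWeight.series (2 * m : ℕ) := fun m =>
    WeightFamily.eulerOp_mem (WeightFamily.eulerOp_mem
      (gPart_mem one_mem_pureWeight mul_mem_pureWeight I m))
  intro s e
  by_cases h : ∃ m : ℕ, e + qWeight s = (2 * m : ℕ)
  · obtain ⟨m, hw⟩ := h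
    have h0 : ∀ k, k ≠ m → (coeff s (eulerOp u (eulerOp u (gPart I u k)))).coeff e = 0 := by
      intro k hk
      by_contra h
      have := weight_of_coeff_ne_zero (hm k) h
      omega
    refine ⟨(Set.finite_singleton m).subset fun k hk => ?_, ?_⟩
    · by_contra h
      exact hk (h0 k h)
    · rw [finsum_eq_single _ m h0]
      refine coeff_eq_of_sub_mem ?_ hw
      rw [← map_sub, ← map_sub]
      exact WeightFamily.eulerOp_mem (WeightFamily.eulerOp_mem (G_sub_gPart_mem I m))
  · push Not at h
    have h0 : ∀ k, (coeff s (eulerOp u (eulerOp u (gPart I u k)))).coeff e = 0 := by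
      intro k
      by_contra h'
      exact h k (weight_of_coeff_ne_zero (hm k) h')
    refine ⟨Set.finite_empty.subset fun k hk => hk (h0 k), ?_⟩
    rw [finsum_eq_zero_of_forall_eq_zero h0]
    have := WeightFamily.eulerOp_mem (WeightFamily.eulerOp_mem (G_mem_avoidWeight hI h)) s
    rwa [mem_avoidWeight, add_sub_cancel_right] at this

theorem tau_eq (I : ℕ → List ℕ → ℚ) (c : LaurentSeries ℂ) :
    tau I c = C c + u⁻¹ • q 1 + (u⁻¹ • (q 1 * q 2) + q 1 ^ 2) + eulerOp u (eulerOp u (G I)) := by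
  have h : ∀ f : Series, (Λ 0 + u⁻¹ • Λ 1) f = eulerOp u f := fun f => by
    change Λ 0 f + u⁻¹ • Λ 1 f = _
    rw [Λ_eq, Λ_eq]
    rfl
  rw [tau, Function.iterate_succ_apply, Function.iterate_one, h, h]
  exact tau_terms_eq u c _

theorem hasFormalSum_expTerm {I : ℕ → List ℕ → ℚ} (hI : IsIntersectionNumbers I)
    (c : LaurentSeries ℂ) :
    HasFormalSum (expTerm (M 2 + (2 * u) • M 1 + u ^ 2 • M 0) (C c + u⁻¹ • q 1)) (tau I c) := by
  have hA : M 2 + (2 * u) • M 1 + u ^ 2 • M 0 = (Al u : Module.End (LaurentSeries ℂ) Series) := by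
    funext f
    change M 2 f + (2 * u) • M 1 f + u ^ 2 • M 0 f = _
    rw [M_eq, M_eq, M_eq]
    rfl
  have h : expTerm (M 2 + (2 * u) • M 1 + u ^ 2 • M 0) (C c + u⁻¹ • q 1) = fun k =>
      (if k = 0 then C c + u⁻¹ • q 1 else 0) + (if k = 1 then u⁻¹ • (q 1 * q 2) + q 1 ^ 2 else 0) +
        eulerOp u (eulerOp u (gPart I u k)) := by
    rw [hA]
    funext k
    exact smul_iterate_Al hI u_ne_zero c k
  rw [h, tau_eq]
  exact ((hasFormalSum_ite 0 _).add (hasFormalSum_ite 1 _)).add (hasFormalSum_eulerOp_gPart hI)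

end GJV

theorem theorem2 :
    (∃! I : ℕ → List ℕ → ℚ, GJV.IsIntersectionNumbers I) ∧
    ∀ I : ℕ → List ℕ → ℚ, GJV.IsIntersectionNumbers I →
      GJV.FormallySummable (GJV.gTerm I) ∧
      ∀ c : LaurentSeries ℂ,
        GJV.FormallySummable (GJV.expTerm
          (GJV.M 2 + (2 * GJV.u) • GJV.M 1 + GJV.u ^ 2 • GJV.M 0)
          (MvPowerSeries.C c + GJV.u⁻¹ • GJV.q 1)) ∧
        GJV.tau I c = GJV.formalExp
          (GJV.M 2 + (2 * GJV.u) • GJV.M 1 + GJV.u ^ 2 • GJV.M 0)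
          (MvPowerSeries.C c + GJV.u⁻¹ • GJV.q 1) := by
  refine ⟨GJV.existsUnique_intersectionNumbers, fun I hI => ⟨GJV.formallySummable_gTerm I, fun c => ?_⟩⟩
  have h := GJV.hasFormalSum_expTerm hI c
  exact ⟨⟨_, h⟩, h.formalSum_eq.symm⟩
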